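/- **Setting.** Let $F$ be a finite extension of $\mathbb Q_p$, $p\neq 2$, with residue field $\mathbb F_q$ and uniformizer $\varpi$; fix an embedding $F\hookrightarrow\mathbb C$, through which eigenvalues are regarded as complex numbers. Let $\chi$ be a semisimple element of $Sp(2n,\mathbb C)$ whose eigenvalues are roots of unity of order prime to $p$, with $mult(u^q)=mult(u)$, and let $g_s$ be a semisimple element of the special orthogonal group of a non-degenerate quadratic space of dimension $2n+1$ over $F$ whose eigenvalues are roots of unity of order prime to $p$. The packet $[u]$ is the orbit of $u$ under $u\mapsto u^q$; we assume $u^{-1}\in[u]$ for all eigenvalues of $\chi$ and of $g_s$ (for $g_s$ this follows from ellipticity). Let $m(\cdot)$ denote multiplicities, $\ell_{[u]}=\frac12|[u]|$ if $u\ne\pm1$, $\ell_{[\pm1]}=1$. The packets $\{1\},\{-1\}$ are always included, possibly with multiplicity $0$. The superscripts $\delta,i,j$ run over $\{','' \}$. For $N\ge 0$ let $W_N=\{\pm1\}^N\rtimes\mathfrak S_N$ and let $sgn_{CD}$ be its character "product of the signs"; conjugacy classes of $W_N$ are given by the positive and negative cycles. For a product $\mathcal W$ of groups $\mathfrak S_N$,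 $W_N$, $\mathbb C[\hat{\mathcal W}]$ is the space of class functions. Restriction along a map between sets of conjugacy classes is pull-back, induction is its adjoint for the usual scalar products. **Cuspidal data.** $cusp$ consists of odd integers $I_\pm\ge1$, even integers $P_\pm\geq 0$ and signs $\zeta_\pm$, with $\zeta_\epsilon=(-1)^{(I_\epsilon-1)/2}$ if $P_\epsilon=0$; $\widetilde{cusp}$ is obtained by replacing $\zeta_\epsilon$ by $\tilde\zeta_\epsilon=(-1)^{(I_\epsilon-1)/2}\zeta_\epsilon$. Let $\epsilon_I$ (resp. $\epsilon_P$) be the sign with $I_{\epsilon_I}>I_{-\epsilon_I}$ (resp. $P_{\epsilon_P}>P_{-\epsilon_P}$); if only one of these differences vanishes put $\epsilon_I=\epsilon_P$, and $\epsilon_I=\epsilon_P=+$ if both vanish. Let $\tilde\chi_\epsilon=1$ if $I_\epsilon>P_\epsilon$ and $\tilde\chi_\epsilon=sgn_{CD}$ otherwise. Let $|r|'_{+},|r|'_{-}$ be the pair $\frac{I_++I_-}2,\frac{|I_+-I_-|}2$ ordered so that $|r|'_+$ is odd, and $|r|''_+,|r|''_-$ the pair $\frac{P_++P_-}2,\frac{|P_+-P_-|}2$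 ordered so that $|r|''_+$ is the first of these two numbers if and only if $\zeta_+\zeta_-=(-1)^{1+(I_++I_-)/2}$. **Spaces.** $\mathbb C[\hat{\mathcal W}_{D(\chi)}]_{cusp}=\bigoplus_{\underline n}\mathbb C[\hat{\mathcal W}_{\underline n}]$, where $\underline n$ runs over the families of pairs $(n'[u],n''[u])$ with $n'[u]+n''[u]=m([u])$ for $u\ne\pm1$, and $(N'_\epsilon,N''_\epsilon)$ with $N'_\epsilon+N''_\epsilon+\frac{I_\epsilon^2+P_\epsilon^2-1}4=\frac{m(\epsilon)}2$ for $\epsilon=\pm1$, and $\mathcal W_{\underline n}=\prod_{u\neq\pm1}\mathfrak S_{n'[u]}\times\mathfrak S_{n''[u]}\times\prod_\epsilon W_{N'_\epsilon}\times W_{N''_\epsilon}$. $\mathbb C[\hat{\mathcal W}_{D(g_s)}]$ is defined in the same way with the packets $[\lambda]$ of $g_s$: $m'(\lambda)+m''(\lambda)=m(\lambda)$ for $\lambda\ne\pm1$ and, with $m'(\epsilon)=2N'_\epsilon+(|r|'_\epsilon)^2$, $m''(\epsilon)=2N''_\epsilon+(|r|''_\epsilon)^2$, also $m'(\epsilon)+m''(\epsilon)=m(\epsilon)$.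 **The maps.** (a) $\rho\circ\iota:\mathbb C[\hat{\mathcal W}_{D(\chi)}]_{cusp}\to\mathbb C[\hat{\mathcal W}_{D(\chi)}]_{\widetilde{cusp}}$ is the sum over all quadruples $(n^{i,j})$, with $\sum_jn^{i,j}=n^i$ at the source and $\sum_in^{i,j}$ at the target, for all packets, of: restrict to the product of the groups of ranks $n^{i,j}$; multiply by $\prod_{u\ne\pm1}(-1)^{n^{'',''}[u]}$ and, for each $\epsilon=\pm1$, by $1$ on $W_{N_\epsilon^{','}}$, $sgn_{CD}^{(1-\zeta_\epsilon)/2}$ on $W_{N_\epsilon^{',''}}$, $\tilde\chi_\epsilon$ on $W_{N_\epsilon^{'','}}$, $\tilde\chi_\epsilon sgn_{CD}^{(1+\zeta_\epsilon)/2}$ on $W_{N_\epsilon^{'',''}}$; exchange the second and third factors and induce. (b) $\rho\circ\iota$ on $\mathbb C[\hat{\mathcal W}_{D(g_s)}]$ is defined in the same way with the twist $\prod_{\lambda\ne\pm1}(-1)^{m^{'',''}(\lambda)}$ times $sgn_{CD}$ on $W_{N_+^{'',''}}\times W_{N_-^{'',''}}$. (c) The map $\tilde{\ }:\mathbb C[\hat{\mathcal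 W}_{D(\chi)}]_{cusp}\to\mathbb C[\hat{\mathcal W}_{D(\chi)}]_{\widetilde{cusp}}$ is the multiplication by $\tilde\chi_+\otimes\tilde\chi_-$ on $W_{N''_+}\times W_{N''_-}$. (d) $\Lambda$ on $\mathbb C[\hat{\mathcal W}_{D(\chi)}]_{\widetilde{cusp}}$ is the multiplication by the normalising character, equal to $sgn_{CD}^{(1-\zeta_\epsilon)/2}$ on $W_{N''_\epsilon}$ and trivial on the other factors. (e) For $\epsilon=\pm1$, $X_\epsilon$ on $\mathbb C[\hat{\mathcal W}_{D(g_s)}]$ tensors by $sgn_{CD}$ on $W_{N''_\epsilon}$ and then exchanges the factors $W_{N'_\epsilon}$, $W_{N''_\epsilon}$; and $$X_{cusp}=\begin{cases}1&\epsilon_I=\epsilon_P,\ \zeta_{\epsilon_P}=+\\X_+X_-&\epsilon_I=\epsilon_P,\ \zeta_{\epsilon_P}=-\\X_{(-1)^{1+(I_++I_-)/2}}&\epsilon_I\neq\epsilon_P,\ \zeta_{\epsilon_P}=-\\X_{(-1)^{(I_++I_-)/2}}&\epsilon_I\ne\epsilon_P,\ \zeta_{\epsilon_P}=+.\end{cases}$$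 (f) $loc_{g_s}:\mathbb C[\hat{\mathcal W}_{D(\chi)}]_{\widetilde{cusp}}\to\mathbb C[\hat{\mathcal W}_{D(g_s)}]$. For a family of non-negative integers $\underline\nu=(\nu^\delta([u],[\lambda]))$ let $\mathcal W_{\underline\nu}$ be the product of the groups $W_{\nu^\delta([u],[\lambda])}$ if $u,\lambda\in\{\pm1\}$, $\mathfrak S_{\nu^\delta([u],[\lambda])}$ otherwise. A cycle of length $\alpha$ is sent into the factor of index $[u]$ (resp. $[\lambda]$) as follows. If $u,\lambda\neq\pm1$, put $d=(\ell_{[u]},\ell_{[\lambda]})$ and $f=1$ if $\ell_{[u]},\ell_{[\lambda]}$ are divisible by the same power of $2$, $f=2$ otherwise: the image is a cycle of length $f\alpha\ell_{[\lambda]}/d$ (resp. $f\alpha\ell_{[u]}/d$). If $u=\pm1$, $\lambda\ne\pm1$: a cycle of length $\alpha\ell_{[\lambda]}$ of sign $(-1)^\alpha$ (resp. of length $\alpha$); symmetrically if $u\neq\pm1$, $\lambda=\pm1$. If $u,\lambda\in\{\pm1\}$ the cycle and its sign are unchanged. Then $loc_{g_s}$ is the sum over all $\underline\nu$ of: restrict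 from $\mathcal W_{\underline n}$ to $\mathcal W_{\underline\nu}$, multiply by $\chi'_{cusp,\underline\nu}\,\chi''_{cusp,\underline\nu}\prod_{\delta,[u],[\lambda]}\chi^\delta_{[u],[\lambda]}$, induce to $\mathcal W_{\underline m}$, for the $\underline n,\underline m$ determined by $\underline\nu$. Here * for $u,\lambda\ne\pm1$, on an element with cycles $\alpha_1,\dots,\alpha_r$, $\chi^\delta_{[u],[\lambda]}=\prod_s\frac{f}{d\,\ell_{[\lambda]}}\sum_{0\le k<\ell_{[\lambda]}}(\lambda^{\alpha_sq^k}+\lambda^{-\alpha_sq^k})$; for $u=\pm1\neq\lambda$ it is $1$ if $u=1$ and $(-1)^{\nu^\delta([u],[\lambda])(1+q^{\ell_{[\lambda]}})/2}$ if $u=-1$, and symmetrically for $\lambda=\pm1$, $u\ne\pm1$; for $u,\lambda\in\{\pm1\}$ it is $1$, except that it is $sgn_{CD}\cdot(-1)^{\nu^\delta([u],[\lambda])(q-1)/2}$ if $u=\lambda=-1$; * $\chi^\delta_{\epsilon'}(w)=(-1)^{\sum_{u\ne\pm1}\nu^\delta([u],\epsilon')}\,sgn_{CD}(w_{\nu^\delta(+,\epsilon')})\,sgn_{CD}(w_{\nu^\delta(-,\epsilon')})$,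 and $\eta'_{\epsilon'},\eta''_{\epsilon'}$ are the signs of the discriminants $(-1)^{\lfloor d/2\rfloor}\det$ of the two residue forms (unit part, and $\varpi$-part divided by $\varpi$) of the quadratic form on the $\epsilon'$-eigenspace of $g_s$; * with fixed integers $x',x''\geq0$, $r'$ the odd one of $\frac{I_++I_-}2,\frac{|I_+-I_-|}2$, $r''_\pm=\frac12(\tilde\zeta_+P_+\pm\tilde\zeta_-P_-)$, and $y''=r''_+$ if this is even, $y''=r''_--1$ otherwise, $$\chi'_{cusp,\underline\nu}=q^{x'}(-1)^{(q-1)(r'-1)/4}(\chi'_+\chi'_-\eta'_+\eta'_-)^{(I_{\epsilon_I}-1)/2}\times\begin{cases}1&\epsilon_I=+\\\eta'_-\chi'_-&\epsilon_I=-,\end{cases}$$ $$\chi''_{cusp,\underline\nu}=q^{x''}(-1)^{y''(q-1)/4}(\eta''_+\eta''_-\chi''_+\chi''_-)^{(I_{\epsilon_P}-1)/2}\times\begin{cases}1&\zeta_{\epsilon_P}=+,\epsilon_P=+\\\eta''_-\chi''_-&\zeta_{\epsilon_P}=+,\epsilon_P=-\\\eta''_+\chi''_+&\zeta_{\epsilon_P}=-,\epsilon_P=-\\\eta''_+\eta''_-\chi''_+\chi''_-&\zeta_{\epsilon_P}=-,\epsilon_P=+.\end{cases}$$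 **Lemma.** For every $\phi\in\mathbb C[\hat{\mathcal W}_{D(\chi)}]_{cusp}$, $$loc_{g_s}\bigl(\Lambda\,(\rho\circ\iota)(\phi)\bigr)=(\rho\circ\iota)\bigl(X_{cusp}\,loc_{g_s}(\tilde\phi)\bigr).$$ In particular $loc_{g_s}\circ\rho\circ\iota=\rho\circ\iota\circ X_{cusp}\circ loc_{g_s}\circ\tilde{\ }$ when $\zeta_+=\zeta_-=+$. -/

import Mathlib

open scoped Polynomial ValuativeRel

noncomputable section

namespace LevelZero

/-! ## Weyl groups and their class functions -/

/-- The two kinds of Weyl groups in use: symmetric groups `𝔖_N` (kind `A`) and the Weyl groups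
`W_N` of type `C` (kind `C`). -/
inductive Kind
  | A
  | C

/-- The Weyl group of type `C` and rank `N`, i.e. `{±1}^N ⋊ 𝔖_N`: the pair `(s, σ)` is the signed
permutation `i ↦ s (σ i) · σ i`. -/
abbrev WeylC (N : ℕ) : Type :=
  SemidirectProduct (Fin N → ℤˣ) (Equiv.Perm (Fin N)) mulAutArrow

/-- `𝔖_N` for the kind `A`, `W_N` for the kind `C`. -/
def WeylGroup : Kind → ℕ → Type
  | .A, N => Equiv.Perm (Fin N)
  | .C, N => WeylC N

instance instGroupWeylGroup : ∀ (t : Kind) (N : ℕ), Group (WeylGroup t N)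
  | .A, N => inferInstanceAs (Group (Equiv.Perm (Fin N)))
  | .C, N => inferInstanceAs (Group (WeylC N))

instance instFiniteWeylGroup : ∀ (t : Kind) (N : ℕ), Finite (WeylGroup t N)
  | .A, N => inferInstanceAs (Finite (Equiv.Perm (Fin N)))
  | .C, N =>
    have : Finite (WeylC N) := Finite.of_equiv _ SemidirectProduct.equivProd.symm
    this

/-- The orbits of a permutation (fixed points included). -/
def orbitsOf {N : ℕ} (σ : Equiv.Perm (Fin N)) : Finset (Finset (Fin N)) := by
  classical
  exact Finset.univ.image fun i => Finset.univ.filter fun k => σ.SameCycle i k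

/-- The signed cycle type: the multiset of the lengths of all cycles (cycles of length one
included), each with its sign; the sign of a cycle of an element of `W_N` is the product of the
signs along the cycle, and all cycles of an element of `𝔖_N` have sign `1`.
It characterises the conjugacy class. -/
def cycles : ∀ {t : Kind} {N : ℕ}, WeylGroup t N → Multiset (ℕ × ℤˣ)
  | .A, _, (σ : Equiv.Perm (Fin _)) => (orbitsOf σ).val.map fun O => (O.card, 1)
  | .C, _, (w : WeylC _) => (orbitsOf w.right).val.map fun O => (O.card, ∏ i ∈ O, w.left i)

/-- The character `sgn_CD` of `W_N`, of kernel the Weyl group of type `D`: the parity of the number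
of sign changes. (It is extended by `1` to the symmetric groups, where it is not used.) -/
def sgnCD : ∀ {t : Kind} {N : ℕ}, WeylGroup t N → ℤˣ
  | .A, _, _ => 1
  | .C, N, (w : WeylC N) => ∏ i : Fin N, w.left i

/-- The product `∏_x 𝔖_{r(x)}` or `W_{r(x)}`, according to the kinds `t(x)`. -/
abbrev WProd {K : Type} (t : K → Kind) (r : K → ℕ) : Type := ∀ x, WeylGroup (t x) (r x)

/-- The value at a conjugacy class of a function on the group that is invariant by conjugation. -/
def onClass {G : Type} [Group G] (f : G → ℂ) (c : ConjClasses G) : ℂ := f (Quot.out c)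

/-- The order of the centralizer of an element of the class `c`. -/
def centOrder {G : Type} [Group G] (c : ConjClasses G) : ℂ :=
  (Nat.card G : ℂ) / (Nat.card c.carrier : ℂ)

/-- How a cycle of length `α` of a factor of kind `t'` is sent into a factor of kind `t`, with
dilatation `k`: `𝔖 → 𝔖` multiplies the lengths by `k`; `𝔖 → W` multiplies the lengths by `k` and
gives the sign `(-1)^α`; `W → W` multiplies the lengths by `k` and keeps the sign. -/
def moveCycle (k : ℕ) : Kind → Kind → ℕ × ℤˣ → ℕ × ℤˣ
  | .A, .C, a => (k * a.1, (-1) ^ a.1)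
  | _, _, a => (k * a.1, a.2)

section maps

variable {K' K : Type} [Fintype K'] [Fintype K]

/-- The "inclusion" of `∏_y 𝒲_{ν(y)}` in `∏_x 𝒲_{r(x)}` which puts the factor `y`, dilated by
`k(y)`, as a block in the factor `π(y)`. It is a map between the sets of conjugacy classes, here
given by its graph: `w'` is sent to the class of `w` if, for all `x`, the cycles of `w x` are those
coming from the factors `y` above `x`. When `k = 1` and the kinds agree this is induced by the usual
inclusion of a Young subgroup. -/
def Corr (π : K' → K) (k : K' → ℕ) {t' : K' → Kind} {t : K → Kind} {ν : K' → ℕ} {r : K → ℕ}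
    (w' : WProd t' ν) (w : WProd t r) : Prop := by
  classical
  exact ∀ x, cycles (w x) =
    ∑ y ∈ Finset.univ.filter (fun y => π y = x),
      (cycles (w' y)).map (moveCycle (k y) (t' y) (t x))

/-- The same relation between conjugacy classes. -/
def CorrClass (π : K' → K) (k : K' → ℕ) {t' : K' → Kind} {t : K → Kind} {ν : K' → ℕ} {r : K → ℕ}
    (c' : ConjClasses (WProd t' ν)) (c : ConjClasses (WProd t r)) : Prop :=
  ∃ w' w, ConjClasses.mk w' = c' ∧ ConjClasses.mk w = c ∧ Corr π k w' w

/-- Restriction (pull-back) of class functions along `Corr π k`. It is zero if the ranks are not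
compatible, i.e. if there is no such inclusion. -/
def res (π : K' → K) (k : K' → ℕ) {t' : K' → Kind} {t : K → Kind} {ν : K' → ℕ} {r : K → ℕ}
    (f : ConjClasses (WProd t r) → ℂ) (c' : ConjClasses (WProd t' ν)) : ℂ := by
  classical
  exact if h : ∃ c, CorrClass π k c' c then f h.choose else 0

/-- Induction of class functions along `Corr π k`: the adjoint of `res` for the usual scalar
products, i.e. Frobenius' formula
`(ind f)(c) = ∑_{c' ↦ c} f(c') |Z(c)| / |Z(c')|`.
It is zero if the ranks are not compatible. -/
def ind (π : K' → K) (k : K' → ℕ) {t' : K' → Kind} {t : K → Kind} {ν : K' → ℕ} {r : K → ℕ}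
    (f : ConjClasses (WProd t' ν) → ℂ) (c : ConjClasses (WProd t r)) : ℂ := by
  classical
  letI : Fintype (ConjClasses (WProd t' ν)) := Fintype.ofFinite _
  exact ∑ c' : ConjClasses (WProd t' ν),
    if CorrClass π k c' c then f c' * (centOrder c / centOrder c') else 0

end maps

/-- A sign as a complex number. -/
def sgnC (s : ℤˣ) : ℂ := ((s : ℤ) : ℂ)

/-! ## Eigenvalues grouped in packets -/

/-- The orbit of `u` under `u ↦ u ^ q`. -/
def frobOrbit (q : ℕ) (u : ℂ) : Set ℂ := {v | ∃ a : ℕ, v = u ^ q ^ a}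

/-- The packets of roots of `P` different from `1` and `-1`. -/
def Packet (q : ℕ) (P : ℂ[X]) : Type :=
  {c : Set ℂ // ∃ u ∈ P.roots, u ≠ 1 ∧ u ≠ -1 ∧ c = frobOrbit q u}

instance instFinitePacket (q : ℕ) (P : ℂ[X]) : Finite (Packet q P) := by
  classical
  refine Set.Finite.to_subtype ((P.roots.toFinset.finite_toSet.image (frobOrbit q)).subset ?_)
  rintro c ⟨u, hu, -, -, rfl⟩
  exact ⟨u, by simpa using hu, rfl⟩

/-- What is retained of a semisimple element: the packets of eigenvalues other than `±1`, for each
packet a representative, half of its cardinality and the multiplicity of its elements, and the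
multiplicities of `1` and of `-1`. -/
structure SpectralDatum where
  packets : Type
  [fintype_packets : Fintype packets]
  /-- an eigenvalue in the packet -/
  root : packets → ℂ
  /-- half of the cardinality of the packet -/
  ell : packets → ℕ
  /-- the multiplicity of the eigenvalues in the packet -/
  mult : packets → ℕ
  /-- the multiplicities of the eigenvalues `1` and `-1` -/
  multSign : ℤˣ → ℕ

attribute [instance] SpectralDatum.fintype_packets

/-- The spectral datum of an element with characteristic polynomial `P`. -/
def SpectralDatum.ofCharpoly (q : ℕ) (P : ℂ[X]) : SpectralDatum where
  packets := Packet q P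
  fintype_packets := Fintype.ofFinite _
  root c := c.2.choose
  ell c := c.1.ncard / 2
  mult c := P.rootMultiplicity c.2.choose
  multSign ε := P.rootMultiplicity (sgnC ε)

/-- All roots of `P` are roots of unity of order prime to `p`, and the packet of each root is stable
by `u ↦ u⁻¹`. -/
def TameSelfDual (p q : ℕ) (P : ℂ[X]) : Prop :=
  ∀ u ∈ P.roots, (∃ k : ℕ, 0 < k ∧ k.Coprime p ∧ u ^ k = 1) ∧ u⁻¹ ∈ frobOrbit q u

/-- All packets: those of eigenvalues other than `±1`, and `{1}`, `{-1}` (present even when the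
multiplicity is zero). -/
abbrev SpectralDatum.Slot (S : SpectralDatum) : Type := S.packets ⊕ ℤˣ

/-- Symmetric groups for the packets other than `{1}` and `{-1}`, groups of type `C` for these. -/
def kind {ι : Type} : ι ⊕ ℤˣ → Kind
  | .inl _ => .A
  | .inr _ => .C

/-! ## Cuspidal data -/

/-- Cuspidal data for the character sheaves: two odd integers `I_±`, two even integers `P_±` and two
signs `ζ_±`. -/
structure CuspDatum where
  I : ℤˣ → ℕ
  P : ℤˣ → ℕ
  ζ : ℤˣ → ℤˣ
  odd_I : ∀ ε, Odd (I ε)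
  even_P : ∀ ε, Even (P ε)

namespace CuspDatum

/-- The convention on the sign of a zero defect. -/
def Normalized (c : CuspDatum) : Prop := ∀ ε, c.P ε = 0 → c.ζ ε = (-1) ^ ((c.I ε - 1) / 2)

/-- The passage between `cusp` and `cusp~`: `ζ_ε` is replaced by `(-1)^{(I_ε - 1)/2} ζ_ε`.
It is an involution. -/
def flip (c : CuspDatum) : CuspDatum where
  I := c.I
  P := c.P
  ζ ε := (-1) ^ ((c.I ε - 1) / 2) * c.ζ ε
  odd_I := c.odd_I
  even_P := c.even_P

/-- The sign `ε` with `f ε > f (-ε)` (when `f 1 ≠ f (-1)`). -/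
def bigger (f : ℤˣ → ℕ) : ℤˣ := if f (-1) < f 1 then 1 else -1

/-- The sign `ε_I`, with `I_{ε_I} > I_{-ε_I}`; by convention it is `ε_P` if `I_+ = I_-`, and `+` if
also `P_+ = P_-`. -/
def εI (c : CuspDatum) : ℤˣ :=
  if c.I 1 ≠ c.I (-1) then bigger c.I else if c.P 1 ≠ c.P (-1) then bigger c.P else 1

/-- The sign `ε_P`, with `P_{ε_P} > P_{-ε_P}`; by convention it is `ε_I` if `P_+ = P_-`, and `+` if
also `I_+ = I_-`. -/
def εP (c : CuspDatum) : ℤˣ :=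
  if c.P 1 ≠ c.P (-1) then bigger c.P else if c.I 1 ≠ c.I (-1) then bigger c.I else 1

/-- `(f_+ + f_-)/2`. -/
def halfSum (f : ℤˣ → ℕ) : ℕ := (f 1 + f (-1)) / 2

/-- `|f_+ - f_-|/2`. -/
def halfDiff (f : ℤˣ → ℕ) : ℕ := Nat.dist (f 1) (f (-1)) / 2

/-- The odd element of the pair `(I_+ + I_-)/2, |I_+ - I_-|/2`. -/
def rOdd (c : CuspDatum) : ℕ := if Odd (halfSum c.I) then halfSum c.I else halfDiff c.I

/-- The even element of the pair `(I_+ + I_-)/2, |I_+ - I_-|/2`. -/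
def rEven (c : CuspDatum) : ℕ := if Odd (halfSum c.I) then halfDiff c.I else halfSum c.I

/-- The integers `|r|'_ε`: up to order the pair `(I_+ + I_-)/2, |I_+ - I_-|/2`, with `|r|'_+` odd. -/
def r' (c : CuspDatum) (ε : ℤˣ) : ℕ := if ε = 1 then c.rOdd else c.rEven

/-- The integers `|r|''_ε`, for the datum `cusp~` with `cusp = cusp~.flip`: up to order the pair
`(P_+ + P_-)/2, |P_+ - P_-|/2`, with `|r|''_+ ≥ |r|''_-` if and only if
`ζ_+ ζ_- = (-1)^{1 + (I_+ + I_-)/2}`. -/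
def r'' (c : CuspDatum) (ε : ℤˣ) : ℕ :=
  if (c.flip.ζ 1 * c.flip.ζ (-1) = (-1) ^ (1 + halfSum c.I)) ↔ ε = 1 then halfSum c.P
  else halfDiff c.P

end CuspDatum

/-! ## The graded spaces -/

/-- The condition on the sum of the two ranks attached to a slot for `ℂ[Ŵ_{D(χ)}]`, in its part
attached to a cuspidal datum: `n'[u] + n''[u] = m([u])` if `u ≠ ±1`, and
`N'_ε + N''_ε + (I_ε² + P_ε² - 1)/4 = n[ε] = m(ε)/2` for `u = ε = ±1`. -/
def symbolLaw (S : SpectralDatum) (c : CuspDatum) : S.Slot → ℕ → Prop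
  | .inl u, s => s = S.mult u
  | .inr ε, s => s + (c.I ε ^ 2 + c.P ε ^ 2 - 1) / 4 = S.multSign ε / 2

/-- The condition on the sum of the two ranks attached to a slot for `ℂ[Ŵ_{D(g)}]`, in its part
attached to `|cusp|`: `m'(λ) + m''(λ) = m(λ)` if `λ ≠ ±1`, and, writing
`m'(ε) = 2N'_ε + (|r|'_ε)²`, `m''(ε) = 2N''_ε + (|r|''_ε)²` for `λ = ε = ±1`, again
`m'(ε) + m''(ε) = m(ε)`. -/
def greenLaw (S : SpectralDatum) (c : CuspDatum) : S.Slot → ℕ → Prop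
  | .inl u, s => s = S.mult u
  | .inr ε, s => 2 * s + c.r' ε ^ 2 + c.r'' ε ^ 2 = S.multSign ε

section graded

variable {S : SpectralDatum}

/-- The families of pairs of ranks `(r'(j), r''(j))`, `j` a slot, allowed by the law `T`. The
Booleans `false` and `true` stand for `'` and `''`. -/
def Decomp (T : S.Slot → ℕ → Prop) : Type :=
  {r : S.Slot × Bool → ℕ // ∀ j, T j (r (j, false) + r (j, true))}

/-- The group `𝒲_r`, a product of symmetric groups and of groups of type `C`. -/
abbrev 𝒲 {X : Type} (r : S.Slot × X → ℕ) : Type := WProd (fun x => kind x.1) r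

/-- `⊕_r ℂ[𝒲̂_r]`, where `ℂ[𝒲̂_r]` is the space of class functions on `𝒲_r`. -/
def Graded (T : S.Slot → ℕ → Prop) : Type := ∀ r : Decomp T, ConjClasses (𝒲 r.1) → ℂ

/-- The component of `φ` at `r`; it is zero when `r` does not obey the law `T`. -/
def Graded.comp {T : S.Slot → ℕ → Prop} (φ : Graded T) (r : S.Slot × Bool → ℕ) :
    ConjClasses (𝒲 r) → ℂ := by
  classical
  exact if h : ∀ j, T j (r (j, false) + r (j, true)) then φ ⟨r, h⟩ else 0

/-- The multiplication of each component by an invariant function. -/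
def Graded.twist {T T' : S.Slot → ℕ → Prop} (h : ∀ j s, T' j s → T j s)
    (f : ∀ r : S.Slot × Bool → ℕ, 𝒲 r → ℂ) (φ : Graded T) : Graded T' :=
  fun r c => onClass (f r.1) c * φ ⟨r.1, fun j => h j _ (r.2 j)⟩ c

/-- The quadruples `r^{i,j}` with `∑_i r^{i,j} = r^j`. -/
def quadruples (r : S.Slot × Bool → ℕ) : Finset (S.Slot × Bool × Bool → ℕ) := by
  classical
  exact (Fintype.piFinset fun x => Finset.range (r (x.1, x.2.2) + 1)).filter
    fun m => ∀ j b, m (j, false, b) + m (j, true, b) = r (j, b)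

/-- The pairs `∑_j m^{i,j}`. -/
def rowSum (m : S.Slot × Bool × Bool → ℕ) (x : S.Slot × Bool) : ℕ :=
  m (x.1, x.2, false) + m (x.1, x.2, true)

/-- Restriction followed by twisted induction: the component at `r` of the image of `φ` is the sum
over the quadruples `m = (m^{i,j})` with `∑_i m^{i,j} = r^j` of the following: restrict the component
of `φ` at `(∑_j m^{i,j})_i` to `𝒲_m`, multiply by the character `tw`, and induce to `𝒲_r` after the
exchange of the second and the third factors. -/
def resInd {T T' : S.Slot → ℕ → Prop}
    (tw : ∀ m : S.Slot × Bool × Bool → ℕ, 𝒲 m → ℂ) (φ : Graded T) : Graded T' :=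
  fun r => ∑ m ∈ quadruples r.1,
    ind (ν := m) (fun x => (x.1, x.2.2)) (fun _ => 1) fun c =>
      onClass (tw m) c * res (fun x => (x.1, x.2.1)) (fun _ => 1) (φ.comp (rowSum m)) c

/-- The character `χ~_ε` (as an exponent of `sgn_CD`): trivial if `I_ε > P_ε`, and `sgn_CD`
otherwise. -/
def tildeExp (c : CuspDatum) (ε : ℤˣ) : ℕ := if c.P ε < c.I ε then 0 else 1

/-- `(1 - ζ)/2`. -/
def minusExp (ζ : ℤˣ) : ℕ := if ζ = 1 then 0 else 1

/-- `(1 + ζ)/2`. -/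
def plusExp (ζ : ℤˣ) : ℕ := if ζ = 1 then 1 else 0

/-- `ρ ∘ ι` on `ℂ[Ŵ_{D(χ)}]`, from the part attached to `cusp` to the part attached to `cusp~`. The
twist is by `(-1)^{n^{'',''}[u]}` for `u ≠ ±1`, and for `u = ε = ±1` by `1` on `N^{','}`, by
`sgn_CD^{(1-ζ_ε)/2}` on `N^{',''}`, by `χ~_ε` on `N^{'','}`, by `χ~_ε sgn_CD^{(1+ζ_ε)/2}` on
`N^{'',''}`. -/
def rhoIota (c : CuspDatum) (φ : Graded (symbolLaw S c)) : Graded (symbolLaw S c.flip) :=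
  resInd (fun m w =>
    (∏ u : S.packets, (-1 : ℂ) ^ m (.inl u, true, true)) *
    ∏ ε : ℤˣ, (sgnC (sgnCD (w (.inr ε, false, true))) ^ minusExp (c.ζ ε) *
      sgnC (sgnCD (w (.inr ε, true, false))) ^ tildeExp c ε *
      sgnC (sgnCD (w (.inr ε, true, true))) ^ (tildeExp c ε + plusExp (c.ζ ε)))) φ

/-- The map `~` from the part of `ℂ[Ŵ_{D(χ)}]` attached to `cusp` to the part attached to `cusp~`:
the identity on representations, composed with the multiplication by the characters `χ~_ε` of
`W_{N''_ε}`. -/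
def tilde (c : CuspDatum) (φ : Graded (symbolLaw S c)) : Graded (symbolLaw S c.flip) :=
  φ.twist (T := symbolLaw S c) (T' := symbolLaw S c.flip)
    (fun j _ h => match j, h with
      | .inl _, h => h
      | .inr _, h => h)
    fun _ w => ∏ ε : ℤˣ, sgnC (sgnCD (w (.inr ε, true))) ^ tildeExp c ε

/-- The multiplication by the normalising character of the part attached to `cusp~`, with
`cusp = cusp~.flip`: the character `sgn_CD^{(1-ζ_ε)/2}` of `W_{N''_ε}`. -/
def normalise (ct : CuspDatum) (φ : Graded (symbolLaw S ct)) : Graded (symbolLaw S ct) :=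
  φ.twist (T := symbolLaw S ct) (fun _ _ h => h)
    fun _ w => ∏ ε : ℤˣ, sgnC (sgnCD (w (.inr ε, true))) ^ minusExp (ct.flip.ζ ε)

/-- `ρ ∘ ι` on `ℂ[Ŵ_{D(g)}]`: the twist is by `(-1)^{m^{'',''}(λ)}` for `λ ≠ ±1` and by `sgn_CD` on
`N_ε^{'',''}` for `λ = ε = ±1`. -/
def rhoIotaGreen {T : S.Slot → ℕ → Prop} (φ : Graded T) : Graded T :=
  resInd (fun m w =>
    (∏ u : S.packets, (-1 : ℂ) ^ m (.inl u, true, true)) *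
    ∏ ε : ℤˣ, sgnC (sgnCD (w (.inr ε, true, true)))) φ

/-- Is this slot the slot `ε`? -/
def isSlot {ι : Type} (ε : ℤˣ) : ι ⊕ ℤˣ → Bool
  | .inl _ => false
  | .inr ε' => decide (ε' = ε)

/-- The exchange of `'` and `''` at the slot `ε`. -/
def swapIdx (ε : ℤˣ) (x : S.Slot × Bool) : S.Slot × Bool :=
  (x.1, if isSlot ε x.1 then !x.2 else x.2)

/-- The exchange of the two factors at the slot `ε`. -/
def swapHom (ε : ℤˣ) (r : S.Slot × Bool → ℕ) : 𝒲 r →* 𝒲 (fun x => r (swapIdx ε x)) where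
  toFun w x := w (swapIdx ε x)
  map_one' := rfl
  map_mul' _ _ := rfl

/-- The endomorphism `X_ε`: tensor by `sgn_CD` on the factor `''` of the slot `ε`, then exchange the
two factors of this slot. -/
def XSign {T : S.Slot → ℕ → Prop} (ε : ℤˣ) (φ : Graded T) : Graded T := fun r c =>
  let d := ConjClasses.map (swapHom ε r.1) c
  onClass (fun w : 𝒲 (fun x => r.1 (swapIdx ε x)) => sgnC (sgnCD (w (.inr ε, true)))) d *
    φ.comp (fun x => r.1 (swapIdx ε x)) d

/-- The endomorphism `X_cusp`. -/
def XCusp {T : S.Slot → ℕ → Prop} (c : CuspDatum) (φ : Graded T) : Graded T :=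
  if c.εI = c.εP then
    if c.ζ c.εP = 1 then φ else XSign 1 (XSign (-1) φ)
  else
    if c.ζ c.εP = 1 then XSign ((-1) ^ CuspDatum.halfSum c.I) φ
    else XSign ((-1) ^ (1 + CuspDatum.halfSum c.I)) φ

end graded

/-! ## Localisation -/

/-- Signs `η' ε` and `η'' ε` of discriminants, for `ε = ±1`; they are those of `g` in `discSigns` below. -/
structure DiscSigns where
  η' : ℤˣ → ℤˣ
  η'' : ℤˣ → ℤˣ

section loc

variable (S L : SpectralDatum)

/-- Pairs of slots, with `'` or `''`: the indices of `ν^δ([u],[λ])`. -/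
abbrev PairIdx : Type := (S.Slot × L.Slot) × Bool

/-- `1` if the two integers are divisible by the same power of `2`, and `2` otherwise. -/
def parityFactor (a b : ℕ) : ℕ := if padicValNat 2 a = padicValNat 2 b then 1 else 2

variable {S L}

/-- `𝒲_{ν([u],[λ])}` is a group of type `C` if `u` and `λ` are both in `{±1}`, and a symmetric group
otherwise. -/
def pairKind : PairIdx S L → Kind
  | ((.inr _, .inr _), _) => .C
  | _ => .A

/-- The dilatation from `𝒲_{ν([u],[λ])}` to the group attached to `[u]`. -/
def dilU : PairIdx S L → ℕ
  | ((.inl u, .inl l), _) =>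
      parityFactor (S.ell u) (L.ell l) * (L.ell l / Nat.gcd (S.ell u) (L.ell l))
  | ((.inl _, .inr _), _) => 1
  | ((.inr _, .inl l), _) => L.ell l
  | ((.inr _, .inr _), _) => 1

/-- The dilatation from `𝒲_{ν([u],[λ])}` to the group attached to `[λ]`. -/
def dilL : PairIdx S L → ℕ
  | ((.inl u, .inl l), _) =>
      parityFactor (S.ell u) (L.ell l) * (S.ell u / Nat.gcd (S.ell u) (L.ell l))
  | ((.inl u, .inr _), _) => S.ell u
  | ((.inr _, .inl _), _) => 1
  | ((.inr _, .inr _), _) => 1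

/-- `n^δ([u]) = ∑_{[λ]} ν^δ([u],[λ]) · dilU`. -/
def sumU (ν : PairIdx S L → ℕ) (x : S.Slot × Bool) : ℕ :=
  ∑ l : L.Slot, ν ((x.1, l), x.2) * dilU ((x.1, l), x.2)

/-- `m^δ([λ]) = ∑_{[u]} ν^δ([u],[λ]) · dilL`. -/
def sumL (ν : PairIdx S L → ℕ) (x : L.Slot × Bool) : ℕ :=
  ∑ u : S.Slot, ν ((u, x.1), x.2) * dilL ((u, x.1), x.2)

/-- The function `φ_{α,[λ],y}`. -/
def phiFun (q : ℕ) (α : ℕ) (l : L.packets) (y : ℂ) : ℂ :=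
  y⁻¹ * (L.ell l : ℂ)⁻¹ * ∑ k ∈ Finset.range (L.ell l),
    (L.root l ^ (α * q ^ k) + (L.root l)⁻¹ ^ (α * q ^ k))

/-- The function `χ^δ_{[u],[λ]}` on `𝒲_{ν^δ([u],[λ])}`. -/
def chiFun (q : ℕ) {N : ℕ} : (x : PairIdx S L) → WeylGroup (pairKind x) N → ℂ
  | ((.inl u, .inl l), _), w =>
      ((cycles w).map fun a => phiFun q a.1 l
        ((Nat.gcd (S.ell u) (L.ell l) : ℂ) / (parityFactor (S.ell u) (L.ell l) : ℂ))).prod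
  | ((.inr ε, .inl l), _), _ => if ε = 1 then 1 else (-1) ^ (N * (1 + q ^ L.ell l) / 2)
  | ((.inl u, .inr ε), _), _ => if ε = 1 then 1 else (-1) ^ (N * (1 + q ^ S.ell u) / 2)
  | ((.inr ε, .inr ε'), _), w =>
      if ε = -1 ∧ ε' = -1 then sgnC (sgnCD w) * (-1) ^ (N * (q - 1) / 2) else 1

/-- The sign `χ^δ_{ε',ν}(w)`, i.e. `(-1)` to the power `∑_{u ≠ ±1} ν^δ(u,ε')`, times the values of
`sgn_CD` at the components of `w` of indices `(+,ε')` and `(-,ε')`. -/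
def chiSign (ε' : ℤˣ) (δ : Bool) (ν : PairIdx S L → ℕ) (w : WProd pairKind ν) : ℤˣ :=
  (-1) ^ (∑ u : S.packets, ν ((.inl u, .inr ε'), δ)) *
    ∏ ε : ℤˣ, sgnCD (w ((.inr ε, .inr ε'), δ))

/-- The contribution `χ'_{cusp,ν}` of the cuspidal part. Here `c = cusp` with the normalisation of
signs of `cusp = cusp~.flip`. -/
def chiCusp' (q x' : ℕ) (c : CuspDatum) (η : DiscSigns) (ν : PairIdx S L → ℕ)
    (w : WProd pairKind ν) : ℂ :=
  (q : ℂ) ^ x' * sgnC ((-1) ^ ((q - 1) * (c.rOdd - 1) / 4) *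
    (chiSign 1 false ν w * chiSign (-1) false ν w * η.η' 1 * η.η' (-1)) ^ ((c.I c.εI - 1) / 2) *
    if c.εI = 1 then 1 else η.η' (-1) * chiSign (-1) false ν w)

/-- The signed integers `r''_± = (ζ~_+ P_+ ± ζ~_- P_-)/2` (defects of `cusp~`). -/
def rSigned (ct : CuspDatum) (s : ℤˣ) : ℤ :=
  ((ct.ζ 1 : ℤ) * ct.P 1 + (s : ℤ) * ((ct.ζ (-1) : ℤ) * ct.P (-1))) / 2

/-- The integer `y''`: it is `r''_+` if this number is even and `r''_- - 1` otherwise. -/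
def ySigned (ct : CuspDatum) : ℤ :=
  if Even (rSigned ct 1) then rSigned ct 1 else rSigned ct (-1) - 1

/-- The contribution `χ''_{cusp,ν}` of the cuspidal part. -/
def chiCusp'' (q x'' : ℕ) (c : CuspDatum) (η : DiscSigns) (ν : PairIdx S L → ℕ)
    (w : WProd pairKind ν) : ℂ :=
  (q : ℂ) ^ x'' * sgnC ((-1 : ℤˣ) ^ (ySigned c.flip * ((q : ℤ) - 1) / 4) *
    (η.η'' 1 * η.η'' (-1) * chiSign 1 true ν w * chiSign (-1) true ν w) ^ ((c.I c.εP - 1) / 2) *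
    if c.ζ c.εP = 1 then
      if c.εP = 1 then 1 else η.η'' (-1) * chiSign (-1) true ν w
    else
      if c.εP = 1 then
        η.η'' 1 * η.η'' (-1) * chiSign 1 true ν w * chiSign (-1) true ν w
      else η.η'' 1 * chiSign 1 true ν w)

/-- The families `ν` with `∑_{[u]} ν^δ([u],[λ]) · dilL = m^δ([λ])`. -/
def pairFamilies (m : L.Slot × Bool → ℕ) : Finset (PairIdx S L → ℕ) := by
  classical
  exact (Fintype.piFinset fun x => Finset.range (m (x.1.2, x.2) + 1)).filter fun ν => sumL ν = m

/-- The localisation `loc_g` from the part of `ℂ[Ŵ_{D(χ)}]` attached to the cuspidal datum `ct`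
(which is a datum `cusp~`) to the part of `ℂ[Ŵ_{D(g)}]` attached to `|cusp|`. Its component at `m`
is the sum over the families `ν` which give `m` of: restrict to `𝒲_ν`, multiply by
`χ'_{cusp,ν} χ''_{cusp,ν} ∏ χ^δ([u],[λ])`, induce to `𝒲_m`. -/
def loc (q x' x'' : ℕ) (ct : CuspDatum) (η : DiscSigns) (φ : Graded (symbolLaw S ct)) :
    Graded (greenLaw L ct) :=
  fun m => ∑ ν ∈ pairFamilies (S := S) m.1,
    ind (t' := pairKind) (ν := ν) (fun x => (x.1.2, x.2)) dilL fun c =>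
      onClass (fun w => chiCusp' q x' ct.flip η ν w * chiCusp'' q x'' ct.flip η ν w *
        ∏ x : PairIdx S L, chiFun q x (w x)) c *
      res (t' := pairKind) (fun x => (x.1.1, x.2)) dilU (φ.comp (sumU ν)) c

end loc

/-! ## The elements over the local field -/

section field

variable {F : Type*} [Field F] [ValuativeRel F]

/-- A basis of a quadratic space `W ⊆ V` adapted to a reduction: it is orthogonal, and each of its
vectors has length a unit (index in `Fin d'`) or a unit times the uniformizer `ϖ` (index in
`Fin d''`). If `M` is the lattice generated by it and `M~` its dual, then the reductions modulo
`ϖ` of the units `a` give the form `⟨,⟩'` on `M/ϖM~`, and those of the units `b` give the form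
`⟨,⟩''` on `M~/M`, both in diagonal form. -/
structure AdaptedBasis {V : Type*} [AddCommGroup V] [Module F V]
    (B : LinearMap.BilinForm F V) (ϖ : 𝒪[F]) (W : Submodule F V) where
  d' : ℕ
  d'' : ℕ
  e : Module.Basis (Fin d' ⊕ Fin d'') F W
  a : Fin d' → 𝒪[F]ˣ
  b : Fin d'' → 𝒪[F]ˣ
  orthogonal : ∀ x y, x ≠ y → B (e x) (e y) = 0
  length_unit : ∀ i, B (e (.inl i)) (e (.inl i)) = ((a i : 𝒪[F]) : F)
  length_unif : ∀ i, B (e (.inr i)) (e (.inr i)) = (ϖ : F) * ((b i : 𝒪[F]) : F)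

/-- The sign of the discriminant `(-1)^{⌊d/2⌋} ∏ a_i` of a diagonal quadratic form over the residue
field (this discriminant does not change if hyperbolic planes are added): `+` if it is a square. -/
def discSign {d : ℕ} (a : Fin d → 𝒪[F]ˣ) : ℤˣ := by
  classical
  exact if IsSquare ((-1) ^ (d / 2) * ∏ i, IsLocalRing.residue 𝒪[F] (a i : 𝒪[F])) then 1 else -1

/-- The signs `η'_ε`, `η''_ε` of the discriminants of the reductions of the quadratic forms on the
eigenspaces of `g` for `ε = ±1`. -/
def discSigns {V : Type*} [AddCommGroup V] [Module F V]
    {B : LinearMap.BilinForm F V} {ϖ : 𝒪[F]} {g : Module.End F V}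
    (b : ∀ ε : ℤˣ, AdaptedBasis B ϖ (Module.End.eigenspace g (((ε : ℤ) : F)))) : DiscSigns where
  η' ε := discSign (b ε).a
  η'' ε := discSign (b ε).b

end field

end LevelZero

end

noncomputable section

namespace LevelZero

set_option linter.unusedSectionVars false

open Equiv

/-! ### Orbits of a permutation -/

section orbits

variable {N : ℕ} (σ : Perm (Fin N))

/-! A class function on a product of groups `𝔖_N` and `W_N` is a function of the signed cycles of an
element, each labelled by its factor. Enumerate the cycles by a finite set `X`: an element of a
graded space becomes a function of a triple `(l, i, a)`, where the cycle `a x` lies in the slot `l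
x` with the superscript `i x` (`Graded.value`), and `graded_ext` says that these values determine
the element.

In this language induction loses its symmetry factors. Frobenius' formula involves centralizer
orders, which are products of cycle weights times factorials of multiplicities; the factorials count
exactly the ways of lifting an enumerated family of cycles (`card_lifts`). So a sum of inductions
over all ranks is a free sum over independent liftings of the individual cycles, weighted by ratios
of cycle weights (`sum_ind`). It follows that `ρ ∘ ι` is a sum over new superscripts `i`, with a
sign that is a product over cycles (`value_resInd`), while `loc` is a sum over liftings to pairs of
slots which leave the superscripts alone (`value_loc`). The two sums can be interchanged, and it
remains to compare signs for a fixed lifting and fixed `i`, `j`.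

Two comparisons suffice. Cycle by cycle, the sign seen in the slot `[u]` equals the sign seen in the
slot `[λ]` (`slotSign_move`), and the normalised twist on the side of `χ` is the product of the
twist of `~` and of the twist on the side of `g` (`normalise_mul_rho`). Globally, the cuspidal
factor of `loc` depends on the superscripts only through the signs `χ^δ_ε`: these are column
products, for `j`, or row products, for `i`, of a 2 × 2 table of signs attached to each `ε`. When
row and column products give different cuspidal factors, the discrepancy is exactly the effect of
exchanging the superscripts in one or both slots `±1`, that is, of `X_cusp` (`coreSign_col_eq_row`,
`coreSign_swap_both`, `coreSign_swap_one`). -/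

/-- The orbit of a point under a permutation. -/
def orbitAt (i : Fin N) : Finset (Fin N) := by
  classical
  exact Finset.univ.filter fun k => σ.SameCycle i k

variable {σ}

lemma mem_orbitAt {i k : Fin N} : k ∈ orbitAt σ i ↔ σ.SameCycle i k := by
  simp [orbitAt]

lemma self_mem_orbitAt (i : Fin N) : i ∈ orbitAt σ i := mem_orbitAt.2 (Perm.SameCycle.refl _ _)

lemma orbitAt_eq_iff {i k : Fin N} : orbitAt σ i = orbitAt σ k ↔ σ.SameCycle i k := by
  constructor
  · intro h
    rw [← mem_orbitAt, h]
    exact self_mem_orbitAt k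
  · intro h
    ext x
    rw [mem_orbitAt, mem_orbitAt]
    exact ⟨fun h' => h.symm.trans h', fun h' => h.trans h'⟩

lemma mem_orbitsOf {O : Finset (Fin N)} : O ∈ orbitsOf σ ↔ ∃ i, orbitAt σ i = O := by
  classical
  simp only [orbitsOf, Finset.mem_image, Finset.mem_univ, true_and, orbitAt]

lemma orbitAt_mem (i : Fin N) : orbitAt σ i ∈ orbitsOf σ := mem_orbitsOf.2 ⟨i, rfl⟩

lemma eq_orbitAt {O : Finset (Fin N)} (hO : O ∈ orbitsOf σ) {i : Fin N} (hi : i ∈ O) :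
    O = orbitAt σ i := by
  obtain ⟨k, rfl⟩ := mem_orbitsOf.1 hO
  exact orbitAt_eq_iff.2 (mem_orbitAt.1 hi)

lemma orbit_nonempty {O : Finset (Fin N)} (hO : O ∈ orbitsOf σ) : O.Nonempty := by
  obtain ⟨k, rfl⟩ := mem_orbitsOf.1 hO
  exact ⟨k, self_mem_orbitAt k⟩

lemma filter_orbitAt {O : Finset (Fin N)} (hO : O ∈ orbitsOf σ)
    [DecidablePred fun i => orbitAt σ i = O] :
    (Finset.univ.filter fun i => orbitAt σ i = O) = O := by
  ext i
  simp only [Finset.mem_filter, Finset.mem_univ, true_and]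
  exact ⟨fun h => h ▸ self_mem_orbitAt i, fun h => (eq_orbitAt hO h).symm⟩

lemma prod_orbitsOf {M : Type*} [CommMonoid M] (f : Fin N → M) :
    ∏ O ∈ orbitsOf σ, ∏ i ∈ O, f i = ∏ i, f i := by
  classical
  rw [← Finset.prod_fiberwise_of_maps_to (g := orbitAt σ) (t := orbitsOf σ)
    (fun i _ => orbitAt_mem i)]
  refine Finset.prod_congr rfl fun O hO => ?_
  rw [filter_orbitAt hO]

lemma sum_card_orbitsOf : ∑ O ∈ orbitsOf σ, O.card = N := by
  classical
  have := Finset.card_eq_sum_card_fiberwise (s := (Finset.univ : Finset (Fin N)))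
    (f := orbitAt σ) (t := orbitsOf σ) (fun i _ => orbitAt_mem i)
  rw [Finset.card_univ, Fintype.card_fin] at this
  refine Eq.trans (Finset.sum_congr rfl fun O hO => ?_) this.symm
  rw [filter_orbitAt hO]

lemma orbit_apply_mem {O : Finset (Fin N)} (hO : O ∈ orbitsOf σ) {i : Fin N} :
    σ i ∈ O ↔ i ∈ O := by
  obtain ⟨k, rfl⟩ := mem_orbitsOf.1 hO
  rw [mem_orbitAt, mem_orbitAt, Perm.sameCycle_apply_right]

lemma orbitAt_apply (i : Fin N) : orbitAt σ (σ i) = orbitAt σ i :=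
  orbitAt_eq_iff.2 (Perm.sameCycle_apply_left.2 (Perm.SameCycle.refl _ _))

lemma isCycleOn_orbit {O : Finset (Fin N)} (hO : O ∈ orbitsOf σ) :
    σ.IsCycleOn (O : Set (Fin N)) := by
  refine ⟨⟨fun i hi => (orbit_apply_mem hO).2 hi, σ.injective.injOn, fun i hi => ?_⟩, ?_⟩
  · refine ⟨σ⁻¹ i, ?_, by simp⟩
    rw [Finset.mem_coe, ← orbit_apply_mem hO]
    simpa using hi
  · intro i hi k hk
    have := eq_orbitAt hO hi
    rw [Finset.mem_coe, this, mem_orbitAt] at hk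
    exact hk

/-! ### Cycle lengths with fixed points, compared with `cycleType`. -/

variable (σ)

/-- The lengths of the cycles of a permutation, fixed points included. -/
def lens : Multiset ℕ := (orbitsOf σ).val.map Finset.card

lemma sum_lens : (lens σ).sum = N := sum_card_orbitsOf

lemma pos_of_mem_lens {a : ℕ} (ha : a ∈ lens σ) : 0 < a := by
  obtain ⟨O, hO, rfl⟩ := Multiset.mem_map.1 ha
  exact (orbit_nonempty hO).card_pos

/-- `cycleType` forgets fixed points; an orbit with at least two points is the support of exactly
one cycle factor. -/
lemma lens_filter : (lens σ).filter (2 ≤ ·) = σ.cycleType := by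
  classical
  have key : (orbitsOf σ).filter (fun O => 2 ≤ O.card) = σ.cycleFactorsFinset.image Perm.support := by
    ext O
    simp only [Finset.mem_filter, Finset.mem_image]
    constructor
    · rintro ⟨hO, h2⟩
      obtain ⟨i, rfl⟩ := mem_orbitsOf.1 hO
      have hi : i ∈ σ.support := by
        rw [Perm.mem_support]
        intro hfix
        obtain ⟨k, hk, hne⟩ := Finset.exists_mem_ne (s := orbitAt σ i) (by omega) i
        rw [mem_orbitAt] at hk
        exact hne (hk.eq_of_left hfix).symm
      refine ⟨σ.cycleOf i, Perm.cycleOf_mem_cycleFactorsFinset_iff.2 hi, ?_⟩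
      ext k
      rw [Perm.mem_support_cycleOf_iff, mem_orbitAt]
      exact ⟨fun h => h.1, fun h => ⟨h, hi⟩⟩
    · rintro ⟨c, hc, rfl⟩
      have hcyc := (Perm.mem_cycleFactorsFinset_iff.1 hc).1
      refine ⟨?_, hcyc.two_le_card_support⟩
      obtain ⟨i, hi⟩ := hcyc.nonempty_support
      have hci := Perm.cycle_is_cycleOf hi hc
      rw [mem_orbitsOf]
      refine ⟨i, ?_⟩
      have his : i ∈ σ.support := by
        rw [hci, Perm.mem_support_cycleOf_iff] at hi
        exact hi.2
      ext k
      rw [hci, Perm.mem_support_cycleOf_iff, mem_orbitAt]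
      exact ⟨fun h => ⟨h, his⟩, fun h => h.1⟩
  have inj : Set.InjOn Perm.support (σ.cycleFactorsFinset : Set (Perm (Fin N))) := by
    intro c hc d hd h
    have hcyc := (Perm.mem_cycleFactorsFinset_iff.1 (Finset.mem_coe.1 hc)).1
    obtain ⟨i, hi⟩ := hcyc.nonempty_support
    rw [Perm.cycle_is_cycleOf hi hc, Perm.cycle_is_cycleOf (h ▸ hi) hd]
  rw [Perm.cycleType_def, lens, Multiset.filter_map, ← Multiset.map_map,
    ← Finset.image_val_of_injOn inj, ← key]
  rfl

lemma lens_eq : lens σ = σ.cycleType + Multiset.replicate (N - σ.cycleType.sum) 1 := by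
  have h1 : (lens σ).filter (fun a => ¬ 2 ≤ a) =
      Multiset.replicate ((lens σ).filter (fun a => ¬ 2 ≤ a)).card 1 := by
    rw [Multiset.eq_replicate_card]
    intro a ha
    rw [Multiset.mem_filter] at ha
    have := pos_of_mem_lens σ ha.1
    omega
  have h2 := Multiset.filter_add_not (fun a => 2 ≤ a) (lens σ)
  have h3 := sum_lens σ
  rw [← h2, Multiset.sum_add, lens_filter, h1, Multiset.sum_replicate, smul_eq_mul, mul_one] at h3
  rw [← h2, lens_filter, h1]
  congr 2
  omega

variable {σ}

lemma lens_eq_iff {τ : Perm (Fin N)} : lens σ = lens τ ↔ σ.cycleType = τ.cycleType := by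
  constructor
  · intro h
    rw [← lens_filter, h, lens_filter]
  · intro h
    rw [lens_eq, lens_eq, h]

lemma exists_lens {m : Multiset ℕ} (hm : ∀ a ∈ m, 0 < a) (hs : m.sum = N) :
    ∃ σ : Perm (Fin N), lens σ = m := by
  have h2 := Multiset.filter_add_not (fun a => 2 ≤ a) m
  have h1 : m.filter (fun a => ¬ 2 ≤ a) =
      Multiset.replicate (m.filter (fun a => ¬ 2 ≤ a)).card 1 := by
    rw [Multiset.eq_replicate_card]
    intro a ha
    rw [Multiset.mem_filter] at ha
    have := hm a ha.1
    omega
  have h3 := hs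
  rw [← h2, Multiset.sum_add, h1, Multiset.sum_replicate, smul_eq_mul, mul_one] at h3
  obtain ⟨σ, hσ⟩ := (Perm.exists_with_cycleType_iff (Fin N) (m := m.filter (2 ≤ ·))).2
    ⟨by rw [Fintype.card_fin]; omega, fun a ha => (Multiset.mem_filter.1 ha).2⟩
  refine ⟨σ, ?_⟩
  rw [lens_eq, hσ]
  conv_rhs => rw [← h2, h1]
  congr 2
  omega

/-! ### Factorials of multiplicities and sizes of conjugacy classes of permutations. -/

/-- The product of the factorials of the multiplicities. -/
def multFactorial {α : Type*} (M : Multiset α) : ℕ := by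
  classical
  exact ∏ a ∈ M.toFinset, (M.count a).factorial

lemma multFactorial_eq_prod {α : Type*} [DecidableEq α] (M : Multiset α) {s : Finset α}
    (hs : ∀ a ∈ M, a ∈ s) : multFactorial M = ∏ a ∈ s, (M.count a).factorial := by
  have h : multFactorial M = ∏ a ∈ M.toFinset, (M.count a).factorial := by
    rw [multFactorial]
    congr!
  rw [h]
  refine Finset.prod_subset (fun a ha => hs a (Multiset.mem_toFinset.1 ha)) ?_
  intro a _ ha
  rw [Multiset.count_eq_zero_of_notMem (by simpa using ha), Nat.factorial_zero]

lemma multFactorial_pos {α : Type*} (M : Multiset α) : 0 < multFactorial M :=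
  Finset.prod_pos fun _ _ => Nat.factorial_pos _

lemma multFactorial_map {α β : Type*} {f : α → β} (hf : Function.Injective f) (M : Multiset α) :
    multFactorial (M.map f) = multFactorial M := by
  classical
  rw [multFactorial_eq_prod (M.map f) (s := M.toFinset.image f) (by
    intro b hb
    obtain ⟨a, ha, rfl⟩ := Multiset.mem_map.1 hb
    exact Finset.mem_image_of_mem _ (Multiset.mem_toFinset.2 ha)),
    Finset.prod_image (fun a _ b _ h => hf h),
    multFactorial_eq_prod M (s := M.toFinset) (fun a ha => Multiset.mem_toFinset.2 ha)]
  refine Finset.prod_congr rfl fun a _ => ?_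
  rw [Multiset.count_map_eq_count' _ _ hf]

lemma multFactorial_add_of_disjoint {α : Type*} {M M' : Multiset α} (h : Disjoint M M') :
    multFactorial (M + M') = multFactorial M * multFactorial M' := by
  classical
  rw [multFactorial_eq_prod (M + M') (s := M.toFinset ∪ M'.toFinset) (by simp),
    Finset.prod_union (by
      rw [Finset.disjoint_left]
      intro a ha hb
      exact Multiset.disjoint_left.1 h (Multiset.mem_toFinset.1 ha) (Multiset.mem_toFinset.1 hb)),
    multFactorial_eq_prod M (s := M.toFinset) (by simp),
    multFactorial_eq_prod M' (s := M'.toFinset) (by simp)]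
  congr 1
  · refine Finset.prod_congr rfl fun a ha => ?_
    rw [Multiset.count_add, Multiset.count_eq_zero_of_notMem (s := M')
      (Multiset.disjoint_left.1 h (Multiset.mem_toFinset.1 ha)), add_zero]
  · refine Finset.prod_congr rfl fun a ha => ?_
    rw [Multiset.count_add, Multiset.count_eq_zero_of_notMem (s := M)
      (Multiset.disjoint_right.1 h (Multiset.mem_toFinset.1 ha)), zero_add]

/-- The class formula for `cycleType` has a separate factorial for the fixed points. Counted as
cycles of length one, they contribute it to `multFactorial` and contribute `1` to the product of
lengths. -/
lemma card_lens (σ : Perm (Fin N)) :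
    Nat.card {τ : Perm (Fin N) // lens τ = lens σ} *
      ((lens σ).prod * multFactorial (lens σ)) = N.factorial := by
  classical
  have h := Perm.card_of_cycleType_mul_eq (Fin N) σ.cycleType
  have hle : σ.cycleType.sum ≤ Fintype.card (Fin N) ∧ ∀ a ∈ σ.cycleType, 2 ≤ a :=
    (Perm.exists_with_cycleType_iff (Fin N)).1 ⟨σ, rfl⟩
  rw [if_pos hle, Fintype.card_fin] at h
  rw [← h]
  congr 1
  · rw [Nat.card_eq_fintype_card, Fintype.card_subtype]
    simp only [lens_eq_iff]
  · rw [lens_eq, Multiset.prod_add, multFactorial_add_of_disjoint, Multiset.prod_replicate, one_pow,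
      mul_one]
    · have h1 : multFactorial (Multiset.replicate (N - σ.cycleType.sum) 1) =
          (N - σ.cycleType.sum).factorial := by
        rw [multFactorial_eq_prod _ (s := {1})]
        · simp
        · intro a ha
          simpa using Multiset.eq_of_mem_replicate ha
      rw [h1, multFactorial_eq_prod σ.cycleType (s := σ.cycleType.toFinset) (by simp)]
      ring
    · rw [Multiset.disjoint_right]
      intro a ha hb
      have := hle.2 a hb
      rw [Multiset.eq_of_mem_replicate ha] at this
      omega

end orbits

/-! ### Counting lifts of labellings -/

section lifts

variable {X T Y : Type*} [Fintype X]

lemma card_fiber_eq_count [DecidableEq T] (c : X → T) (t : T) [Fintype {x // c x = t}] :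
    Fintype.card {x // c x = t} = (Finset.univ.val.map c).count t := by
  rw [Fintype.card_of_subtype (Finset.univ.filter fun x => c x = t) (by simp), Multiset.count_map, Finset.card_def, Finset.filter_val]
  simp only [eq_comm]

lemma card_stabilizer_labelling (c : X → T) :
    Nat.card {σ : Perm X // c ∘ σ = c} = multFactorial (Finset.univ.val.map c) := by
  classical
  rw [Nat.card_eq_fintype_card, DomMulAct.stabilizer_card' c,
    multFactorial_eq_prod _ (s := Finset.univ.image c) (by simp)]
  exact Finset.prod_congr rfl fun t _ => by rw [card_fiber_eq_count]

lemma exists_equiv_of_map_eq {X' : Type*} [Fintype X'] {a : X → T} {b : X' → T}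
    (h : Finset.univ.val.map a = Finset.univ.val.map b) : ∃ e : X ≃ X', ∀ x, b (e x) = a x := by
  classical
  have e (t : T) : {x // a x = t} ≃ {x // b x = t} :=
    Fintype.equivOfCardEq (by rw [card_fiber_eq_count, card_fiber_eq_count, h])
  exact ⟨Equiv.ofFiberEquiv e, fun x => Equiv.ofFiberEquiv_map e x⟩

lemma exists_labelling (M : Multiset Y) (h : M.card = Fintype.card X) :
    ∃ p : X → Y, Finset.univ.val.map p = M := by
  classical
  have e : X ≃ M.ToType := Fintype.equivOfCardEq (by rw [Multiset.card_coe, h])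
  refine ⟨fun x => (e x : Y), ?_⟩
  conv_rhs => rw [← Multiset.map_univ_coe M, ← Multiset.map_univ_val_equiv e, Multiset.map_map]
  rfl

/-- Enumerate `M` by `X` in any way; composing with `f` gives a labelling with the same values as
`c` up to order, and a permutation of `X` corrects the order. -/
lemma exists_lift {c : X → T} {f : Y → T} {M : Multiset Y}
    (h : M.map f = Finset.univ.val.map c) :
    ∃ p : X → Y, f ∘ p = c ∧ Finset.univ.val.map p = M := by
  obtain ⟨p, hp⟩ := exists_labelling (X := X) M (by
    have := congrArg Multiset.card h
    simpa using this)
  rw [← hp, Multiset.map_map] at h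
  obtain ⟨σ, hσ⟩ := exists_equiv_of_map_eq h.symm
  refine ⟨p ∘ σ, funext hσ, ?_⟩
  rw [← hp, ← Multiset.map_map, Multiset.map_univ_val_equiv]

lemma card_eq_mul_of_fibers {A B : Type*} [Finite A] [Finite B] (F : A → B) {k : ℕ}
    (h : ∀ b, Nat.card {a // F a = b} = k) : Nat.card A = Nat.card B * k := by
  have := Fintype.ofFinite B
  rw [← Nat.card_congr (Equiv.sigmaFiberEquiv F), Nat.card_sigma]
  simp [h]

/-- Orbit–stabilizer: the permutations preserving `c` act transitively on the lifts of `c` with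
values `M`, and the stabilizer of a lift has order `multFactorial M`. These are the factorials that
cancel in Frobenius' formula. -/
lemma card_lifts {c : X → T} {f : Y → T} {M : Multiset Y}
    (h : M.map f = Finset.univ.val.map c) :
    Nat.card {p : X → Y // f ∘ p = c ∧ Finset.univ.val.map p = M} * multFactorial M =
      multFactorial (Finset.univ.val.map c) := by
  classical
  obtain ⟨p, hpc, hpM⟩ := exists_lift h
  have htr (σ : Perm X) : Finset.univ.val.map (p ∘ σ) = M := by
    rw [← hpM, ← Multiset.map_map, Multiset.map_univ_val_equiv]
  rw [← card_stabilizer_labelling c, ← hpM, ← card_stabilizer_labelling p]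
  let F : {σ : Perm X // c ∘ σ = c} →
      {p' : X → Y // f ∘ p' = c ∧ Finset.univ.val.map p' = Finset.univ.val.map p} := fun σ =>
    ⟨p ∘ σ.1, by rw [← Function.comp_assoc, hpc, σ.2], by rw [htr, hpM]⟩
  have lift (p' : {p' : X → Y // f ∘ p' = c ∧ Finset.univ.val.map p' = Finset.univ.val.map p}) :
      ∃ σ : Perm X, p ∘ σ = p'.1 :=
    (exists_equiv_of_map_eq p'.2.2).imp fun σ hσ => funext hσ
  have hfin : Finite
      {p' : X → Y // f ∘ p' = c ∧ Finset.univ.val.map p' = Finset.univ.val.map p} := by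
    choose s hs using lift
    refine Finite.of_injective s fun p' p'' h' => Subtype.ext ?_
    rw [← hs p', ← hs p'', h']
  refine (card_eq_mul_of_fibers F fun p' => ?_).symm
  obtain ⟨s, hs⟩ := lift p'
  have hcs : c ∘ s = c := by
    rw [← hpc, Function.comp_assoc, hs, p'.2.1, hpc]
  -- Right translation by `s⁻¹` carries the fibre above `p'` to the stabilizer of `p`.
  refine Nat.card_congr
    { toFun := fun σ => ⟨σ.1.1 * s⁻¹, ?_⟩
      invFun := fun σ => ⟨⟨σ.1 * s, ?_⟩, ?_⟩
      left_inv := fun σ => by simp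
      right_inv := fun σ => by simp }
  · have h1 : p ∘ σ.1.1 = p ∘ s := by rw [hs]; exact congrArg Subtype.val σ.2
    ext x
    simpa using congrFun h1 (s⁻¹ x)
  · rw [← hpc]
    ext x
    have h1 := congrFun σ.2 (s x)
    have h2 := congrFun hcs x
    rw [← hpc] at h2
    simp only [Function.comp_apply, Perm.coe_mul] at h1 h2 ⊢
    rw [h1, h2]
  · refine Subtype.ext ?_
    change p ∘ (σ.1 ∘ s) = p'.1
    rw [← Function.comp_assoc, σ.2, hs]

end lifts

/-! ### Conjugacy in the Weyl groups -/

section conj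

variable {N : ℕ}

/-- A permutation intertwining two permutations along a bijection of orbits. -/
lemma exists_intertwiner {σ σ' : Perm (Fin N)} (e : orbitsOf σ ≃ orbitsOf σ')
    (he : ∀ O, (e O).1.card = O.1.card) :
    ∃ τ : Perm (Fin N), (∀ i, τ (σ i) = σ' (τ i)) ∧
      ∀ O : orbitsOf σ, ∀ i ∈ O.1, τ i ∈ (e O).1 := by
  choose b hb using fun O : orbitsOf σ => orbit_nonempty O.2
  choose b' hb' using fun O : orbitsOf σ' => orbit_nonempty O.2
  let o (i : Fin N) : orbitsOf σ := ⟨orbitAt σ i, orbitAt_mem i⟩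
  have ho (i : Fin N) : i ∈ (o i).1 := self_mem_orbitAt i
  have ho' {O : orbitsOf σ} {i : Fin N} (h : i ∈ O.1) : o i = O :=
    Subtype.ext (eq_orbitAt O.2 h).symm
  choose k _ hk using fun i => (isCycleOn_orbit (o i).2).exists_pow_eq (hb (o i)) (ho i)
  -- Matched orbits have the same length, so two exponents give the same point of one exactly when
  -- they do in the other; this makes `t` below injective and equivariant.
  have key (O : orbitsOf σ) (m n : ℕ) : (σ ^ m) (b O) = (σ ^ n) (b O) ↔
      (σ' ^ m) (b' (e O)) = (σ' ^ n) (b' (e O)) := by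
    rw [(isCycleOn_orbit O.2).pow_apply_eq_pow_apply (hb O),
      (isCycleOn_orbit (e O).2).pow_apply_eq_pow_apply (hb' _), he]
  let t (i : Fin N) : Fin N := (σ' ^ k i) (b' (e (o i)))
  have tmem (i : Fin N) : t i ∈ (e (o i)).1 :=
    ((isCycleOn_orbit (e (o i)).2).1.mapsTo.perm_pow _) (hb' _)
  have inj : Function.Injective t := by
    intro i j h
    have h1 : e (o i) = e (o j) := by
      refine Subtype.ext ?_
      rw [eq_orbitAt (e (o i)).2 (tmem i), eq_orbitAt (e (o j)).2 (tmem j), h]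
    have h2 : o i = o j := e.injective h1
    have h3 : (σ' ^ k i) (b' (e (o j))) = (σ' ^ k j) (b' (e (o j))) := by
      rw [← h1]
      exact h.trans (by rw [h1])
    rw [← key, ← h2, hk, h2, hk] at h3
    exact h3
  refine ⟨Equiv.ofBijective t (Finite.injective_iff_bijective.1 inj), fun i => ?_, fun O i hi => ?_⟩
  · have h1 : o (σ i) = o i := Subtype.ext (orbitAt_apply i)
    change (σ' ^ k (σ i)) (b' (e (o (σ i)))) = σ' ((σ' ^ k i) (b' (e (o i))))
    rw [← Perm.mul_apply, ← pow_succ', h1, ← key, pow_succ', Perm.mul_apply, hk, ← h1, hk]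
  · rw [← ho' hi]
    exact tmem i

/-- Functions whose products over the orbits of `σ` are trivial are coboundaries. -/
lemma exists_coboundary (σ : Perm (Fin N)) (r : Fin N → ℤˣ)
    (hr : ∀ O ∈ orbitsOf σ, ∏ i ∈ O, r i = 1) :
    ∃ t : Fin N → ℤˣ, ∀ i, t (σ i) = r i * t i := by
  choose b hb using fun O : orbitsOf σ => orbit_nonempty O.2
  let o (i : Fin N) : orbitsOf σ := ⟨orbitAt σ i, orbitAt_mem i⟩
  have ho (i : Fin N) : i ∈ (o i).1 := self_mem_orbitAt i
  choose k hlt hk using fun i => (isCycleOn_orbit (o i).2).exists_pow_eq (hb (o i)) (ho i)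
  -- The product of `r` along the path from the base point of the orbit to `i`.
  let t (i : Fin N) : ℤˣ := ∏ j ∈ Finset.range (k i), r ((σ ^ j) (b (o i)))
  refine ⟨t, fun i => ?_⟩
  have h1 : o (σ i) = o i := Subtype.ext (orbitAt_apply i)
  have hcyc := isCycleOn_orbit (o i).2
  have h2 : k (σ i) ≡ k i + 1 [MOD (o i).1.card] := by
    rw [← hcyc.pow_apply_eq_pow_apply (hb _), pow_succ', Perm.mul_apply, hk, ← h1, hk]
  have h3 : r i * t i = ∏ j ∈ Finset.range (k i + 1), r ((σ ^ j) (b (o i))) := by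
    rw [Finset.prod_range_succ, hk, mul_comm]
  rw [h3]
  change ∏ j ∈ Finset.range (k (σ i)), r ((σ ^ j) (b (o (σ i)))) = _
  rw [h1]
  have hlt1 := hlt i
  have hlt2 := hlt (σ i)
  rw [h1] at hlt2
  -- Either the path grows by one step, or it closes up at the base point; the second case is where
  -- the hypothesis on the full product over the orbit enters.
  rcases (Nat.succ_le_of_lt hlt1).lt_or_eq with h | h
  · rw [Nat.ModEq, Nat.mod_eq_of_lt hlt2, Nat.mod_eq_of_lt h] at h2
    rw [h2]
  · have h' : k i + 1 = (o i).1.card := h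
    rw [h', Nat.ModEq, Nat.mod_self, Nat.mod_eq_of_lt hlt2] at h2
    rw [h2, h', Finset.prod_range_zero, ← hr _ (o i).2]
    refine (Finset.prod_bij (fun j _ => (σ ^ j) (b (o i))) ?_ ?_ ?_ ?_).symm
    · exact fun j _ => (hcyc.1.mapsTo.perm_pow _) (hb _)
    · intro m hm n hn hmn
      rw [hcyc.pow_apply_eq_pow_apply (hb _), Nat.ModEq, Nat.mod_eq_of_lt (Finset.mem_range.1 hm),
        Nat.mod_eq_of_lt (Finset.mem_range.1 hn)] at hmn
      exact hmn
    · intro j hj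
      obtain ⟨n, hn, h⟩ := hcyc.exists_pow_eq (hb _) hj
      exact ⟨n, Finset.mem_range.2 hn, h⟩
    · exact fun _ _ => rfl

/-- The signs of the orbits of a signed permutation can be prescribed. -/
lemma card_signs (σ : Perm (Fin N)) (p : orbitsOf σ → ℤˣ) :
    Nat.card {s : Fin N → ℤˣ // ∀ O : orbitsOf σ, ∏ i ∈ O.1, s i = p O} *
      2 ^ (orbitsOf σ).card = 2 ^ N := by
  classical
  let P : (Fin N → ℤˣ) →* (orbitsOf σ → ℤˣ) :=
    { toFun := fun s O => ∏ i ∈ O.1, s i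
      map_one' := by ext; simp
      map_mul' := fun s s' => by ext; simp [Finset.prod_mul_distrib] }
  have hsurj : Function.Surjective P := by
    intro p
    choose b hb using fun O : orbitsOf σ => orbit_nonempty O.2
    let o (i : Fin N) : orbitsOf σ := ⟨orbitAt σ i, orbitAt_mem i⟩
    -- The prescribed sign is carried entirely by the base point of each orbit.
    refine ⟨fun i => if i = b (o i) then p (o i) else 1, funext fun O => ?_⟩
    change ∏ i ∈ O.1, (if i = b (o i) then p (o i) else 1) = p O
    have ho' {i : Fin N} (h : i ∈ O.1) : o i = O := Subtype.ext (eq_orbitAt O.2 h).symm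
    rw [Finset.prod_eq_single (b O)]
    · rw [ho' (hb O), if_pos rfl]
    · intro i hi hne
      rw [ho' hi, if_neg hne]
    · exact fun h => absurd (hb O) h
  have hker (p : orbitsOf σ → ℤˣ) :
      Nat.card {s : Fin N → ℤˣ // P s = p} = Nat.card P.ker := by
    obtain ⟨s₀, rfl⟩ := hsurj p
    refine Nat.card_congr
      { toFun := fun s => ⟨s.1 * s₀⁻¹, by
          rw [MonoidHom.mem_ker, map_mul, s.2, map_inv, mul_inv_cancel]⟩
        invFun := fun s => ⟨s.1 * s₀, by rw [map_mul, MonoidHom.mem_ker.1 s.2, one_mul]⟩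
        left_inv := fun s => by simp
        right_inv := fun s => by simp }
  have h1 := card_eq_mul_of_fibers P hker
  have h2 : Nat.card (Fin N → ℤˣ) = 2 ^ N := by simp [Nat.card_eq_fintype_card]
  have h3 : Nat.card (orbitsOf σ → ℤˣ) = 2 ^ (orbitsOf σ).card := by
    simp [Nat.card_eq_fintype_card]
  rw [h2, h3] at h1
  rw [h1, ← hker p, mul_comm]
  congr 1
  exact Nat.card_congr (Equiv.subtypeEquivRight fun s => by
    rw [funext_iff]; rfl)

end conj

/-! ### Signed cycle types -/

section cycleTypes

variable {N : ℕ}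

/-- The signed cycles that occur in groups of the given kind. -/
def IsCycleOf : Kind → ℕ × ℤˣ → Prop
  | .A, a => 0 < a.1 ∧ a.2 = 1
  | .C, a => 0 < a.1

/-- The order of the centralizer of a cycle in the group of rank its length. -/
def cycleWeight : Kind → ℕ × ℤˣ → ℕ
  | .A, a => a.1
  | .C, a => 2 * a.1

lemma IsCycleOf.pos {t : Kind} {a : ℕ × ℤˣ} (h : IsCycleOf t a) : 0 < a.1 := by
  cases t
  · exact h.1
  · exact h

lemma cycleWeight_pos {t : Kind} {a : ℕ × ℤˣ} (h : IsCycleOf t a) : 0 < cycleWeight t a := by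
  have := h.pos
  cases t <;> simpa [cycleWeight]

lemma cycles_A (σ : Perm (Fin N)) :
    cycles (t := .A) (N := N) σ = (lens σ).map fun a => (a, 1) := by
  simp [cycles, lens, Multiset.map_map]

lemma cycles_C (w : WeylC N) : cycles (t := .C) (N := N) w =
    (orbitsOf w.right).val.map fun O => (O.card, ∏ i ∈ O, w.left i) := rfl

lemma map_fst_cycles_C (w : WeylC N) :
    (cycles (t := .C) (N := N) w).map Prod.fst = lens w.right := by
  simp [cycles_C, lens, Multiset.map_map]

lemma isCycleOf_of_mem_cycles : ∀ {t : Kind} (w : WeylGroup t N) {a : ℕ × ℤˣ},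
    a ∈ cycles w → IsCycleOf t a
  | .A, (σ : Perm (Fin N)), a, ha => by
    rw [cycles_A] at ha
    obtain ⟨l, hl, rfl⟩ := Multiset.mem_map.1 ha
    exact ⟨pos_of_mem_lens σ hl, rfl⟩
  | .C, (w : WeylC N), a, ha => by
    have := Multiset.mem_map_of_mem Prod.fst ha
    rw [map_fst_cycles_C] at this
    exact pos_of_mem_lens _ this

lemma sum_length_cycles : ∀ {t : Kind} (w : WeylGroup t N), ((cycles w).map Prod.fst).sum = N
  | .A, (σ : Perm (Fin N)) => by
    rw [cycles_A, Multiset.map_map]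
    simpa using sum_lens σ
  | .C, (w : WeylC N) => by
    rw [map_fst_cycles_C, sum_lens]

lemma sgnCD_eq_prod : ∀ {t : Kind} (w : WeylGroup t N), sgnCD w = ((cycles w).map Prod.snd).prod
  | .A, (σ : Perm (Fin N)) => by
    rw [cycles_A, Multiset.map_map]
    simp [sgnCD]
  | .C, (w : WeylC N) => by
    rw [cycles_C, Multiset.map_map]
    exact (prod_orbitsOf (σ := w.right) w.left).symm

lemma map_val_eq_univ {α β : Type*} (s : Finset α) (f : α → β) :
    s.val.map f = (Finset.univ : Finset s).val.map fun x : s => f x := by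
  rw [Finset.univ_eq_attach, Finset.attach_val, ← Multiset.attach_map_val' s.val f]
  rfl

/-- For type `C`, a permutation with the right lengths is chosen first, the signed cycles are then
distributed over its orbits by `exists_lift`, and `card_signs` shows that some vector of signs
realises them. -/
lemma exists_cycles_eq : ∀ {t : Kind} {M : Multiset (ℕ × ℤˣ)}, (∀ a ∈ M, IsCycleOf t a) →
    (M.map Prod.fst).sum = N → ∃ w : WeylGroup t N, cycles w = M
  | .A, M, hM, hs => by
    obtain ⟨σ, hσ⟩ := exists_lens (m := M.map Prod.fst) (N := N) (by
      intro a ha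
      obtain ⟨b, hb, rfl⟩ := Multiset.mem_map.1 ha
      exact (hM b hb).1) hs
    refine ⟨σ, ?_⟩
    rw [cycles_A, hσ, Multiset.map_map]
    conv_rhs => rw [← Multiset.map_id M]
    exact Multiset.map_congr rfl fun a ha => Prod.ext rfl (hM a ha).2.symm
  | .C, M, hM, hs => by
    obtain ⟨σ, hσ⟩ := exists_lens (m := M.map Prod.fst) (N := N) (by
      intro a ha
      obtain ⟨b, hb, rfl⟩ := Multiset.mem_map.1 ha
      exact hM b hb) hs
    rw [lens, map_val_eq_univ] at hσ
    obtain ⟨p, hp, hpM⟩ := exists_lift hσ.symm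
    have h := card_signs σ fun O => (p O).2
    have h0 : Nat.card {s : Fin N → ℤˣ // ∀ O : orbitsOf σ, ∏ i ∈ O.1, s i = (p O).2} ≠ 0 := by
      intro h0
      rw [h0, zero_mul] at h
      exact (pow_ne_zero N two_ne_zero) h.symm
    obtain ⟨⟨s, hs⟩⟩ := (Nat.card_ne_zero.1 h0).1
    refine ⟨(⟨s, σ⟩ : WeylC N), ?_⟩
    rw [cycles_C, map_val_eq_univ, ← hpM]
    exact Multiset.map_congr rfl fun O _ => Prod.ext (congrFun hp O).symm (hs O)

/-- The relation `c * w = w' * c` read on the two components of the semidirect product, with `c =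
(t, τ)`; this avoids computing inverses. -/
lemma isConj_C_iff (w w' : WeylC N) : IsConj w w' ↔ ∃ (τ : Perm (Fin N)) (t : Fin N → ℤˣ),
    (∀ i, τ (w.right i) = w'.right (τ i)) ∧
      ∀ i, t i * w.left (τ⁻¹ i) = w'.left i * t (w'.right⁻¹ i) := by
  rw [isConj_iff]
  constructor
  · rintro ⟨c, hc⟩
    have hc' : c * w = w' * c := by rw [← hc, inv_mul_cancel_right]
    refine ⟨c.right, c.left, fun i => ?_, fun i => ?_⟩
    · exact Equiv.congr_fun (congrArg SemidirectProduct.right hc') i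
    · exact congrFun (congrArg SemidirectProduct.left hc') i
  · rintro ⟨τ, t, h1, h2⟩
    refine ⟨⟨t, τ⟩, ?_⟩
    rw [mul_inv_eq_iff_eq_mul]
    exact SemidirectProduct.ext (funext h2) (Equiv.ext h1)

lemma prod_comp_orbit {M : Type*} [CommMonoid M] {σ : Perm (Fin N)} {O : Finset (Fin N)}
    (hO : O ∈ orbitsOf σ) (f : Fin N → M) : ∏ i ∈ O, f (σ i) = ∏ i ∈ O, f i := by
  refine Finset.prod_equiv σ (fun i => (orbit_apply_mem hO).symm) fun _ _ => rfl

lemma cycles_eq_of_isConj_C {w w' : WeylC N} (h : IsConj w w') :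
    cycles (t := .C) (N := N) w = cycles (t := .C) (N := N) w' := by
  classical
  obtain ⟨τ, t, h1, h2⟩ := (isConj_C_iff w w').1 h
  have hτ : w'.right = τ * w.right * τ⁻¹ := by
    ext i
    simp [h1]
  have horb (i : Fin N) : (orbitAt w.right i).map τ.toEmbedding = orbitAt w'.right (τ i) := by
    ext k
    rw [Finset.mem_map_equiv, mem_orbitAt, mem_orbitAt, hτ, Perm.sameCycle_conj]
    simp
  have himg : orbitsOf w'.right = (orbitsOf w.right).image (Finset.map τ.toEmbedding) := by
    ext O
    rw [mem_orbitsOf, Finset.mem_image]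
    constructor
    · rintro ⟨i, rfl⟩
      exact ⟨_, orbitAt_mem (τ⁻¹ i), by rw [horb]; simp⟩
    · rintro ⟨O', hO', rfl⟩
      obtain ⟨i, rfl⟩ := mem_orbitsOf.1 hO'
      exact ⟨τ i, (horb i).symm⟩
  rw [cycles_C, cycles_C, himg, Finset.image_val_of_injOn (Finset.map_injective _).injOn,
    Multiset.map_map]
  refine Multiset.map_congr rfl fun O hO => ?_
  have hO' : O.map τ.toEmbedding ∈ orbitsOf w'.right := himg ▸ Finset.mem_image_of_mem _ hO
  refine Prod.ext (by simp) ?_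
  have h3 : ∏ i ∈ O.map τ.toEmbedding, (t i * w.left (τ⁻¹ i)) =
      ∏ i ∈ O.map τ.toEmbedding, (w'.left i * t (w'.right⁻¹ i)) :=
    Finset.prod_congr rfl fun i _ => h2 i
  -- Reindexing by `w'.right` inside the orbit makes the same product of `t` appear on both sides,
  -- so that it cancels.
  rw [Finset.prod_mul_distrib, Finset.prod_mul_distrib,
    ← prod_comp_orbit hO' fun i => t (w'.right⁻¹ i)] at h3
  simp only [Perm.inv_def, Equiv.symm_apply_apply] at h3
  rw [mul_comm] at h3
  have h4 := mul_right_cancel h3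
  simp only [Function.comp_apply]
  rw [← h4]
  simp

/-- Matching orbits by length and sign gives `τ`. The signs transported by `τ` may still differ from
those of `w'`, but with trivial product over each orbit, so the difference is a coboundary `t`. -/
lemma isConj_of_cycles_eq_C {w w' : WeylC N}
    (h : cycles (t := .C) (N := N) w = cycles (t := .C) (N := N) w') : IsConj w w' := by
  classical
  rw [cycles_C, cycles_C, map_val_eq_univ (orbitsOf w.right),
    map_val_eq_univ (orbitsOf w'.right)] at h
  obtain ⟨e, he⟩ := exists_equiv_of_map_eq h
  obtain ⟨τ, h1, h2⟩ := exists_intertwiner e fun O => (Prod.ext_iff.1 (he O)).1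
  have hmap (O : orbitsOf w.right) : O.1.map τ.toEmbedding = (e O).1 := by
    refine Finset.eq_of_subset_of_card_le (fun i hi => ?_) ?_
    · obtain ⟨k, hk, rfl⟩ := Finset.mem_map.1 hi
      exact h2 O k hk
    · rw [Finset.card_map]
      exact (Prod.ext_iff.1 (he O)).1.le
  obtain ⟨t, ht⟩ := exists_coboundary w'.right
    (fun i => w'.left (w'.right i) * w.left (τ⁻¹ (w'.right i))) fun O' hO' => by
      rw [prod_comp_orbit hO' fun i => w'.left i * w.left (τ⁻¹ i), Finset.prod_mul_distrib]
      obtain ⟨O, hO⟩ := e.surjective ⟨O', hO'⟩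
      have h3 : ∏ i ∈ (e O).1, w'.left i = ∏ i ∈ O.1, w.left i := (Prod.ext_iff.1 (he O)).2
      have h4 : ∏ i ∈ (e O).1, w.left (τ⁻¹ i) = ∏ i ∈ O.1, w.left i := by
        rw [← hmap]
        simp
      rw [hO] at h3 h4
      rw [h3, h4, Int.units_mul_self]
  refine (isConj_C_iff w w').2 ⟨τ, t, h1, fun i => ?_⟩
  have h3 := ht (w'.right⁻¹ i)
  simp only [Perm.inv_def, Equiv.apply_symm_apply] at h3 ⊢
  rw [h3, mul_right_comm, mul_assoc (w'.left i), Int.units_mul_self, mul_one]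

lemma cycles_eq_iff : ∀ {t : Kind} {w w' : WeylGroup t N}, cycles w = cycles w' ↔ IsConj w w'
  | .A, (σ : Perm (Fin N)), (σ' : Perm (Fin N)) => by
    rw [cycles_A, cycles_A, Multiset.map_eq_map (fun a b h => (Prod.ext_iff.1 h).1), lens_eq_iff]
    exact Perm.isConj_iff_cycleType_eq.symm
  | .C, _, _ => ⟨isConj_of_cycles_eq_C, cycles_eq_of_isConj_C⟩

/-- The order of the centralizer of an element with given signed cycles. -/
def centWeight (t : Kind) (M : Multiset (ℕ × ℤˣ)) : ℕ :=
  (M.map (cycleWeight t)).prod * multFactorial M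

/-- Elements with signed cycles `M` are fibred over the permutations with the underlying lengths. A
point of a fibre is a distribution of the signed cycles over the orbits, counted by `card_lifts`,
followed by signs with the prescribed products, counted by `card_signs`. -/
lemma card_cycles_eq_C (w : WeylC N) :
    Nat.card {w' : WeylC N // cycles (t := .C) (N := N) w' = cycles (t := .C) (N := N) w} *
      centWeight .C (cycles (t := .C) (N := N) w) = Nat.card (WeylC N) := by
  classical
  set M := cycles (t := .C) (N := N) w with hM
  have hfst : M.map Prod.fst = lens w.right := map_fst_cycles_C w
  let F : {w' : WeylC N // cycles (t := .C) (N := N) w' = M} →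
      {σ : Perm (Fin N) // lens σ = lens w.right} := fun w' =>
    ⟨w'.1.right, by rw [← map_fst_cycles_C, w'.2, hfst]⟩
  have hcard {σ : Perm (Fin N)} (hσ : lens σ = lens w.right) : (orbitsOf σ).card = M.card := by
    have h1 : (lens σ).card = (orbitsOf σ).card := Multiset.card_map _ _
    rw [← h1, hσ, ← hfst, Multiset.card_map]
  have hle : M.card ≤ N := by
    rw [← hcard rfl, Finset.card_eq_sum_ones]
    refine le_of_le_of_eq ?_ (sum_card_orbitsOf (σ := w.right))
    exact Finset.sum_le_sum fun O hO => (orbit_nonempty hO).card_pos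
  have hfib (σ : {σ : Perm (Fin N) // lens σ = lens w.right}) :
      Nat.card {w' // F w' = σ} = multFactorial (lens w.right) / multFactorial M *
        2 ^ (N - M.card) := by
    have e : {w' // F w' = σ} ≃ {s : Fin N → ℤˣ // cycles (t := .C) (N := N)
        (⟨s, σ.1⟩ : WeylC N) = M} :=
      { toFun := fun w' => ⟨w'.1.1.left, by
          have h1 : w'.1.1.right = σ.1 := congrArg Subtype.val w'.2
          have h2 := w'.1.2
          rw [← h1]
          exact h2⟩
        invFun := fun s => ⟨⟨⟨s.1, σ.1⟩, s.2⟩, rfl⟩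
        left_inv := fun w' => by
          have h1 : w'.1.1.right = σ.1 := congrArg Subtype.val w'.2
          exact Subtype.ext (Subtype.ext (SemidirectProduct.ext rfl h1.symm))
        right_inv := fun s => rfl }
    rw [Nat.card_congr e]
    have hσ : M.map Prod.fst = (Finset.univ : Finset (orbitsOf σ.1)).val.map fun O => O.1.card := by
      rw [hfst]
      refine σ.2.symm.trans ?_
      rw [lens, map_val_eq_univ]
    have hL := card_lifts hσ
    have hL' : Nat.card {p : orbitsOf σ.1 → ℕ × ℤˣ // Prod.fst ∘ p = (fun O => O.1.card) ∧
        Finset.univ.val.map p = M} = multFactorial (lens w.right) / multFactorial M := by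
      rw [← hσ, hfst] at hL
      exact (Nat.div_eq_of_eq_mul_left (multFactorial_pos M) hL.symm).symm
    -- The lifts take values in an infinite type; finiteness is read off from the nonzero
    -- `Nat.card`, which would be `0` for an infinite type.
    have hfin : Finite {p : orbitsOf σ.1 → ℕ × ℤˣ // Prod.fst ∘ p = (fun O => O.1.card) ∧
        Finset.univ.val.map p = M} := by
      refine Nat.finite_of_card_ne_zero fun h0 => ?_
      rw [h0, zero_mul] at hL
      exact (multFactorial_pos _).ne hL
    rw [← hL']
    have hmem (s : {s : Fin N → ℤˣ // cycles (t := .C) (N := N) (⟨s, σ.1⟩ : WeylC N) = M}) :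
        (Finset.univ.val.map fun O : orbitsOf σ.1 => (O.1.card, ∏ i ∈ O.1, s.1 i)) = M := by
      rw [← map_val_eq_univ (orbitsOf σ.1) fun O => (O.card, ∏ i ∈ O, s.1 i)]
      exact s.2
    refine card_eq_mul_of_fibers (fun s : {s : Fin N → ℤˣ // cycles (t := .C) (N := N)
        (⟨s, σ.1⟩ : WeylC N) = M} => ⟨fun O => (O.1.card, ∏ i ∈ O.1, s.1 i), rfl, hmem s⟩) ?_
    · intro p
      have h1 := card_signs σ.1 fun O => (p.1 O).2
      rw [hcard σ.2] at h1
      have h2 : 2 ^ N = 2 ^ (N - M.card) * 2 ^ M.card := by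
        rw [← pow_add, Nat.sub_add_cancel hle]
      rw [h2] at h1
      rw [← Nat.eq_of_mul_eq_mul_right (by positivity) h1]
      refine Nat.card_congr
        { toFun := fun s => ⟨s.1.1, fun O => ?_⟩
          invFun := fun s => ⟨⟨s.1, ?_⟩, ?_⟩
          left_inv := fun s => rfl
          right_inv := fun s => rfl }
      · have := congrFun (congrArg Subtype.val s.2) O
        exact (Prod.ext_iff.1 this).2
      · rw [cycles_C, map_val_eq_univ]
        refine Eq.trans ?_ p.2.2
        exact Multiset.map_congr rfl fun O _ => Prod.ext (congrFun p.2.1 O).symm (s.2 O)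
      · exact Subtype.ext (funext fun O => Prod.ext (congrFun p.2.1 O).symm (s.2 O))
  have hW : Finite (WeylC N) := instFiniteWeylGroup .C N
  rw [card_eq_mul_of_fibers F hfib, Nat.card_congr SemidirectProduct.equivProd, Nat.card_prod]
  have h1 := card_lens w.right
  have hdvd : multFactorial M ∣ multFactorial (lens w.right) := by
    have hσ : M.map Prod.fst =
        (Finset.univ : Finset (orbitsOf w.right)).val.map fun O => O.1.card := by
      rw [hfst, lens, map_val_eq_univ]
    rw [← hfst, hσ, ← card_lifts hσ]
    exact dvd_mul_left _ _
  have h2 : (M.map (cycleWeight .C)).prod = 2 ^ M.card * (lens w.right).prod := by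
    rw [← hfst]
    have : M.map (cycleWeight .C) = M.map fun a => 2 * a.1 := rfl
    rw [this, Multiset.prod_map_mul, Multiset.map_const', Multiset.prod_replicate]
  have h3 : Nat.card (Fin N → ℤˣ) = 2 ^ N := by simp [Nat.card_eq_fintype_card]
  have h4 : Nat.card (Perm (Fin N)) = N.factorial := by
    rw [Nat.card_eq_fintype_card, Fintype.card_perm, Fintype.card_fin]
  have h5 : 2 ^ N = 2 ^ (N - M.card) * 2 ^ M.card := by
    rw [← pow_add, Nat.sub_add_cancel hle]
  rw [h3, h4, ← h1, centWeight, h2, h5]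
  obtain ⟨k, hk⟩ := hdvd
  rw [hk, Nat.mul_div_cancel_left _ (multFactorial_pos M)]
  ring

lemma card_cycles_eq : ∀ {t : Kind} (w : WeylGroup t N),
    Nat.card {w' : WeylGroup t N // cycles w' = cycles w} * centWeight t (cycles w) =
      Nat.card (WeylGroup t N)
  | .A, (σ : Perm (Fin N)) => by
    have h4 : Nat.card (WeylGroup .A N) = N.factorial := by
      change Nat.card (Perm (Fin N)) = _
      rw [Nat.card_eq_fintype_card, Fintype.card_perm, Fintype.card_fin]
    rw [h4, ← card_lens σ]
    have hinj : Function.Injective fun a : ℕ => (a, (1 : ℤˣ)) :=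
      fun a b h => (Prod.ext_iff.1 h).1
    have h1 : centWeight .A (cycles (t := .A) (N := N) σ) =
        (lens σ).prod * multFactorial (lens σ) := by
      rw [centWeight, cycles_A, multFactorial_map hinj, Multiset.map_map]
      congr 2
      exact Multiset.map_id' _
    rw [h1]
    congr 1
    refine Nat.card_congr (Equiv.subtypeEquivRight fun σ' => ?_)
    have h2 := Multiset.map_eq_map hinj (s := lens σ') (t := lens σ)
    rw [← cycles_A] at h2
    exact (Iff.of_eq (congrArg (· = cycles (t := .A) (N := N) σ) (cycles_A σ'))).trans h2
  | .C, w => card_cycles_eq_C w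

end cycleTypes

/-! ### Labelled cycle types of elements of products -/

section labelled

variable {K : Type} [Fintype K] {t : K → Kind} {r : K → ℕ}

/-- All cycles of an element of a product, labelled by the factor in which they lie. -/
def labelledCycles (w : WProd t r) : Multiset (K × (ℕ × ℤˣ)) :=
  ∑ x, (cycles (w x)).map (Prod.mk x)

open scoped Classical in
/-- The cycles with a given label. -/
def cyclesAt (x : K) (M : Multiset (K × (ℕ × ℤˣ))) : Multiset (ℕ × ℤˣ) :=
  (M.filter fun b => b.1 = x).map Prod.snd

open scoped Classical in
/-- The total length of the cycles with a given label. -/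
def rankAt (M : Multiset (K × (ℕ × ℤˣ))) (x : K) : ℕ :=
  (M.map fun b => if b.1 = x then b.2.1 else 0).sum

lemma rankAt_eq (M : Multiset (K × (ℕ × ℤˣ))) (x : K) :
    rankAt M x = ((cyclesAt x M).map Prod.fst).sum := by
  classical
  rw [rankAt, cyclesAt, Multiset.map_map]
  induction M using Multiset.induction_on with
  | empty => simp
  | cons b M ih =>
    rw [Multiset.map_cons, Multiset.sum_cons, ih, Multiset.filter_cons]
    split_ifs <;> simp

lemma cyclesAt_finset_sum {ι : Type*} (s : Finset ι) (g : ι → Multiset (K × (ℕ × ℤˣ))) (x : K) :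
    cyclesAt x (∑ i ∈ s, g i) = ∑ i ∈ s, cyclesAt x (g i) := by
  classical
  induction s using Finset.induction_on with
  | empty => simp [cyclesAt]
  | insert i s hi ih =>
    rw [Finset.sum_insert hi, Finset.sum_insert hi, ← ih, cyclesAt, Multiset.filter_add,
      Multiset.map_add]
    rfl

lemma cyclesAt_sum (f : K → Multiset (ℕ × ℤˣ)) (x : K) :
    cyclesAt x (∑ y, (f y).map (Prod.mk y)) = f x := by
  classical
  rw [cyclesAt_finset_sum, Finset.sum_eq_single x]
  · rw [cyclesAt, Multiset.filter_map, Multiset.map_map, Multiset.filter_eq_self.2 (by simp)]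
    exact Multiset.map_id _
  · intro y _ hy
    rw [cyclesAt, Multiset.filter_map,
      Multiset.filter_eq_nil.2 (by simpa using fun _ _ _ => hy)]
    simp
  · simp

lemma cyclesAt_labelledCycles (w : WProd t r) (x : K) :
    cyclesAt x (labelledCycles w) = cycles (w x) :=
  cyclesAt_sum (fun y => cycles (w y)) x

lemma sum_cyclesAt (M : Multiset (K × (ℕ × ℤˣ))) :
    ∑ x, (cyclesAt x M).map (Prod.mk x) = M := by
  classical
  induction M using Multiset.induction_on with
  | empty => simp [cyclesAt]
  | cons b M ih =>
    have h1 (x : K) : (cyclesAt x (b ::ₘ M)).map (Prod.mk x) =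
        (if b.1 = x then {b} else 0) + (cyclesAt x M).map (Prod.mk x) := by
      rw [cyclesAt, cyclesAt, Multiset.filter_cons]
      split_ifs with h
      · subst h; simp
      · simp
    rw [Finset.sum_congr rfl fun x _ => h1 x, Finset.sum_add_distrib, ih]
    simp

lemma eq_of_cyclesAt_eq {M M' : Multiset (K × (ℕ × ℤˣ))}
    (h : ∀ x, cyclesAt x M = cyclesAt x M') : M = M' := by
  rw [← sum_cyclesAt M, ← sum_cyclesAt M']
  exact Finset.sum_congr rfl fun x _ => by rw [h]

lemma isCycleOf_of_mem_labelledCycles (w : WProd t r) {b : K × (ℕ × ℤˣ)}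
    (hb : b ∈ labelledCycles w) : IsCycleOf (t b.1) b.2 := by
  rw [labelledCycles, Multiset.mem_sum] at hb
  obtain ⟨x, _, hx⟩ := hb
  obtain ⟨a, ha, rfl⟩ := Multiset.mem_map.1 hx
  exact isCycleOf_of_mem_cycles _ ha

lemma rankAt_labelledCycles (w : WProd t r) : rankAt (labelledCycles w) = r := by
  ext x
  rw [rankAt_eq, cyclesAt_labelledCycles, sum_length_cycles]

lemma exists_labelledCycles_eq {M : Multiset (K × (ℕ × ℤˣ))}
    (hM : ∀ b ∈ M, IsCycleOf (t b.1) b.2) (hr : rankAt M = r) :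
    ∃ w : WProd t r, labelledCycles w = M := by
  classical
  have h (x : K) : ∃ w : WeylGroup (t x) (r x), cycles w = cyclesAt x M := by
    refine exists_cycles_eq (fun a ha => ?_) (by rw [← hr, rankAt_eq])
    obtain ⟨b, hb, rfl⟩ := Multiset.mem_map.1 ha
    rw [Multiset.mem_filter] at hb
    obtain ⟨hb, rfl⟩ := hb
    exact hM b hb
  choose w hw using h
  refine ⟨w, eq_of_cyclesAt_eq fun x => ?_⟩
  rw [cyclesAt_labelledCycles, hw]

lemma labelledCycles_eq_iff' {w w' : WProd t r} :
    labelledCycles w = labelledCycles w' ↔ ∀ x, cycles (w x) = cycles (w' x) := by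
  constructor
  · intro h x
    rw [← cyclesAt_labelledCycles w, h, cyclesAt_labelledCycles w']
  · intro h
    exact Finset.sum_congr rfl fun x _ => by rw [h]

lemma labelledCycles_eq_iff {w w' : WProd t r} :
    labelledCycles w = labelledCycles w' ↔ IsConj w w' := by
  rw [labelledCycles_eq_iff']
  constructor
  · intro h
    have h' (x : K) := isConj_iff.1 (cycles_eq_iff.1 (h x))
    choose c hc using h'
    exact isConj_iff.2 ⟨c, funext hc⟩
  · intro h x
    obtain ⟨c, hc⟩ := isConj_iff.1 h
    exact cycles_eq_iff.2 (isConj_iff.2 ⟨c x, congrFun hc x⟩)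

/-- The labelled cycles of the elements of a conjugacy class. -/
def classCycles (c : ConjClasses (WProd t r)) : Multiset (K × (ℕ × ℤˣ)) :=
  labelledCycles (Quot.out c)

lemma classCycles_mk (w : WProd t r) : classCycles (ConjClasses.mk w) = labelledCycles w :=
  labelledCycles_eq_iff.2 (ConjClasses.mk_eq_mk_iff_isConj.1 (Quot.out_eq (ConjClasses.mk w)))

lemma classCycles_injective :
    Function.Injective (classCycles : ConjClasses (WProd t r) → Multiset (K × (ℕ × ℤˣ))) := by
  intro c c' h
  rw [← Quot.out_eq c, ← Quot.out_eq c']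
  exact ConjClasses.mk_eq_mk_iff_isConj.2 (labelledCycles_eq_iff.1 h)

lemma rankAt_classCycles (c : ConjClasses (WProd t r)) : rankAt (classCycles c) = r :=
  rankAt_labelledCycles _

lemma isCycleOf_of_mem_classCycles (c : ConjClasses (WProd t r)) {b : K × (ℕ × ℤˣ)}
    (hb : b ∈ classCycles c) : IsCycleOf (t b.1) b.2 := isCycleOf_of_mem_labelledCycles _ hb

lemma exists_classCycles_eq {M : Multiset (K × (ℕ × ℤˣ))}
    (hM : ∀ b ∈ M, IsCycleOf (t b.1) b.2) (hr : rankAt M = r) :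
    ∃ c : ConjClasses (WProd t r), classCycles c = M := by
  obtain ⟨w, hw⟩ := exists_labelledCycles_eq hM hr
  exact ⟨ConjClasses.mk w, by rw [classCycles_mk, hw]⟩

lemma onClass_eq {f : WProd t r → ℂ} {F : Multiset (K × (ℕ × ℤˣ)) → ℂ}
    (h : ∀ w, f w = F (labelledCycles w)) (c : ConjClasses (WProd t r)) :
    onClass f c = F (classCycles c) := h _

variable (t) in
/-- The order of the centralizer of an element with given labelled cycles. -/
def labelledWeight (M : Multiset (K × (ℕ × ℤˣ))) : ℕ :=
  (M.map fun b => cycleWeight (t b.1) b.2).prod * multFactorial M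

/-- Cycles with different labels are different, so multiplicities are counted factor by factor. -/
lemma multFactorial_labelledCycles (w : WProd t r) :
    multFactorial (labelledCycles w) = ∏ x, multFactorial (cycles (w x)) := by
  classical
  let s : Finset (ℕ × ℤˣ) := Finset.univ.biUnion fun x => (cycles (w x)).toFinset
  have hs (x : K) : ∀ a ∈ cycles (w x), a ∈ s := fun a ha =>
    Finset.mem_biUnion.2 ⟨x, Finset.mem_univ _, Multiset.mem_toFinset.2 ha⟩
  rw [multFactorial_eq_prod (labelledCycles w) (s := Finset.univ ×ˢ s), Finset.prod_product]
  · refine Finset.prod_congr rfl fun x _ => ?_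
    rw [multFactorial_eq_prod _ (hs x)]
    refine Finset.prod_congr rfl fun a _ => ?_
    rw [← cyclesAt_labelledCycles w x, cyclesAt]
    congr 1
    rw [Multiset.count_map, Multiset.filter_filter, Multiset.count_eq_card_filter_eq]
    congr 1
    refine Multiset.filter_congr fun b _ => ?_
    rw [Prod.ext_iff]
    exact ⟨fun h => ⟨h.2, h.1.symm⟩, fun h => ⟨h.2.symm, h.1⟩⟩
  · intro b hb
    rw [labelledCycles, Multiset.mem_sum] at hb
    obtain ⟨x, _, hx⟩ := hb
    obtain ⟨a, ha, rfl⟩ := Multiset.mem_map.1 hx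
    exact Finset.mem_product.2 ⟨Finset.mem_univ _, hs x a ha⟩

lemma map_labelledCycles_prod {M : Type*} [CommMonoid M] (f : K × (ℕ × ℤˣ) → M) (w : WProd t r) :
    ((labelledCycles w).map f).prod = ∏ x, ((cycles (w x)).map fun a => f (x, a)).prod := by
  classical
  rw [labelledCycles]
  have h1 := map_sum (Multiset.mapAddMonoidHom f)
    (fun x => (cycles (w x)).map (Prod.mk x)) Finset.univ
  simp only [Multiset.coe_mapAddMonoidHom] at h1
  rw [h1, Multiset.prod_sum]
  refine Finset.prod_congr rfl fun x _ => ?_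
  rw [Multiset.map_map]
  rfl

lemma labelledWeight_labelledCycles (w : WProd t r) :
    labelledWeight t (labelledCycles w) = ∏ x, centWeight (t x) (cycles (w x)) := by
  rw [labelledWeight, multFactorial_labelledCycles, map_labelledCycles_prod,
    ← Finset.prod_mul_distrib]
  rfl

/-- A class of the product is a product of classes, and each factor satisfies the orbit–stabilizer
count `card_cycles_eq`. -/
lemma centOrder_eq (c : ConjClasses (WProd t r)) :
    centOrder c = labelledWeight t (classCycles c) := by
  obtain ⟨w, rfl⟩ := ConjClasses.mk_surjective c
  have h1 : Nat.card (ConjClasses.mk w).carrier =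
      ∏ x, Nat.card {w' : WeylGroup (t x) (r x) // cycles w' = cycles (w x)} := by
    rw [← Nat.card_pi]
    refine Nat.card_congr (Equiv.trans (Equiv.subtypeEquivRight fun w' => ?_)
      (Equiv.subtypePiEquivPi (p := fun x w' => cycles w' = cycles (w x))))
    rw [ConjClasses.mem_carrier_iff_mk_eq, ConjClasses.mk_eq_mk_iff_isConj,
      ← labelledCycles_eq_iff, labelledCycles_eq_iff']
  have h2 : Nat.card (ConjClasses.mk w).carrier * labelledWeight t (labelledCycles w) =
      Nat.card (WProd t r) := by
    rw [h1, labelledWeight_labelledCycles, ← Finset.prod_mul_distrib, Nat.card_pi]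
    exact Finset.prod_congr rfl fun x _ => card_cycles_eq (w x)
  have h3 : (Nat.card (ConjClasses.mk w).carrier : ℂ) ≠ 0 := by
    rw [Nat.cast_ne_zero]
    intro h0
    rw [h0, zero_mul] at h2
    exact Nat.card_pos.ne h2
  rw [centOrder, classCycles_mk, ← h2, Nat.cast_mul, mul_comm, mul_div_assoc, div_self h3, mul_one]

lemma cast_labelledWeight (M : Multiset (K × (ℕ × ℤˣ))) : (labelledWeight t M : ℂ) =
    (M.map fun b => (cycleWeight (t b.1) b.2 : ℂ)).prod * multFactorial M := by
  rw [labelledWeight, Nat.cast_mul]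
  congr 1
  rw [← Nat.coe_castRingHom, map_multiset_prod, Multiset.map_map]
  rfl

/-- The value of a class function at labelled cycles; zero if there are no such elements. -/
def evalCycles (f : ConjClasses (WProd t r) → ℂ) (M : Multiset (K × (ℕ × ℤˣ))) : ℂ := by
  classical
  exact if h : ∃ c, classCycles c = M then f h.choose else 0

lemma evalCycles_classCycles (f : ConjClasses (WProd t r) → ℂ) (c : ConjClasses (WProd t r)) :
    evalCycles f (classCycles c) = f c := by
  have h : ∃ c', classCycles c' = classCycles c := ⟨c, rfl⟩
  rw [evalCycles, dif_pos h, classCycles_injective h.choose_spec]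

end labelled

/-! ### Restriction and induction in terms of cycles -/

section maps

variable {K' K : Type} [Fintype K'] [Fintype K] (π : K' → K) (k : K' → ℕ)
  (t' : K' → Kind) (t : K → Kind) {ν : K' → ℕ} {r : K → ℕ}

/-- The image of a labelled cycle under `Corr`. -/
def pushCycle (b : K' × (ℕ × ℤˣ)) : K × (ℕ × ℤˣ) :=
  (π b.1, moveCycle (k b.1) (t' b.1) (t (π b.1)) b.2)

lemma pushCycle_fst (b : K' × (ℕ × ℤˣ)) : (pushCycle π k t' t b).1 = π b.1 := rfl

lemma moveCycle_fst (k : ℕ) (s s' : Kind) (a : ℕ × ℤˣ) : (moveCycle k s s' a).1 = k * a.1 := by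
  cases s <;> cases s' <;> rfl

lemma pushCycle_length (b : K' × (ℕ × ℤˣ)) : (pushCycle π k t' t b).2.1 = k b.1 * b.2.1 :=
  moveCycle_fst _ _ _ _

variable {t' t}

/-- Once the cycles of all factors are gathered in one labelled multiset, the conditions for the
various `x` amount to applying one function to that multiset. -/
lemma corr_iff (w' : WProd t' ν) (w : WProd t r) :
    Corr π k w' w ↔ labelledCycles w = (labelledCycles w').map (pushCycle π k t' t) := by
  classical
  have h (x : K) : cyclesAt x ((labelledCycles w').map (pushCycle π k t' t)) =
      ∑ y ∈ Finset.univ.filter (fun y => π y = x),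
        (cycles (w' y)).map (moveCycle (k y) (t' y) (t x)) := by
    rw [labelledCycles]
    have h1 := map_sum (Multiset.mapAddMonoidHom (pushCycle π k t' t))
      (fun x => (cycles (w' x)).map (Prod.mk x)) Finset.univ
    simp only [Multiset.coe_mapAddMonoidHom] at h1
    rw [h1, cyclesAt_finset_sum, Finset.sum_filter]
    refine Finset.sum_congr rfl fun y _ => ?_
    rw [Multiset.map_map, cyclesAt, Multiset.filter_map]
    split_ifs with hy
    · subst hy
      rw [Multiset.filter_eq_self.2 (by intro a _; rfl), Multiset.map_map]
      rfl
    · rw [Multiset.filter_eq_nil.2 (by intro a _; exact hy)]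
      simp
  constructor
  · intro hc
    refine eq_of_cyclesAt_eq fun x => ?_
    rw [h, cyclesAt_labelledCycles]
    convert! hc x
  · intro hc x
    rw [← cyclesAt_labelledCycles w, hc, h]

lemma corrClass_iff (c' : ConjClasses (WProd t' ν)) (c : ConjClasses (WProd t r)) :
    CorrClass π k c' c ↔ classCycles c = (classCycles c').map (pushCycle π k t' t) := by
  constructor
  · rintro ⟨w', w, rfl, rfl, h⟩
    rw [classCycles_mk, classCycles_mk]
    exact (corr_iff π k w' w).1 h
  · intro h
    exact ⟨_, _, Quot.out_eq c', Quot.out_eq c, (corr_iff π k _ _).2 h⟩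

/-- The class chosen in `res` is determined by its labelled cycles, and both sides take the default
value `0` when no such class exists. -/
lemma res_eq (f : ConjClasses (WProd t r) → ℂ) (c' : ConjClasses (WProd t' ν)) :
    res π k f c' = evalCycles f ((classCycles c').map (pushCycle π k t' t)) := by
  rw [res]
  split_ifs with h
  · have := (corrClass_iff π k c' _).1 h.choose_spec
    rw [← this, evalCycles_classCycles]
  · rw [evalCycles, dif_neg]
    rintro ⟨c, hc⟩
    exact h ⟨c, (corrClass_iff π k c' c).2 hc⟩

open scoped Classical in
lemma rankAt_map_pushCycle (M : Multiset (K' × (ℕ × ℤˣ))) (x : K) :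
    rankAt (M.map (pushCycle π k t' t)) x =
      ∑ y ∈ Finset.univ.filter (fun y => π y = x), rankAt M y * k y := by
  induction M using Multiset.induction_on with
  | empty => simp [rankAt]
  | cons b M ih =>
    have h1 (y : K') : rankAt (b ::ₘ M) y = (if b.1 = y then b.2.1 else 0) + rankAt M y := by
      simp [rankAt]
    have h2 : rankAt ((b ::ₘ M).map (pushCycle π k t' t)) x =
        (if π b.1 = x then k b.1 * b.2.1 else 0) +
          rankAt (M.map (pushCycle π k t' t)) x := by
      simp [rankAt, pushCycle_fst, pushCycle_length]
    rw [h2, ih]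
    simp only [h1, add_mul, Finset.sum_add_distrib, Finset.sum_filter, ite_mul, zero_mul]
    congr 1
    rw [Finset.sum_eq_single b.1]
    · simp [mul_comm]
    · intro y _ hy
      simp [Ne.symm hy]
    · simp

variable (t' t) in
open scoped Classical in
/-- The labelled cycles with a given image. -/
def cycleFiber (b : K × (ℕ × ℤˣ)) : Finset (K' × (ℕ × ℤˣ)) :=
  (Finset.univ ×ˢ (Finset.range (b.2.1 + 1) ×ˢ Finset.univ)).filter fun y =>
    pushCycle π k t' t y = b ∧ IsCycleOf (t' y.1) y.2

/-- The bound on lengths in `cycleFiber` only serves to get a finite set: since the image has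
positive length, the dilatation is at least one and cannot shorten a cycle. -/
lemma mem_cycleFiber {b : K × (ℕ × ℤˣ)} (hb : 0 < b.2.1) {y : K' × (ℕ × ℤˣ)} :
    y ∈ cycleFiber π k t' t b ↔ pushCycle π k t' t y = b ∧ IsCycleOf (t' y.1) y.2 := by
  classical
  simp only [cycleFiber, Finset.mem_filter, Finset.mem_product, Finset.mem_univ, true_and,
    Finset.mem_range, and_true, and_iff_right_iff_imp]
  rintro ⟨rfl, -⟩
  rw [pushCycle_length] at hb ⊢
  have : 0 < k y.1 := Nat.pos_of_mul_pos_right hb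
  nlinarith

open scoped Classical in
/-- A sum of inductions, as a sum over the liftings of a labelling of the cycles. -/
theorem sum_ind (c : ConjClasses (WProd t r)) {X : Type*} [Fintype X]
    [DecidableEq X] (lab : X → K × (ℕ × ℤˣ))
    (hlab : Finset.univ.val.map lab = classCycles c) (F : Multiset (K' × (ℕ × ℤˣ)) → ℂ)
    (s : Finset (K' → ℕ))
    (hs : ∀ ν, (∀ x, ∑ y ∈ Finset.univ.filter (fun y => π y = x), ν y * k y = r x) → ν ∈ s)
    (f : ∀ ν, ConjClasses (WProd t' ν) → ℂ) (hf : ∀ ν ∈ s, ∀ c', f ν c' = F (classCycles c')) :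
    ∑ ν ∈ s, ind π k (f ν) c =
      ∑ p ∈ Fintype.piFinset fun x => cycleFiber π k t' t (lab x),
        F (Finset.univ.val.map p) * ∏ x, ((cycleWeight (t (lab x).1) (lab x).2 : ℂ) /
          cycleWeight (t' (p x).1) (p x).2) := by
  have hpos (x : X) : 0 < (lab x).2.1 := by
    refine (isCycleOf_of_mem_classCycles c (b := lab x) ?_).pos
    rw [← hlab]
    exact Multiset.mem_map_of_mem _ (Finset.mem_univ_val x)
  have hmem (p : X → K' × (ℕ × ℤˣ)) :
      p ∈ Fintype.piFinset (fun x => cycleFiber π k t' t (lab x)) ↔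
        pushCycle π k t' t ∘ p = lab ∧ ∀ x, IsCycleOf (t' (p x).1) (p x).2 := by
    rw [Fintype.mem_piFinset, funext_iff, ← forall_and]
    exact forall_congr' fun x => mem_cycleFiber π k (hpos x)
  let W (M : Multiset (K × (ℕ × ℤˣ))) : ℂ := (M.map fun b => (cycleWeight (t b.1) b.2 : ℂ)).prod
  let W' (M : Multiset (K' × (ℕ × ℤˣ))) : ℂ :=
    (M.map fun b => (cycleWeight (t' b.1) b.2 : ℂ)).prod
  let P := Fintype.piFinset fun x => cycleFiber π k t' t (lab x)
  -- The summand depends on a lifting only through its multiset of values. Grouping by that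
  -- multiset, `card_lifts` turns the number of liftings into the quotient of factorials missing
  -- from the ratio of weights.
  have hR : ∑ p ∈ P, F (Finset.univ.val.map p) *
      ∏ x, ((cycleWeight (t (lab x).1) (lab x).2 : ℂ) / cycleWeight (t' (p x).1) (p x).2) =
      ∑ M ∈ P.image fun p => Finset.univ.val.map p,
        F M * (labelledWeight t (classCycles c) / labelledWeight t' M) := by
    have h1 (p : X → K' × (ℕ × ℤˣ)) : ∏ x, ((cycleWeight (t (lab x).1) (lab x).2 : ℂ) /
        cycleWeight (t' (p x).1) (p x).2) = W (classCycles c) / W' (Finset.univ.val.map p) := by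
      rw [Finset.prod_div_distrib, ← hlab]
      simp only [W, W', Multiset.map_map]
      rfl
    simp only [h1]
    rw [Finset.sum_comp (fun M => F M * (W (classCycles c) / W' M))
      (fun p => Finset.univ.val.map p)]
    refine Finset.sum_congr rfl fun M hM => ?_
    obtain ⟨p₀, hp₀, rfl⟩ := Finset.mem_image.1 hM
    obtain ⟨hp₁, hp₂⟩ := (hmem p₀).1 hp₀
    set M := Finset.univ.val.map p₀ with hMdef
    have hMlab : M.map (pushCycle π k t' t) = Finset.univ.val.map lab := by
      rw [hMdef, Multiset.map_map, hp₁]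
    have hMcyc : ∀ b ∈ M, IsCycleOf (t' b.1) b.2 := by
      intro b hb
      obtain ⟨x, _, rfl⟩ := Multiset.mem_map.1 hb
      exact hp₂ x
    have h2 := card_lifts hMlab
    have h3 : (P.filter fun p => Finset.univ.val.map p = M).card =
        Nat.card {p : X → K' × (ℕ × ℤˣ) // pushCycle π k t' t ∘ p = lab ∧
          Finset.univ.val.map p = M} := by
      refine (Nat.subtype_card _ fun p => ?_).symm
      rw [Finset.mem_filter, hmem]
      refine and_congr_left fun h => ⟨fun h' => h'.1, fun h' => ⟨h', fun x => hMcyc _ ?_⟩⟩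
      rw [← h]
      exact Multiset.mem_map_of_mem _ (Finset.mem_univ_val x)
    rw [h3, nsmul_eq_mul]
    have h4 : (multFactorial M : ℂ) ≠ 0 := Nat.cast_ne_zero.2 (multFactorial_pos M).ne'
    have h5 : (labelledWeight t (classCycles c) : ℂ) =
        W (classCycles c) * Nat.card {p : X → K' × (ℕ × ℤˣ) // pushCycle π k t' t ∘ p = lab ∧
          Finset.univ.val.map p = M} * multFactorial M := by
      rw [cast_labelledWeight, ← hlab, ← h2, Nat.cast_mul, mul_assoc]
    have h6 : (labelledWeight t' M : ℂ) = W' M * multFactorial M := cast_labelledWeight M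
    rw [h5, h6, mul_div_mul_right _ _ h4]
    ring
  rw [hR]
  have hI (ν : K' → ℕ) : Fintype (ConjClasses (WProd t' ν)) := Fintype.ofFinite _
  have hL (ν : K' → ℕ) : ind π k (f ν) c = ∑ c' ∈ Finset.univ.filter fun c' =>
      classCycles c = (classCycles c').map (pushCycle π k t' t),
        f ν c' * (labelledWeight t (classCycles c) / labelledWeight t' (classCycles c')) := by
    rw [Finset.sum_filter, ind]
    refine Finset.sum_congr (by congr!) fun c' _ => ?_
    rw [centOrder_eq, centOrder_eq]
    exact if_congr (corrClass_iff π k c' c) rfl rfl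
  -- A pair `(ν, c')` is the same as a multiset of labelled cycles: the ranks `ν` are recovered as
  -- total lengths, and `hs` ensures that no `ν` obtained in this way is missing from `s`.
  rw [Finset.sum_congr rfl fun ν _ => hL ν, Finset.sum_sigma']
  refine Finset.sum_bij (fun x _ => classCycles x.2) ?_ ?_ ?_ ?_
  · rintro ⟨ν, c'⟩ hx
    simp only [Finset.mem_sigma, Finset.mem_filter, Finset.mem_univ, true_and] at hx
    have h1 : (classCycles c').map (pushCycle π k t' t) = Finset.univ.val.map lab := by
      rw [hlab, hx.2]
    obtain ⟨p, hp, hpM⟩ := exists_lift h1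
    refine Finset.mem_image.2 ⟨p, (hmem p).2 ⟨hp, fun x => ?_⟩, hpM⟩
    refine isCycleOf_of_mem_classCycles c' ?_
    rw [← hpM]
    exact Multiset.mem_map_of_mem _ (Finset.mem_univ_val x)
  · rintro ⟨ν₁, c₁⟩ _ ⟨ν₂, c₂⟩ _ h
    have h' : classCycles c₁ = classCycles c₂ := h
    have hν : ν₁ = ν₂ := by
      rw [← rankAt_classCycles c₁, h', rankAt_classCycles c₂]
    subst hν
    rw [classCycles_injective h']
  · intro M hM
    obtain ⟨p, hp, rfl⟩ := Finset.mem_image.1 hM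
    obtain ⟨hp₁, hp₂⟩ := (hmem p).1 hp
    obtain ⟨c', hc'⟩ := exists_classCycles_eq (t := t') (M := Finset.univ.val.map p) (by
      intro b hb
      obtain ⟨x, _, rfl⟩ := Multiset.mem_map.1 hb
      exact hp₂ x) rfl
    have h1 : classCycles c = (classCycles c').map (pushCycle π k t' t) := by
      rw [hc', Multiset.map_map, hp₁, hlab]
    refine ⟨⟨_, c'⟩, ?_, hc'⟩
    simp only [Finset.mem_sigma, Finset.mem_filter, Finset.mem_univ, true_and]
    refine ⟨hs _ fun x => ?_, h1⟩
    rw [← rankAt_classCycles c, h1, rankAt_map_pushCycle, hc']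
  · rintro ⟨ν, c'⟩ hx
    rw [hf ν (Finset.mem_sigma.1 hx).1]

end maps

/-! ### Elements of the graded spaces as functions of cycles -/

lemma sgnC_mul (a b : ℤˣ) : sgnC (a * b) = sgnC a * sgnC b := by simp [sgnC]

lemma sgnC_one : sgnC 1 = 1 := by simp [sgnC]

/-- The inclusion of signs in the complex numbers. -/
def sgnHom : ℤˣ →* ℂ where
  toFun := sgnC
  map_one' := sgnC_one
  map_mul' := sgnC_mul

lemma sgnC_prod {ι : Type*} (s : Finset ι) (f : ι → ℤˣ) :
    sgnC (∏ x ∈ s, f x) = ∏ x ∈ s, sgnC (f x) := map_prod sgnHom f s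

lemma sgnC_pow (a : ℤˣ) (n : ℕ) : sgnC (a ^ n) = sgnC a ^ n := map_pow sgnHom a n

lemma prod_neg_one_pow_length {t : Kind} {N : ℕ} (w : WeylGroup t N) :
    ((cycles w).map fun a => (-1 : ℤˣ) ^ a.1).prod = (-1) ^ N := by
  conv_rhs => rw [← sum_length_cycles w]
  generalize cycles w = M
  induction M using Multiset.induction_on with
  | empty => simp
  | cons a M ih => rw [Multiset.map_cons, Multiset.prod_cons, ih, Multiset.map_cons,
      Multiset.sum_cons, pow_add]

section graded

variable {S : SpectralDatum} {T T' : S.Slot → ℕ → Prop} {X : Type*} [Fintype X] [DecidableEq X]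

/-- The value of an element of a graded space at a class given by a family of cycles `a`, placed in
the slots `l` with the superscripts `i`. -/
def Graded.value (φ : Graded T) (l : X → S.Slot) (i : X → Bool) (a : X → ℕ × ℤˣ) : ℂ :=
  evalCycles (t := fun x : S.Slot × Bool => kind x.1)
    (φ.comp (rankAt (Finset.univ.val.map fun x => ((l x, i x), a x))))
    (Finset.univ.val.map fun x => ((l x, i x), a x))

open scoped Classical in
/-- The total length of the cycles placed in a slot. -/
def slotRank (l : X → S.Slot) (a : X → ℕ × ℤˣ) (s : S.Slot) : ℕ :=
  ∑ x, if l x = s then (a x).1 else 0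

/-- Each cycle of the slot has one of the two superscripts, so the total does not depend on `i`. The
laws of the graded spaces therefore do not see the superscripts. -/
lemma rankAt_add_rankAt (l : X → S.Slot) (i : X → Bool) (a : X → ℕ × ℤˣ) (s : S.Slot) :
    rankAt (Finset.univ.val.map fun x => ((l x, i x), a x)) (s, false) +
      rankAt (Finset.univ.val.map fun x => ((l x, i x), a x)) (s, true) = slotRank l a s := by
  classical
  rw [rankAt, rankAt, slotRank, Multiset.map_map, Multiset.map_map]
  change (∑ x, _) + (∑ x, _) = _
  rw [← Finset.sum_add_distrib]
  refine Finset.sum_congr rfl fun x _ => ?_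
  simp only [Function.comp_apply, Prod.mk.injEq]
  by_cases h : l x = s <;> cases i x <;> simp [h]

lemma comp_of_law (φ : Graded T) {r : S.Slot × Bool → ℕ}
    (h : ∀ j, T j (r (j, false) + r (j, true))) : φ.comp r = φ ⟨r, h⟩ := by
  rw [Graded.comp, dif_pos h]

lemma comp_of_not_law (φ : Graded T) {r : S.Slot × Bool → ℕ}
    (h : ¬ ∀ j, T j (r (j, false) + r (j, true))) : φ.comp r = fun _ => 0 := by
  rw [Graded.comp, dif_neg h]
  rfl

lemma value_eq (φ : Graded T) {l : X → S.Slot} {i : X → Bool} {a : X → ℕ × ℤˣ}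
    {r : S.Slot × Bool → ℕ} (c : ConjClasses (𝒲 r))
    (hc : classCycles c = Finset.univ.val.map fun x => ((l x, i x), a x)) :
    φ.value l i a = φ.comp r c := by
  rw [Graded.value, ← hc, rankAt_classCycles, evalCycles_classCycles]

lemma value_of_not_law (φ : Graded T) {l : X → S.Slot} {i : X → Bool} {a : X → ℕ × ℤˣ}
    (h : ¬ ∀ j, T j (slotRank l a j)) : φ.value l i a = 0 := by
  rw [Graded.value, comp_of_not_law]
  · rw [evalCycles]
    split_ifs <;> rfl
  · simpa only [rankAt_add_rankAt] using h

lemma exists_class {l : X → S.Slot} {a : X → ℕ × ℤˣ} (ha : ∀ x, IsCycleOf (kind (l x)) (a x))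
    (i : X → Bool) : ∃ (r : S.Slot × Bool → ℕ) (c : ConjClasses (𝒲 r)),
      classCycles c = (Finset.univ.val.map fun x => ((l x, i x), a x)) ∧
      ∀ j, r (j, false) + r (j, true) = slotRank l a j := by
  obtain ⟨c, hc⟩ := exists_classCycles_eq (t := fun x : S.Slot × Bool => kind x.1)
    (M := Finset.univ.val.map fun x => ((l x, i x), a x)) (by
      intro b hb
      obtain ⟨x, _, rfl⟩ := Multiset.mem_map.1 hb
      exact ha x) rfl
  exact ⟨_, c, hc, fun j => rankAt_add_rankAt l i a j⟩

/-- Enumerating the cycles of a class gives a family of the required form, and it obeys the law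
because the ranks do. -/
lemma graded_ext {φ ψ : Graded T}
    (h : ∀ (n : ℕ) (l : Fin n → S.Slot) (i : Fin n → Bool) (a : Fin n → ℕ × ℤˣ),
      (∀ x, IsCycleOf (kind (l x)) (a x)) → (∀ j, T j (slotRank l a j)) →
      φ.value l i a = ψ.value l i a) : φ = ψ := by
  funext r c
  obtain ⟨p, hp⟩ := exists_labelling (X := Fin (classCycles c).card) (classCycles c) (by simp)
  have hc : classCycles c = Finset.univ.val.map fun x => (((p x).1.1, (p x).1.2), (p x).2) :=
    hp.symm
  have h1 := h _ (fun x => (p x).1.1) (fun x => (p x).1.2) (fun x => (p x).2)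
    (fun x => isCycleOf_of_mem_classCycles c (b := p x) (by
      exact hp ▸ Multiset.mem_map_of_mem p (Finset.mem_univ_val x)))
    (fun j => by
      rw [← rankAt_add_rankAt _ (fun x => (p x).1.2), ← hc, rankAt_classCycles]
      exact r.2 j)
  rwa [value_eq φ c hc, value_eq ψ c hc, comp_of_law φ r.2, comp_of_law ψ r.2] at h1

lemma value_twist (h : ∀ j s, T' j s → T j s) (h' : ∀ j s, T j s → T' j s)
    {f : ∀ r : S.Slot × Bool → ℕ, 𝒲 r → ℂ} {f₀ : (S.Slot × Bool) × (ℕ × ℤˣ) → ℤˣ}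
    (hf : ∀ r w, f r w = sgnC ((labelledCycles w).map f₀).prod) (φ : Graded T)
    {l : X → S.Slot} {a : X → ℕ × ℤˣ} (ha : ∀ x, IsCycleOf (kind (l x)) (a x)) (i : X → Bool) :
    (φ.twist h f : Graded T').value l i a =
      sgnC (∏ x, f₀ ((l x, i x), a x)) * φ.value l i a := by
  by_cases hT : ∀ j, T j (slotRank l a j)
  · obtain ⟨r, c, hc, hr⟩ := exists_class ha i
    have h1 : ∀ j, T j (r (j, false) + r (j, true)) := fun j => by rw [hr]; exact hT j
    rw [value_eq _ c hc, value_eq _ c hc, comp_of_law φ h1,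
      comp_of_law _ fun j => h' j _ (h1 j)]
    change onClass (f r) c * _ = _
    rw [onClass_eq (F := fun M => sgnC (M.map f₀).prod) (hf r), hc, Multiset.map_map]
    rfl
  · rw [value_of_not_law φ hT, value_of_not_law _ fun h1 => hT fun j => h j _ (h1 j), mul_zero]

/-- The type of the component depends on `r`; keeping the ranks behind an equation allows `subst` to
identify the two components. -/
lemma res_comp_eq {K' : Type} [Fintype K'] {t' : K' → Kind} {ν : K' → ℕ}
    (π : K' → S.Slot × Bool) (k : K' → ℕ) (φ : Graded T) (c : ConjClasses (WProd t' ν))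
    {r : S.Slot × Bool → ℕ}
    (hr : rankAt ((classCycles c).map (pushCycle π k t' fun x => kind x.1)) = r) :
    res π k (φ.comp r) c = evalCycles
      (φ.comp (rankAt ((classCycles c).map (pushCycle π k t' fun x => kind x.1))))
      ((classCycles c).map (pushCycle π k t' fun x => kind x.1)) := by
  subst hr
  exact res_eq π k _ c

lemma moveCycle_one_self (s : Kind) (a : ℕ × ℤˣ) : moveCycle 1 s s a = a := by
  cases s <;> simp [moveCycle]

lemma sum_fiber_quad (ν : S.Slot × Bool × Bool → ℕ) (x : S.Slot × Bool)
    [DecidablePred fun y : S.Slot × Bool × Bool => (y.1, y.2.2) = x] :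
    ∑ y ∈ Finset.univ.filter (fun y : S.Slot × Bool × Bool => (y.1, y.2.2) = x), ν y * 1 =
      ν (x.1, false, x.2) + ν (x.1, true, x.2) := by
  classical
  have : Finset.univ.filter (fun y : S.Slot × Bool × Bool => (y.1, y.2.2) = x) =
      {(x.1, false, x.2), (x.1, true, x.2)} := by
    ext ⟨s, b, b'⟩
    obtain ⟨s', b''⟩ := x
    cases b <;> simp
  rw [this, Finset.sum_pair (by simp)]
  simp

lemma sum_fiber_row (ν : S.Slot × Bool × Bool → ℕ) (x : S.Slot × Bool)
    [DecidablePred fun y : S.Slot × Bool × Bool => (y.1, y.2.1) = x] :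
    ∑ y ∈ Finset.univ.filter (fun y : S.Slot × Bool × Bool => (y.1, y.2.1) = x), ν y * 1 =
      rowSum ν x := by
  classical
  have : Finset.univ.filter (fun y : S.Slot × Bool × Bool => (y.1, y.2.1) = x) =
      {(x.1, x.2, false), (x.1, x.2, true)} := by
    ext ⟨s, b, b'⟩
    obtain ⟨s', b''⟩ := x
    cases b' <;> simp
  rw [this, Finset.sum_pair (by simp)]
  simp [rowSum]

/-- Here nothing is dilated and the kinds agree, so a cycle with superscript `j x` lifts in exactly
two ways, according to the other superscript `i x`, and all ratios of weights are `1`. -/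
theorem value_resInd (hTT : ∀ j s, T j s ↔ T' j s)
    {tw : ∀ m : S.Slot × Bool × Bool → ℕ, 𝒲 m → ℂ}
    {f : (S.Slot × Bool × Bool) × (ℕ × ℤˣ) → ℤˣ}
    (hf : ∀ m w, tw m w = sgnC ((labelledCycles w).map f).prod) (φ : Graded T)
    {l : X → S.Slot} {a : X → ℕ × ℤˣ} (ha : ∀ x, IsCycleOf (kind (l x)) (a x)) (j : X → Bool) :
    (resInd tw φ : Graded T').value l j a =
      ∑ i : X → Bool, sgnC (∏ x, f ((l x, i x, j x), a x)) * φ.value l i a := by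
  classical
  by_cases hT : ∀ j, T j (slotRank l a j)
  · obtain ⟨r, c, hc, hr⟩ := exists_class ha j
    have h1 : ∀ j, T' j (r (j, false) + r (j, true)) := fun j => by
      rw [hr, ← hTT]; exact hT j
    rw [value_eq _ c hc, comp_of_law _ h1]
    have hres : (resInd tw φ : Graded T') ⟨r, h1⟩ = ∑ m ∈ quadruples r,
        ind (ν := m) (fun x => (x.1, x.2.2)) (fun _ => 1) fun c =>
          onClass (tw m) c * res (fun x => (x.1, x.2.1)) (fun _ => 1) (φ.comp (rowSum m)) c := rfl
    rw [hres, Finset.sum_apply, sum_ind (t' := fun y : S.Slot × Bool × Bool => kind y.1) _ _ c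
      (fun x => ((l x, j x), a x)) hc.symm (fun M => sgnC (M.map f).prod * evalCycles
        (φ.comp (rankAt (M.map (pushCycle (fun y : S.Slot × Bool × Bool => (y.1, y.2.1))
          (fun _ => 1) (fun y => kind y.1) fun x => kind x.1))))
        (M.map (pushCycle (fun y : S.Slot × Bool × Bool => (y.1, y.2.1)) (fun _ => 1)
          (fun y => kind y.1) fun x => kind x.1)))]
    · have hpos (x : X) : 0 < (((l x, j x), a x) : (S.Slot × Bool) × (ℕ × ℤˣ)).2.1 := (ha x).pos
      symm
      refine Finset.sum_bij (fun i _ x => ((l x, i x, j x), a x)) ?_ ?_ ?_ ?_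
      · intro i _
        rw [Fintype.mem_piFinset]
        intro x
        rw [mem_cycleFiber _ _ (hpos x)]
        exact ⟨Prod.ext rfl (moveCycle_one_self _ _), ha x⟩
      · intro i _ i' _ h
        funext x
        have := congrFun h x
        simp only [Prod.mk.injEq] at this
        tauto
      · intro p hp
        rw [Fintype.mem_piFinset] at hp
        have hp' (x : X) := (mem_cycleFiber _ _ (hpos x)).1 (hp x)
        refine ⟨fun x => (p x).1.2.1, Finset.mem_univ _, funext fun x => ?_⟩
        obtain ⟨h2, -⟩ := hp' x
        rw [pushCycle, moveCycle_one_self] at h2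
        simp only [Prod.mk.injEq] at h2
        obtain ⟨⟨h3, h4⟩, h5⟩ := h2
        rw [← h3, ← h4, ← h5]
      · intro i _
        have h3 : ∏ x, ((cycleWeight (kind (l x)) (a x) : ℂ) / cycleWeight (kind (l x)) (a x)) = 1 :=
          Finset.prod_eq_one fun x _ =>
            div_self (Nat.cast_ne_zero.2 (cycleWeight_pos (ha x)).ne')
        refine Eq.trans ?_ (congrArg (_ * ·) h3).symm
        · have h2 : (Finset.univ.val.map fun x => ((l x, i x, j x), a x)).map
              (pushCycle (fun y : S.Slot × Bool × Bool => (y.1, y.2.1)) (fun _ => 1)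
                (fun y => kind y.1) fun x => kind x.1) =
              Finset.univ.val.map fun x => ((l x, i x), a x) := by
            rw [Multiset.map_map]
            exact Multiset.map_congr rfl fun x _ => Prod.ext rfl (moveCycle_one_self _ _)
          rw [h2, Multiset.map_map, mul_one]
          rfl
    · intro ν hν
      have h2 (x : S.Slot × Bool) : ν (x.1, false, x.2) + ν (x.1, true, x.2) = r x := by
        rw [← hν x, sum_fiber_quad]
      rw [quadruples, Finset.mem_filter, Fintype.mem_piFinset]
      refine ⟨?_, fun s b => h2 (s, b)⟩
      rintro ⟨s, b, b'⟩
      have := h2 (s, b')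
      rw [Finset.mem_range]
      cases b <;> simp only at this ⊢ <;> omega
    · intro ν _ c'
      rw [onClass_eq (F := fun M => sgnC (M.map f).prod) (hf ν), res_comp_eq]
      funext x
      rw [rankAt_map_pushCycle, rankAt_classCycles, sum_fiber_row]
  · rw [value_of_not_law _ fun h1 => hT fun j => (hTT j _).2 (h1 j)]
    symm
    refine Finset.sum_eq_zero fun i _ => ?_
    rw [value_of_not_law φ hT, mul_zero]

/-! ### Exchange of superscripts and the operators `X_ε`. -/

/-- The exchange of the superscripts of the cycles in the slot `ε`. -/
def swapAt (ε : ℤˣ) (l : X → S.Slot) (i : X → Bool) (x : X) : Bool := (swapIdx ε (l x, i x)).2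

lemma swapIdx_swapIdx (ε : ℤˣ) (y : S.Slot × Bool) : swapIdx ε (swapIdx ε y) = y := by
  obtain ⟨s, b⟩ := y
  simp only [swapIdx]
  split_ifs <;> simp

lemma swapAt_swapAt (ε : ℤˣ) (l : X → S.Slot) (i : X → Bool) :
    swapAt ε l (swapAt ε l i) = i := by
  funext x
  exact congrArg Prod.snd (swapIdx_swapIdx ε (l x, i x))

lemma labelledCycles_swapHom (ε : ℤˣ) (r : S.Slot × Bool → ℕ) (w : 𝒲 r) :
    labelledCycles (t := fun x : S.Slot × Bool => kind x.1) (swapHom ε r w) =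
      (labelledCycles w).map fun b => (swapIdx ε b.1, b.2) := by
  classical
  have h1 := map_sum (Multiset.mapAddMonoidHom
      fun b : (S.Slot × Bool) × (ℕ × ℤˣ) => (swapIdx ε b.1, b.2))
    (fun x => (cycles (w x)).map (Prod.mk x)) Finset.univ
  simp only [Multiset.coe_mapAddMonoidHom] at h1
  rw [labelledCycles, labelledCycles, h1]
  rw [← Equiv.sum_comp (Function.Involutive.toPerm _ (swapIdx_swapIdx (S := S) ε)) fun x =>
    ((cycles (w x)).map (Prod.mk x)).map fun b : (S.Slot × Bool) × (ℕ × ℤˣ) => (swapIdx ε b.1, b.2)]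
  refine Finset.sum_congr rfl fun x _ => ?_
  rw [Multiset.map_map]
  refine Multiset.map_congr rfl fun a _ => ?_
  exact Prod.ext (swapIdx_swapIdx ε x).symm rfl

open scoped Classical in
lemma sgnCD_eq_labelled {K : Type} [Fintype K] {t : K → Kind} {r : K → ℕ} (w : WProd t r) (y : K) :
    sgnCD (w y) = ((labelledCycles w).map fun b => if b.1 = y then b.2.2 else 1).prod := by
  rw [map_labelledCycles_prod, Finset.prod_eq_single y]
  · simp [sgnCD_eq_prod]
  · intro x _ hx
    simp [hx]
  · simp

open scoped Classical in
-- `XSign` first transports the class and then evaluates the character, hence the swapped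
-- superscripts in the condition.
lemma value_XSign (ε : ℤˣ) (φ : Graded T) {l : X → S.Slot} {a : X → ℕ × ℤˣ}
    (ha : ∀ x, IsCycleOf (kind (l x)) (a x)) (i : X → Bool) :
    (XSign ε φ).value l i a =
      sgnC (∏ x, if l x = .inr ε ∧ swapAt ε l i x = true then (a x).2 else 1) *
        φ.value l (swapAt ε l i) a := by
  by_cases hT : ∀ j, T j (slotRank l a j)
  · obtain ⟨r, c, hc, hr⟩ := exists_class ha i
    have h1 : ∀ j, T j (r (j, false) + r (j, true)) := fun j => by rw [hr]; exact hT j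
    have hd : classCycles (t := fun x : S.Slot × Bool => kind x.1)
        (r := fun x => r (swapIdx ε x)) (ConjClasses.map (swapHom ε r) c) =
        Finset.univ.val.map fun x => ((l x, swapAt ε l i x), a x) := by
      obtain ⟨w, rfl⟩ := ConjClasses.mk_surjective c
      change classCycles (ConjClasses.mk (swapHom ε r w)) = _
      rw [classCycles_mk, labelledCycles_swapHom]
      rw [classCycles_mk] at hc
      rw [hc, Multiset.map_map]
      rfl
    rw [value_eq _ c hc, value_eq _ _ hd, comp_of_law _ h1]
    change onClass (fun w : 𝒲 (fun x => r (swapIdx ε x)) => sgnC (sgnCD (w (.inr ε, true))))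
      (ConjClasses.map (swapHom ε r) c) * _ = _
    rw [onClass_eq (F := fun M => sgnC (M.map fun b => if b.1 = (.inr ε, true) then b.2.2 else 1).prod)
        (fun w => by rw [sgnCD_eq_labelled]; congr!), hd, Multiset.map_map]
    congr 2
    refine Finset.prod_congr rfl fun x _ => ?_
    simp only [Function.comp_apply, Prod.mk.injEq]
  · rw [value_of_not_law _ hT, value_of_not_law _ hT, mul_zero]

end graded

/-! ### Localisation in terms of cycles -/

section loc

variable {S L : SpectralDatum}

/-- The factor of `chiFun` attached to a cycle. -/
def chiLocal (q : ℕ) : PairIdx S L → ℕ × ℤˣ → ℂ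
  | ((.inl u, .inl l), _), a => phiFun q a.1 l
      ((Nat.gcd (S.ell u) (L.ell l) : ℂ) / (parityFactor (S.ell u) (L.ell l) : ℂ))
  | ((.inr ε, .inl l), _), a => if ε = 1 then 1 else ((-1) ^ ((1 + q ^ L.ell l) / 2)) ^ a.1
  | ((.inl u, .inr ε), _), a => if ε = 1 then 1 else ((-1) ^ ((1 + q ^ S.ell u) / 2)) ^ a.1
  | ((.inr ε, .inr ε'), _), a =>
      if ε = -1 ∧ ε' = -1 then sgnC a.2 * ((-1) ^ ((q - 1) / 2)) ^ a.1 else 1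

lemma prod_pow_length {t : Kind} {N : ℕ} (w : WeylGroup t N) (z : ℂ) :
    ((cycles w).map fun a => z ^ a.1).prod = z ^ N := by
  conv_rhs => rw [← sum_length_cycles w]
  generalize cycles w = M
  induction M using Multiset.induction_on with
  | empty => simp
  | cons a M ih => rw [Multiset.map_cons, Multiset.prod_cons, ih, Multiset.map_cons,
      Multiset.sum_cons, pow_add]

lemma neg_one_pow_mul_div {N m : ℕ} (h : Even m) :
    (-1 : ℂ) ^ (N * m / 2) = ((-1) ^ (m / 2)) ^ N := by
  rw [Nat.mul_div_assoc _ h.two_dvd, mul_comm, pow_mul]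

lemma prod_one_map {α : Type*} (M : Multiset α) : (M.map fun _ => (1 : ℂ)).prod = 1 := by simp

/-- For odd `q` the numbers `1 + q ^ n` and `q - 1` are even, so the halved exponents are multiples
of `N` without rounding and the signs are multiplicative in the cycles. -/
lemma chiFun_eq {q : ℕ} (hq : Odd q) {N : ℕ} (x : PairIdx S L) (w : WeylGroup (pairKind x) N) :
    chiFun q x w = ((cycles w).map (chiLocal q x)).prod := by
  have h1 (n : ℕ) : Even (1 + q ^ n) := by
    rw [add_comm]; exact (hq.pow).add_one
  obtain ⟨⟨u | ε, l | ε'⟩, δ⟩ := x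
  · rfl
  · have hc : chiLocal q (((.inl u, .inr ε'), δ) : PairIdx S L) = fun a =>
        if ε' = 1 then 1 else ((-1) ^ ((1 + q ^ S.ell u) / 2)) ^ a.1 := rfl
    rw [hc, chiFun]
    split_ifs
    · rw [prod_one_map]
    · rw [prod_pow_length, neg_one_pow_mul_div (h1 _)]
  · have hc : chiLocal q (((.inr ε, .inl l), δ) : PairIdx S L) = fun a =>
        if ε = 1 then 1 else ((-1) ^ ((1 + q ^ L.ell l) / 2)) ^ a.1 := rfl
    rw [hc, chiFun]
    split_ifs
    · rw [prod_one_map]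
    · rw [prod_pow_length, neg_one_pow_mul_div (h1 _)]
  · have hc : chiLocal q (((.inr ε, .inr ε'), δ) : PairIdx S L) = fun a =>
        if ε = -1 ∧ ε' = -1 then sgnC a.2 * ((-1) ^ ((q - 1) / 2)) ^ a.1 else 1 := rfl
    rw [hc, chiFun]
    split_ifs
    · rw [Multiset.prod_map_mul, prod_pow_length,
        neg_one_pow_mul_div (Nat.Odd.sub_odd hq odd_one), sgnCD_eq_prod]
      congr 1
      change sgnHom _ = _
      rw [map_multiset_prod, Multiset.map_map]
      rfl
    · rw [prod_one_map]

/-- With the three lemmas that follow: every local ingredient of `loc` ignores the superscript,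
which is why `false` can serve as a placeholder below. Only the cuspidal factor sees superscripts.
-/
lemma chiLocal_superscript (q : ℕ) (y : S.Slot × L.Slot) (δ δ' : Bool) (a : ℕ × ℤˣ) :
    chiLocal q (y, δ) a = chiLocal q (y, δ') a := by
  obtain ⟨u | ε, l | ε'⟩ := y <;> rfl

lemma pairKind_superscript (y : S.Slot × L.Slot) (δ δ' : Bool) :
    pairKind (y, δ) = pairKind (y, δ') := by
  obtain ⟨u | ε, l | ε'⟩ := y <;> rfl

lemma dilL_superscript (y : S.Slot × L.Slot) (δ δ' : Bool) : dilL (y, δ) = dilL (y, δ') := by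
  obtain ⟨u | ε, l | ε'⟩ := y <;> rfl

lemma dilU_superscript (y : S.Slot × L.Slot) (δ δ' : Bool) : dilU (y, δ) = dilU (y, δ') := by
  obtain ⟨u | ε, l | ε'⟩ := y <;> rfl

/-- The image of a cycle in the factor attached to `[u]`. -/
def moveU (y : S.Slot × L.Slot) (a : ℕ × ℤˣ) : ℕ × ℤˣ :=
  moveCycle (dilU (y, false)) (pairKind (y, false)) (kind y.1) a

/-- The image of a cycle in the factor attached to `[λ]`. -/
def moveL (y : S.Slot × L.Slot) (a : ℕ × ℤˣ) : ℕ × ℤˣ :=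
  moveCycle (dilL (y, false)) (pairKind (y, false)) (kind y.2) a

lemma pushCycle_U (b : PairIdx S L × (ℕ × ℤˣ)) :
    pushCycle (fun x : PairIdx S L => (x.1.1, x.2)) dilU pairKind (fun x => kind x.1) b =
      ((b.1.1.1, b.1.2), moveU b.1.1 b.2) := by
  obtain ⟨⟨y, δ⟩, a⟩ := b
  rw [pushCycle, moveU, dilU_superscript y δ false, pairKind_superscript y δ false]

lemma pushCycle_L (b : PairIdx S L × (ℕ × ℤˣ)) :
    pushCycle (fun x : PairIdx S L => (x.1.2, x.2)) dilL pairKind (fun x => kind x.1) b =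
      ((b.1.1.2, b.1.2), moveL b.1.1 b.2) := by
  obtain ⟨⟨y, δ⟩, a⟩ := b
  rw [pushCycle, moveL, dilL_superscript y δ false, pairKind_superscript y δ false]

lemma isCycleOf_moveU (hU : ∀ x : PairIdx S L, 0 < dilU x) (y : S.Slot × L.Slot) {a : ℕ × ℤˣ}
    (ha : IsCycleOf (pairKind (y, false)) a) : IsCycleOf (kind y.1) (moveU y a) := by
  have h1 : 0 < (moveU y a).1 := by
    rw [moveU, moveCycle_fst]
    exact Nat.mul_pos (hU _) ha.pos
  obtain ⟨u | ε, l | ε'⟩ := y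
  · exact ⟨h1, ha.2⟩
  · exact ⟨h1, ha.2⟩
  · exact h1
  · exact h1

open scoped Classical in
/-- The product of the signs of the cycles in the slot `ε` with the superscript `δ`. -/
def signAt {X : Type*} [Fintype X] (l : X → L.Slot) (j : X → Bool) (a : X → ℕ × ℤˣ)
    (δ : Bool) (ε : ℤˣ) : ℤˣ :=
  ∏ x, if l x = .inr ε ∧ j x = δ then (a x).2 else 1

/-- A cycle of length `α` coming from a packet `u ≠ ±1` acquires the sign `(-1)^α` in the slot `ε'`,
and these signs multiply to `(-1)^ν`. Thus `χ^δ_{ε'}` is the value of `sgn_CD` at the image, and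
depends on the target cycles only. -/
lemma chiSign_eq {ν : PairIdx S L → ℕ} (w : WProd pairKind ν) (ε' : ℤˣ) (δ : Bool)
    [DecidableEq (L.Slot × Bool)] :
    chiSign ε' δ ν w = (((labelledCycles w).map (pushCycle (fun x : PairIdx S L => (x.1.2, x.2))
      dilL pairKind fun x => kind x.1)).map fun b => if b.1 = (.inr ε', δ) then b.2.2 else 1).prod := by
  classical
  rw [Multiset.map_map, map_labelledCycles_prod, Fintype.prod_prod_type, Fintype.prod_prod_type]
  have h1 (u : S.Slot) : ∏ l : L.Slot, ∏ δ' : Bool, ((cycles (w ((u, l), δ'))).map fun a =>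
      ((fun b : (L.Slot × Bool) × (ℕ × ℤˣ) => if b.1 = (.inr ε', δ) then b.2.2 else 1) ∘
        pushCycle (fun x : PairIdx S L => (x.1.2, x.2)) dilL pairKind fun x => kind x.1)
          (((u, l), δ'), a)).prod =
      ((cycles (w ((u, .inr ε'), δ))).map fun a => (moveL (S := S) (L := L) (u, .inr ε') a).2).prod := by
    rw [Finset.prod_eq_single (.inr ε'), Finset.prod_eq_single δ]
    · simp [pushCycle_L]
    · intro δ' _ h
      simp [pushCycle_L, h]
    · simp
    · intro l _ h
      simp [pushCycle_L, h]
    · simp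
  rw [Finset.prod_congr rfl fun u _ => h1 u, Fintype.prod_sum_type, chiSign]
  congr 1
  · rw [← Finset.prod_pow_eq_pow_sum]
    exact Finset.prod_congr rfl fun u _ => (prod_neg_one_pow_length _).symm
  · exact Finset.prod_congr rfl fun ε _ => sgnCD_eq_prod _

/-- The product of the contributions `χ'_cusp` and `χ''_cusp`, as a function of the signs
`χ^δ_ε`. -/
def cuspFactor (q x' x'' : ℕ) (c : CuspDatum) (η : DiscSigns) (χ : Bool → ℤˣ → ℤˣ) : ℂ :=
  ((q : ℂ) ^ x' * sgnC ((-1) ^ ((q - 1) * (c.rOdd - 1) / 4) *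
    (χ false 1 * χ false (-1) * η.η' 1 * η.η' (-1)) ^ ((c.I c.εI - 1) / 2) *
    if c.εI = 1 then 1 else η.η' (-1) * χ false (-1))) *
  ((q : ℂ) ^ x'' * sgnC ((-1 : ℤˣ) ^ (ySigned c.flip * ((q : ℤ) - 1) / 4) *
    (η.η'' 1 * η.η'' (-1) * χ true 1 * χ true (-1)) ^ ((c.I c.εP - 1) / 2) *
    if c.ζ c.εP = 1 then
      if c.εP = 1 then 1 else η.η'' (-1) * χ true (-1)
    else
      if c.εP = 1 then η.η'' 1 * η.η'' (-1) * χ true 1 * χ true (-1)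
      else η.η'' 1 * χ true 1))

lemma sum_fiber_U (ν : PairIdx S L → ℕ) (x : S.Slot × Bool)
    [DecidablePred fun y : PairIdx S L => (y.1.1, y.2) = x] :
    ∑ y ∈ Finset.univ.filter (fun y : PairIdx S L => (y.1.1, y.2) = x), ν y * dilU y =
      sumU ν x := by
  obtain ⟨u, δ⟩ := x
  refine Finset.sum_nbij' (fun y => y.1.2) (fun l => ((u, l), δ)) ?_ ?_ ?_ ?_ ?_
  · simp
  · simp
  · rintro ⟨⟨u', l⟩, δ'⟩ h
    simp only [Finset.mem_filter, Finset.mem_univ, true_and, Prod.mk.injEq] at h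
    simp [h]
  · simp
  · rintro ⟨⟨u', l⟩, δ'⟩ h
    simp only [Finset.mem_filter, Finset.mem_univ, true_and, Prod.mk.injEq] at h
    simp [h]

lemma sum_fiber_L (ν : PairIdx S L → ℕ) (x : L.Slot × Bool)
    [DecidablePred fun y : PairIdx S L => (y.1.2, y.2) = x] :
    ∑ y ∈ Finset.univ.filter (fun y : PairIdx S L => (y.1.2, y.2) = x), ν y * dilL y =
      sumL ν x := by
  obtain ⟨l, δ⟩ := x
  refine Finset.sum_nbij' (fun y => y.1.1) (fun u => ((u, l), δ)) ?_ ?_ ?_ ?_ ?_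
  · simp
  · simp
  · rintro ⟨⟨u, l'⟩, δ'⟩ h
    simp only [Finset.mem_filter, Finset.mem_univ, true_and, Prod.mk.injEq] at h
    simp [h]
  · simp
  · rintro ⟨⟨u, l'⟩, δ'⟩ h
    simp only [Finset.mem_filter, Finset.mem_univ, true_and, Prod.mk.injEq] at h
    simp [h]

/-! ### Localisation as a sum over liftings. -/

variable {X : Type*} [Fintype X] [DecidableEq X]

open scoped Classical in
/-- The liftings of the cycles `a` in the slots `l` to the groups `𝒲_ν`. -/
def liftings (S : SpectralDatum) (l : X → L.Slot) (a : X → ℕ × ℤˣ) :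
    Finset (X → (S.Slot × L.Slot) × (ℕ × ℤˣ)) :=
  Fintype.piFinset fun x =>
    (Finset.univ ×ˢ (Finset.range ((a x).1 + 1) ×ˢ Finset.univ)).filter fun y =>
      y.1.2 = l x ∧ moveL y.1 y.2 = a x ∧ IsCycleOf (pairKind (y.1, false)) y.2

lemma mem_liftings {l : X → L.Slot} {a : X → ℕ × ℤˣ} (ha : ∀ x, 0 < (a x).1)
    {p : X → (S.Slot × L.Slot) × (ℕ × ℤˣ)} : p ∈ liftings S l a ↔
      ∀ x, (p x).1.2 = l x ∧ moveL (p x).1 (p x).2 = a x ∧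
        IsCycleOf (pairKind ((p x).1, false)) (p x).2 := by
  classical
  rw [liftings, Fintype.mem_piFinset]
  refine forall_congr' fun x => ?_
  simp only [Finset.mem_filter, Finset.mem_product, Finset.mem_univ, true_and,
    Finset.mem_range, and_true, and_iff_right_iff_imp]
  rintro ⟨-, h, -⟩
  have h1 := ha x
  rw [← h, moveL, moveCycle_fst] at h1 ⊢
  have : 0 < dilL (((p x).1, false) : PairIdx S L) := Nat.pos_of_mul_pos_right h1
  nlinarith

/-- `sum_ind` applies, since the summand is a function of the labelled cycles upstairs. The cuspidal
factor comes out of the sum because it depends only on the cycles below. The law `hT` is required: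
off the law the left side is `0` by default, while the right side has no reason to vanish. -/
theorem value_loc {q : ℕ} (hq : Odd q) (hL : ∀ x : PairIdx S L, 0 < dilL x) (x' x'' : ℕ)
    (ct : CuspDatum) (η : DiscSigns) (φ : Graded (symbolLaw S ct)) {l : X → L.Slot}
    {a : X → ℕ × ℤˣ} (ha : ∀ x, IsCycleOf (kind (l x)) (a x))
    (hT : ∀ s, greenLaw L ct s (slotRank l a s)) (j : X → Bool) :
    (loc q x' x'' ct η φ).value l j a = cuspFactor q x' x'' ct.flip η (signAt l j a) *
      ∑ p ∈ liftings S l a, (∏ x, chiLocal q ((p x).1, false) (p x).2 *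
        ((cycleWeight (kind (l x)) (a x) : ℂ) /
          cycleWeight (pairKind ((p x).1, false)) (p x).2)) *
        φ.value (fun x => (p x).1.1) j (fun x => moveU (p x).1 (p x).2) := by
  classical
  obtain ⟨m, c, hc, hm⟩ := exists_class ha j
  have h1 : ∀ s, greenLaw L ct s (m (s, false) + m (s, true)) := fun s => by
    rw [hm]; exact hT s
  let CF (M : Multiset ((L.Slot × Bool) × (ℕ × ℤˣ))) : ℂ := cuspFactor q x' x'' ct.flip η
    fun δ ε => (M.map fun b => if b.1 = (.inr ε, δ) then b.2.2 else 1).prod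
  have hCF : CF (Finset.univ.val.map fun x => ((l x, j x), a x)) =
      cuspFactor q x' x'' ct.flip η (signAt l j a) := by
    simp only [CF]
    congr 1
    funext δ ε
    rw [Multiset.map_map, signAt]
    refine Finset.prod_congr rfl fun x _ => ?_
    simp only [Function.comp_apply, Prod.mk.injEq]
  have hres : (loc q x' x'' ct η φ) ⟨m, h1⟩ = ∑ ν ∈ pairFamilies (S := S) m,
      ind (t' := pairKind) (ν := ν) (fun x => (x.1.2, x.2)) dilL fun c =>
      onClass (fun w => chiCusp' q x' ct.flip η ν w * chiCusp'' q x'' ct.flip η ν w *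
        ∏ x : PairIdx S L, chiFun q x (w x)) c *
      res (t' := pairKind) (fun x => (x.1.1, x.2)) dilU (φ.comp (sumU ν)) c := rfl
  rw [value_eq _ c hc, comp_of_law _ h1, hres, Finset.sum_apply, sum_ind (t' := pairKind) _ _ c
    (fun x => ((l x, j x), a x)) hc.symm
    (fun M => CF (M.map (pushCycle (fun x : PairIdx S L => (x.1.2, x.2))
      dilL pairKind fun x => kind x.1)) * (M.map fun b => chiLocal q b.1 b.2).prod * evalCycles
        (φ.comp (rankAt (M.map (pushCycle (fun x : PairIdx S L => (x.1.1, x.2)) dilU pairKind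
          fun x => kind x.1))))
        (M.map (pushCycle (fun x : PairIdx S L => (x.1.1, x.2)) dilU pairKind fun x => kind x.1)))]
  · rw [Finset.mul_sum]
    have hpos (x : X) : 0 < (((l x, j x), a x) : (L.Slot × Bool) × (ℕ × ℤˣ)).2.1 := (ha x).pos
    symm
    refine Finset.sum_bij (fun p _ x => (((p x).1, j x), (p x).2)) ?_ ?_ ?_ ?_
    · intro p hp
      rw [mem_liftings hpos] at hp
      rw [Fintype.mem_piFinset]
      intro x
      obtain ⟨h2, h3, h4⟩ := hp x
      rw [mem_cycleFiber _ _ (hpos x), pushCycle_L, pairKind_superscript _ _ false]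
      exact ⟨Prod.ext (Prod.ext h2 rfl) h3, h4⟩
    · intro p _ p' _ h
      funext x
      have := congrFun h x
      simp only [Prod.mk.injEq] at this
      exact Prod.ext this.1.1 this.2
    · intro p hp
      rw [Fintype.mem_piFinset] at hp
      have hp' (x : X) := (mem_cycleFiber _ _ (hpos x)).1 (hp x)
      simp only [pushCycle_L, Prod.mk.injEq] at hp'
      refine ⟨fun x => ((p x).1.1, (p x).2), (mem_liftings hpos).2 fun x => ?_,
        funext fun x => ?_⟩
      · obtain ⟨⟨⟨h2, h3⟩, h4⟩, h5⟩ := hp' x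
        exact ⟨h2, h4, (pairKind_superscript (p x).1.1 (p x).1.2 false) ▸ h5⟩
      · exact Prod.ext (Prod.ext rfl (hp' x).1.1.2.symm) rfl
    · intro p hp
      rw [mem_liftings hpos] at hp
      have h2 : (Finset.univ.val.map fun x => (((p x).1, j x), (p x).2)).map
          (pushCycle (fun x : PairIdx S L => (x.1.2, x.2)) dilL pairKind fun x => kind x.1) =
          Finset.univ.val.map fun x => ((l x, j x), a x) := by
        rw [Multiset.map_map]
        refine Multiset.map_congr rfl fun x _ => ?_
        rw [Function.comp_apply, pushCycle_L]
        exact Prod.ext (Prod.ext (hp x).1 rfl) (hp x).2.1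
      have h3 : (Finset.univ.val.map fun x => (((p x).1, j x), (p x).2)).map
          (pushCycle (fun x : PairIdx S L => (x.1.1, x.2)) dilU pairKind fun x => kind x.1) =
          Finset.univ.val.map fun x => (((p x).1.1, j x), moveU (p x).1 (p x).2) := by
        rw [Multiset.map_map]
        refine Multiset.map_congr rfl fun x _ => ?_
        rw [Function.comp_apply, pushCycle_U]
      have h4 : (((Finset.univ.val.map fun x => (((p x).1, j x), (p x).2)).map
          fun b => chiLocal q b.1 b.2).prod : ℂ) =
          ∏ x, chiLocal q ((p x).1, false) (p x).2 := by
        rw [Multiset.map_map]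
        exact Finset.prod_congr rfl fun x _ => chiLocal_superscript q _ _ _ _
      have h5 : ∏ x, ((cycleWeight (kind (l x)) (a x) : ℂ) /
          cycleWeight (pairKind ((p x).1, j x)) (p x).2) =
          ∏ x, ((cycleWeight (kind (l x)) (a x) : ℂ) /
            cycleWeight (pairKind ((p x).1, false)) (p x).2) :=
        Finset.prod_congr rfl fun x _ => by rw [pairKind_superscript (p x).1 (j x) false]
      rw [h2, h3, h4, hCF, Finset.prod_mul_distrib, ← h5, Graded.value]
      ring
  · intro ν hν
    have h2 (x : L.Slot × Bool) : sumL ν x = m x := by rw [← hν x, sum_fiber_L]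
    rw [pairFamilies, Finset.mem_filter, Fintype.mem_piFinset]
    refine ⟨?_, funext h2⟩
    rintro ⟨⟨u, s⟩, δ⟩
    -- Positive dilatations give `ν ≤ m`, so the finite range in `pairFamilies` is large enough.
    rw [Finset.mem_range, ← h2, Nat.lt_succ_iff, sumL]
    refine le_trans ?_ (Finset.single_le_sum (f := fun u => ν ((u, s), δ) * dilL ((u, s), δ))
      (fun _ _ => Nat.zero_le _) (Finset.mem_univ u))
    exact Nat.le_mul_of_pos_right _ (hL _)
  · intro ν _ c'
    rw [res_comp_eq]
    · congr 1
      refine onClass_eq (F := fun M => CF (M.map (pushCycle (fun x : PairIdx S L => (x.1.2, x.2))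
        dilL pairKind fun x => kind x.1)) * (M.map fun b => chiLocal q b.1 b.2).prod)
        (fun w => ?_) c'
      simp only [CF]
      congr 1
      · simp only [← chiSign_eq]
        rfl
      · rw [map_labelledCycles_prod]
        exact Finset.prod_congr rfl fun x _ => chiFun_eq hq x _
    · funext x
      rw [rankAt_map_pushCycle, rankAt_classCycles, sum_fiber_U]

end loc

/-! ### Spectral data -/

/-- The packet contains the distinct elements `u` and `u⁻¹`. It must also be shown finite, as
`ncard` is `0` on infinite sets; it consists of roots of unity of bounded order. -/
lemma two_le_ncard_frobOrbit {p q : ℕ} {P : ℂ[X]} (hP : TameSelfDual p q P) {u : ℂ}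
    (hu : u ∈ P.roots) (h1 : u ≠ 1) (h2 : u ≠ -1) : 2 ≤ (frobOrbit q u).ncard := by
  obtain ⟨⟨k, hk, -, huk⟩, hinv⟩ := hP u hu
  have hu0 : u ≠ 0 := by
    rintro rfl
    rw [zero_pow hk.ne'] at huk
    exact zero_ne_one huk
  have hne : u ≠ u⁻¹ := by
    intro h
    have h3 : u * u = 1 := by
      nth_rewrite 2 [h]
      exact mul_inv_cancel₀ hu0
    rcases mul_self_eq_one_iff.1 h3 with h | h
    · exact h1 h
    · exact h2 h
  have hfin : (frobOrbit q u).Finite := by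
    refine Set.Finite.subset (Polynomial.nthRoots k (1 : ℂ)).toFinset.finite_toSet ?_
    rintro v ⟨a, rfl⟩
    rw [Finset.mem_coe, Multiset.mem_toFinset, Polynomial.mem_nthRoots hk, ← pow_mul, mul_comm,
      pow_mul, huk, one_pow]
  rw [← Set.ncard_pair hne]
  refine Set.ncard_le_ncard ?_ hfin
  rintro v (rfl | rfl)
  · exact ⟨0, by simp⟩
  · exact hinv

lemma ell_ofCharpoly_pos {p q : ℕ} {P : ℂ[X]} (hP : TameSelfDual p q P)
    (c : (SpectralDatum.ofCharpoly q P).packets) : 0 < (SpectralDatum.ofCharpoly q P).ell c := by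
  obtain ⟨c, u, hu, h1, h2, rfl⟩ := c
  exact Nat.div_pos (two_le_ncard_frobOrbit hP hu h1 h2) two_pos

lemma odd_natCard {k : Type*} [Field k] [Finite k] (h : ringChar k ≠ 2) : Odd (Nat.card k) := by
  have := Fintype.ofFinite k
  rw [Nat.card_eq_fintype_card, Nat.odd_iff]
  exact FiniteField.odd_card_of_char_ne_two h

lemma parityFactor_pos (a b : ℕ) : 0 < parityFactor a b := by
  rw [parityFactor]; split_ifs <;> norm_num

/-- Equal valuations of `a` and `b` remain equal after division by the gcd, and the two coprime
quotients cannot both be even. -/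
lemma odd_div_gcd {a b : ℕ} (ha : 0 < a) (hb : 0 < b) (h : padicValNat 2 a = padicValNat 2 b) :
    Odd (a / Nat.gcd a b) := by
  have hd : 0 < Nat.gcd a b := Nat.gcd_pos_of_pos_left b ha
  have ha' : 0 < a / Nat.gcd a b := Nat.div_pos (Nat.gcd_le_left b ha) hd
  have hb' : 0 < b / Nat.gcd a b := Nat.div_pos (Nat.gcd_le_right a hb) hd
  have e1 := Nat.div_mul_cancel (Nat.gcd_dvd_left a b)
  have e2 := Nat.div_mul_cancel (Nat.gcd_dvd_right a b)
  have hcop : Nat.Coprime (a / Nat.gcd a b) (b / Nat.gcd a b) := Nat.coprime_div_gcd_div_gcd hd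
  have h0 : padicValNat 2 (a / Nat.gcd a b * Nat.gcd a b) =
      padicValNat 2 (b / Nat.gcd a b * Nat.gcd a b) := by rw [e1, e2, h]
  rw [padicValNat.mul ha'.ne' hd.ne', padicValNat.mul hb'.ne' hd.ne',
    Nat.add_right_cancel_iff] at h0
  by_contra hodd
  rw [Nat.not_odd_iff_even, even_iff_two_dvd] at hodd
  have h3 : 1 ≤ padicValNat 2 (a / Nat.gcd a b) := one_le_padicValNat_of_dvd ha'.ne' hodd
  rw [h0] at h3
  have h4 := dvd_of_one_le_padicValNat h3
  have := Nat.dvd_gcd hodd h4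
  rw [hcop] at this
  norm_num at this

section loc

variable {S L : SpectralDatum}

lemma dilU_pos (hL : ∀ l, 0 < L.ell l) (x : PairIdx S L) : 0 < dilU x := by
  obtain ⟨⟨u | ε, l | ε'⟩, δ⟩ := x
  · exact Nat.mul_pos (parityFactor_pos _ _)
      (Nat.div_pos (Nat.gcd_le_right _ (hL l)) (Nat.gcd_pos_of_pos_right _ (hL l)))
  · exact one_pos
  · exact hL l
  · exact one_pos

lemma dilL_pos (hS : ∀ u, 0 < S.ell u) (x : PairIdx S L) : 0 < dilL x := by
  obtain ⟨⟨u | ε, l | ε'⟩, δ⟩ := x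
  · exact Nat.mul_pos (parityFactor_pos _ _)
      (Nat.div_pos (Nat.gcd_le_left _ (hS u)) (Nat.gcd_pos_of_pos_left _ (hS u)))
  · exact hS u
  · exact one_pos
  · exact one_pos

/-- The value of the sign character at a cycle placed in a slot. -/
def slotSign : S.Slot → ℕ × ℤˣ → ℤˣ
  | .inl _, a => (-1) ^ a.1
  | .inr _, a => a.2

/-- Between two packets, the dilatations `f ℓ_λ / d` and `f ℓ_u / d` are both odd when `f = 1` and
both even when `f = 2`. Between a packet and `±1`, the length `α` on one side matches the sign
`(-1)^α` on the other. This is the reason for the factor `f`. -/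
lemma slotSign_move (hS : ∀ u, 0 < S.ell u) (hL : ∀ l, 0 < L.ell l) (y : S.Slot × L.Slot)
    (a : ℕ × ℤˣ) : slotSign y.1 (moveU y a) = slotSign y.2 (moveL y a) := by
  obtain ⟨u | ε, l | ε'⟩ := y
  · change (-1 : ℤˣ) ^ (parityFactor (S.ell u) (L.ell l) *
        (L.ell l / Nat.gcd (S.ell u) (L.ell l)) * a.1) =
      (-1) ^ (parityFactor (S.ell u) (L.ell l) *
        (S.ell u / Nat.gcd (S.ell u) (L.ell l)) * a.1)
    rw [pow_mul _ _ a.1, pow_mul _ _ a.1]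
    congr 1
    by_cases h : padicValNat 2 (S.ell u) = padicValNat 2 (L.ell l)
    · rw [parityFactor, if_pos h, one_mul, one_mul, (odd_div_gcd (hS u) (hL l) h).neg_one_pow,
        Nat.gcd_comm, (odd_div_gcd (hL l) (hS u) h.symm).neg_one_pow]
    · rw [parityFactor, if_neg h, pow_mul, pow_mul]
      simp
  · change (-1 : ℤˣ) ^ (1 * a.1) = (-1) ^ a.1
    rw [one_mul]
  · change (-1 : ℤˣ) ^ a.1 = (-1) ^ (1 * a.1)
    rw [one_mul]
  · rfl

/-! ### The twists in terms of cycles -/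

/-- All the twists have this shape: multiplied over the cycles of a factor, `slotSign` gives `(-1)`
to the rank at a packet and `sgn_CD` at `±1`. -/
lemma twist_eq {Y : Type} [Fintype Y] {r : S.Slot × Y → ℕ} (E : S.Slot × Y → ℕ) (w : 𝒲 r) :
    sgnC ((labelledCycles w).map fun b => slotSign b.1.1 b.2 ^ E b.1).prod =
      (∏ u : S.packets, ∏ y, ((-1 : ℂ) ^ r (.inl u, y)) ^ E (.inl u, y)) *
        ∏ ε : ℤˣ, ∏ y, sgnC (sgnCD (w (.inr ε, y))) ^ E (.inr ε, y) := by
  rw [map_labelledCycles_prod, Fintype.prod_prod_type, Fintype.prod_sum_type, sgnC_mul]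
  simp only [sgnC_prod]
  congr 1
  · refine Finset.prod_congr rfl fun u _ => Finset.prod_congr rfl fun y _ => ?_
    rw [Multiset.prod_map_pow, sgnC_pow]
    congr 1
    have h := prod_neg_one_pow_length (w (.inl u, y))
    refine (congrArg sgnC h).trans ?_
    rw [sgnC_pow]
    simp [sgnC]
  · refine Finset.prod_congr rfl fun ε _ => Finset.prod_congr rfl fun y _ => ?_
    rw [Multiset.prod_map_pow, sgnC_pow, sgnCD_eq_prod]
    rfl

/-- The exponents of the characters in `rhoIota`. -/
def rhoExp (c : CuspDatum) : S.Slot × Bool × Bool → ℕ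
  | (.inl _, true, true) => 1
  | (.inl _, _, _) => 0
  | (.inr _, false, false) => 0
  | (.inr ε, false, true) => minusExp (c.ζ ε)
  | (.inr ε, true, false) => tildeExp c ε
  | (.inr ε, true, true) => tildeExp c ε + plusExp (c.ζ ε)

/-- The exponents of the characters in `rhoIotaGreen`. -/
def greenExp : S.Slot × Bool × Bool → ℕ
  | (_, true, true) => 1
  | (_, _, _) => 0

/-- The exponents of the characters in `tilde`. -/
def tildeSlotExp (c : CuspDatum) : S.Slot × Bool → ℕ
  | (.inr ε, true) => tildeExp c ε
  | (_, _) => 0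

/-- The exponents of the characters in `normalise`. -/
def normaliseExp (c : CuspDatum) : S.Slot × Bool → ℕ
  | (.inr ε, true) => minusExp (c.ζ ε)
  | (_, _) => 0

lemma flip_flip (c : CuspDatum) : c.flip.flip = c := by
  obtain ⟨I, P, ζ, hI, hP⟩ := c
  simp [CuspDatum.flip, ← mul_assoc, ← mul_pow]

lemma symbolLaw_flip (c : CuspDatum) (s : S.Slot) (n : ℕ) :
    symbolLaw S c s n ↔ symbolLaw S c.flip s n := by
  cases s <;> exact Iff.rfl

variable {X : Type*} [Fintype X] [DecidableEq X]

lemma value_rhoIota (c : CuspDatum) (φ : Graded (symbolLaw S c)) {l : X → S.Slot}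
    {a : X → ℕ × ℤˣ} (ha : ∀ x, IsCycleOf (kind (l x)) (a x)) (j : X → Bool) :
    (rhoIota c φ).value l j a = ∑ i : X → Bool,
      sgnC (∏ x, slotSign (l x) (a x) ^ rhoExp c (l x, i x, j x)) * φ.value l i a := by
  refine value_resInd (f := fun b => slotSign b.1.1 b.2 ^ rhoExp c b.1)
    (symbolLaw_flip c) (fun m w => ?_) φ ha j
  rw [twist_eq]
  simp only [Fintype.prod_prod_type, Fintype.prod_bool, rhoExp, pow_one, pow_zero, mul_one]
  congr 1
  refine Finset.prod_congr rfl fun ε _ => ?_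
  ring

lemma value_rhoIotaGreen {T : L.Slot → ℕ → Prop} (ψ : Graded T) {l : X → L.Slot}
    {a : X → ℕ × ℤˣ} (ha : ∀ x, IsCycleOf (kind (l x)) (a x)) (j : X → Bool) :
    (rhoIotaGreen ψ).value l j a = ∑ i : X → Bool,
      sgnC (∏ x, slotSign (l x) (a x) ^ greenExp (l x, i x, j x)) * ψ.value l i a := by
  refine value_resInd (f := fun b => slotSign b.1.1 b.2 ^ greenExp b.1)
    (fun _ _ => Iff.rfl) (fun m w => ?_) ψ ha j
  rw [twist_eq]
  simp only [Fintype.prod_prod_type, Fintype.prod_bool, greenExp, pow_one, pow_zero, mul_one]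

lemma value_tilde (c : CuspDatum) (φ : Graded (symbolLaw S c)) {l : X → S.Slot}
    {a : X → ℕ × ℤˣ} (ha : ∀ x, IsCycleOf (kind (l x)) (a x)) (i : X → Bool) :
    (tilde c φ).value l i a =
      sgnC (∏ x, slotSign (l x) (a x) ^ tildeSlotExp c (l x, i x)) * φ.value l i a := by
  refine value_twist (f₀ := fun b => slotSign b.1.1 b.2 ^ tildeSlotExp c b.1) _
    (fun s n => (symbolLaw_flip c s n).1) (fun m w => ?_) φ ha i
  rw [twist_eq]
  simp only [Fintype.prod_bool, tildeSlotExp, pow_zero, mul_one, Finset.prod_const_one, one_mul]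

lemma value_normalise (c : CuspDatum) (φ : Graded (symbolLaw S c.flip)) {l : X → S.Slot}
    {a : X → ℕ × ℤˣ} (ha : ∀ x, IsCycleOf (kind (l x)) (a x)) (i : X → Bool) :
    (normalise c.flip φ).value l i a =
      sgnC (∏ x, slotSign (l x) (a x) ^ normaliseExp c (l x, i x)) * φ.value l i a := by
  refine value_twist (f₀ := fun b => slotSign b.1.1 b.2 ^ normaliseExp c b.1) _
    (fun s n h => h) (fun m w => ?_) φ ha i
  rw [twist_eq]
  simp only [Fintype.prod_bool, normaliseExp, pow_zero, mul_one, Finset.prod_const_one, one_mul,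
    flip_flip]

/-- At `±1` the exponents `minusExp` cancel modulo `2` on `','' `, while on `'',''` they add with
`plusExp` to `1`, the exponent on the side of `g`. What is left is the exponent of `~`, which
depends on `i` only. -/
lemma normalise_mul_rho (c : CuspDatum) (s : S.Slot) (i j : Bool) (z : ℤˣ) :
    z ^ normaliseExp c (s, j) * z ^ rhoExp c (s, i, j) =
      z ^ tildeSlotExp c (s, i) * z ^ greenExp (s, i, j) := by
  have hz : z * z = 1 := Int.units_mul_self z
  rcases s with u | ε
  · cases i <;> cases j <;> simp [normaliseExp, rhoExp, tildeSlotExp, greenExp]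
  · rcases Int.units_eq_one_or (c.ζ ε) with h | h <;> cases i <;> cases j <;>
      simp [normaliseExp, rhoExp, tildeSlotExp, greenExp, h, minusExp, plusExp, pow_succ, hz,
        mul_comm]

end loc

/-! ### The identity of signs -/

/-- The part of `cuspFactor` which depends on the signs `χ^δ_ε`. -/
def coreSign (εI εP ζ : ℤˣ) (k k' : ℕ) (χ : Bool → ℤˣ → ℤˣ) : ℤˣ :=
  ((χ false 1 * χ false (-1)) ^ k * if εI = 1 then 1 else χ false (-1)) *
  ((χ true 1 * χ true (-1)) ^ k' * if ζ = 1 then if εP = 1 then 1 else χ true (-1)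
    else if εP = 1 then χ true 1 * χ true (-1) else χ true 1)

/-- Powers of `q`, constant signs and the discriminants `η` do not depend on superscripts; they
split off multiplicatively and are common to both sides. -/
lemma cuspFactor_eq (q x' x'' : ℕ) (c : CuspDatum) (η : DiscSigns) (χ : Bool → ℤˣ → ℤˣ) :
    cuspFactor q x' x'' c η χ = cuspFactor q x' x'' c η (fun _ _ => 1) *
      sgnC (coreSign c.εI c.εP (c.ζ c.εP) ((c.I c.εI - 1) / 2) ((c.I c.εP - 1) / 2) χ) := by
  simp only [cuspFactor, coreSign, mul_pow, sgnC_mul, sgnC_pow, sgnC_one, one_pow]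
  split_ifs <;> simp only [sgnC_mul, sgnC_one] <;> ring

/-- The products of signs over the columns of a square. -/
def colSign (Q : Bool → Bool → ℤˣ → ℤˣ) (δ : Bool) (ε : ℤˣ) : ℤˣ := Q false δ ε * Q true δ ε

/-- The products of signs over the rows of a square. -/
def rowSign (Q : Bool → Bool → ℤˣ → ℤˣ) (δ : Bool) (ε : ℤˣ) : ℤˣ := Q δ false ε * Q δ true ε

lemma units_pow_even {k : ℕ} (h : Even k) (z : ℤˣ) : z ^ k = 1 := by
  obtain ⟨m, rfl⟩ := h
  rw [pow_add, Int.units_mul_self]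

lemma units_pow_odd {k : ℕ} (h : ¬ Even k) (z : ℤˣ) : z ^ k = z := by
  obtain ⟨m, rfl⟩ := Nat.not_even_iff_odd.1 h
  rw [pow_succ, units_pow_even (even_two_mul m), one_mul]

/-- Lets `decide` treat a reverted sign that no longer occurs in the goal. -/
instance decidableForallUnitsConst (P : Prop) [Decidable P] : Decidable (ℤˣ → P) :=
  decidable_of_iff P ⟨fun h _ => h, fun h => h 1⟩

/-- Here `coreSign` involves only the products `χ'_ε χ''_ε`, and the product of all four entries of
a table is the same by rows and by columns. -/
lemma coreSign_col_eq_row (Q : Bool → Bool → ℤˣ → ℤˣ) (ε : ℤˣ) (k : ℕ) :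
    coreSign ε ε 1 k k (colSign Q) = coreSign ε ε 1 k k (rowSign Q) := by
  simp only [coreSign, colSign, rowSign, if_true]
  generalize Q false false 1 = a
  generalize Q false true 1 = b
  generalize Q true false 1 = c
  generalize Q true true 1 = d
  generalize Q false false (-1) = a'
  generalize Q false true (-1) = b'
  generalize Q true false (-1) = c'
  generalize Q true true (-1) = d'
  by_cases hk : Even k
  · simp only [units_pow_even hk]
    split_ifs <;> revert a b c d a' b' c' d' <;> decide
  · simp only [units_pow_odd hk]
    split_ifs <;> revert a b c d a' b' c' d' <;> decide

/-- For `ζ = -1` the symmetric expression of the previous case is multiplied by `χ''_+ χ''_-`. The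
column products `χ''` differ from the entries `'',''` by the entries `',''`, which are what the
twist sees after exchanging `i` in both slots; the row products are the twist in `X_+ X_-`. -/
lemma coreSign_swap_both (Q : Bool → Bool → ℤˣ → ℤˣ) (ε : ℤˣ) (k : ℕ) :
    coreSign ε ε (-1) k k (colSign Q) * (Q true true 1 * Q true true (-1)) =
      Q false true 1 * Q false true (-1) * (rowSign Q true 1 * rowSign Q true (-1)) *
        coreSign ε ε (-1) k k (rowSign Q) := by
  have hne : (-1 : ℤˣ) ≠ 1 := by decide
  simp only [coreSign, colSign, rowSign, hne, if_false]
  generalize Q false false 1 = a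
  generalize Q false true 1 = b
  generalize Q true false 1 = c
  generalize Q true true 1 = d
  generalize Q false false (-1) = a'
  generalize Q false true (-1) = b'
  generalize Q true false (-1) = c'
  generalize Q true true (-1) = d'
  by_cases hk : Even k
  · simp only [units_pow_even hk]
    split_ifs <;> revert a b c d a' b' c' d' <;> decide
  · simp only [units_pow_odd hk]
    split_ifs <;> revert a b c d a' b' c' d' <;> decide

/-- Compare modulo `2` the exponents of `χ'_ε` and `χ''_ε` in `coreSign`: their sum is odd exactly
at `ε = ζ (-1)^m`. Only that slot breaks the symmetry between rows and columns, so it is the one to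
be exchanged. -/
lemma coreSign_swap_one (Q : Bool → Bool → ℤˣ → ℤˣ) {εI εP : ℤˣ} (h : εI ≠ εP) (ζ : ℤˣ)
    {k k' m : ℕ} (hm : k + k' + 1 = m) :
    coreSign εI εP ζ k k' (colSign Q) * (Q true true (ζ * (-1) ^ m) *
        Q true true (-(ζ * (-1) ^ m))) =
      Q false true (ζ * (-1) ^ m) * Q true true (-(ζ * (-1) ^ m)) *
        rowSign Q true (ζ * (-1) ^ m) * coreSign εI εP ζ k k' (rowSign Q) := by
  have hne : (-1 : ℤˣ) ≠ 1 := by decide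
  subst hm
  have hI : εI = -εP := by
    revert h
    revert εI εP
    decide
  subst hI
  have e : (-1 : ℤˣ) ^ (k + k' + 1) = -((-1) ^ k * (-1) ^ k') := by
    rw [pow_succ, pow_add, mul_neg_one]
  rw [e]
  by_cases hk : Even k <;> by_cases hk' : Even k' <;>
    rcases Int.units_eq_one_or ζ with rfl | rfl <;>
    rcases Int.units_eq_one_or εP with rfl | rfl <;>
    simp only [coreSign, colSign, rowSign, hne, if_false, if_true, neg_neg, one_mul, mul_one,
      units_pow_even, units_pow_odd, hk, hk', not_false_eq_true, mul_neg] <;>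
    generalize Q false false 1 = a <;>
    generalize Q false true 1 = b <;>
    generalize Q true false 1 = c <;>
    generalize Q true true 1 = d <;>
    generalize Q false false (-1) = a' <;>
    generalize Q false true (-1) = b' <;>
    generalize Q true false (-1) = c' <;>
    generalize Q true true (-1) = d' <;>
    revert a b c d a' b' c' d' <;>
    decide

/-! ### Comparison of both sides with `X_cusp`, and the end of the proof. -/

section main

variable {S L : SpectralDatum} {X : Type*} [Fintype X] [DecidableEq X]

open scoped Classical in
/-- The product of the signs of the cycles in the slot `ε` with superscripts `b`, `b'`. -/
def quadSign (l : X → L.Slot) (i j : X → Bool) (a : X → ℕ × ℤˣ) (b b' : Bool) (ε : ℤˣ) : ℤˣ :=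
  ∏ x, if l x = .inr ε ∧ i x = b ∧ j x = b' then (a x).2 else 1

open scoped Classical in
/-- The contribution of the eigenvalues other than `±1` to the twist of `rhoIotaGreen`. -/
def packetSign (l : X → L.Slot) (i j : X → Bool) (a : X → ℕ × ℤˣ) : ℤˣ :=
  ∏ x, if ∃ u, l x = .inl u then slotSign (l x) (a x) ^ greenExp (l x, i x, j x) else 1

lemma colSign_quadSign (l : X → L.Slot) (i j : X → Bool) (a : X → ℕ × ℤˣ) :
    colSign (quadSign l i j a) = signAt l j a := by
  classical
  funext δ ε
  rw [colSign, quadSign, quadSign, signAt, ← Finset.prod_mul_distrib]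
  refine Finset.prod_congr rfl fun x _ => ?_
  by_cases h : l x = .inr ε <;> by_cases h' : j x = δ <;> cases i x <;> simp [h, h']

lemma rowSign_quadSign (l : X → L.Slot) (i j : X → Bool) (a : X → ℕ × ℤˣ) :
    rowSign (quadSign l i j a) = signAt l i a := by
  classical
  funext δ ε
  rw [rowSign, quadSign, quadSign, signAt, ← Finset.prod_mul_distrib]
  refine Finset.prod_congr rfl fun x _ => ?_
  by_cases h : l x = .inr ε <;> by_cases h' : i x = δ <;> cases j x <;> simp [h, h']

/-- Two distinct signs exhaust `±1`, so the twist splits into the packets and the two special slots;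
an exchange at `ε` then affects the factor of `ε` alone. -/
lemma greenSign_eq (l : X → L.Slot) (i j : X → Bool) (a : X → ℕ × ℤˣ) {ε ε' : ℤˣ} (h : ε ≠ ε') :
    ∏ x, slotSign (l x) (a x) ^ greenExp (l x, i x, j x) =
      packetSign l i j a * (quadSign l i j a true true ε * quadSign l i j a true true ε') := by
  classical
  rw [packetSign, quadSign, quadSign, ← Finset.prod_mul_distrib, ← Finset.prod_mul_distrib]
  refine Finset.prod_congr rfl fun x _ => ?_
  rcases hx : l x with u | δ
  · simp
  · have hδ : δ = ε ∨ δ = ε' := by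
      rcases Int.units_eq_one_or ε with rfl | rfl <;> rcases Int.units_eq_one_or ε' with rfl | rfl <;>
        rcases Int.units_eq_one_or δ with rfl | rfl <;> simp_all
    rcases hδ with rfl | rfl <;> cases i x <;> cases j x <;> simp [greenExp, slotSign, h, h.symm]

lemma swapAt_of_eq {l : X → L.Slot} {i : X → Bool} {x : X} {ε : ℤˣ} (h : l x = .inr ε) :
    swapAt ε l i x = !i x := by
  simp [swapAt, swapIdx, h, isSlot]

lemma swapAt_of_ne {l : X → L.Slot} {i : X → Bool} {x : X} {ε : ℤˣ} (h : l x ≠ .inr ε) :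
    swapAt ε l i x = i x := by
  rw [swapAt, swapIdx]
  rcases hx : l x with u | δ
  · simp [isSlot]
  · have : δ ≠ ε := by
      rintro rfl
      exact h hx
    simp [isSlot, this]

lemma quadSign_swapAt_self (l : X → L.Slot) (i j : X → Bool) (a : X → ℕ × ℤˣ) (b b' : Bool)
    (ε : ℤˣ) : quadSign l (swapAt ε l i) j a b b' ε = quadSign l i j a (!b) b' ε := by
  classical
  refine Finset.prod_congr rfl fun x _ => ?_
  by_cases h : l x = .inr ε
  · simp only [swapAt_of_eq h, Bool.not_eq_eq_eq_not]
  · simp [h]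

lemma quadSign_swapAt_of_ne (l : X → L.Slot) (i j : X → Bool) (a : X → ℕ × ℤˣ) (b b' : Bool)
    {ε ε' : ℤˣ} (hε : ε ≠ ε') :
    quadSign l (swapAt ε l i) j a b b' ε' = quadSign l i j a b b' ε' := by
  classical
  refine Finset.prod_congr rfl fun x _ => ?_
  by_cases h : l x = .inr ε'
  · rw [swapAt_of_ne (by rw [h]; simpa using hε.symm)]
  · simp [h]

lemma packetSign_swapAt (l : X → L.Slot) (i j : X → Bool) (a : X → ℕ × ℤˣ) (ε : ℤˣ) :
    packetSign l (swapAt ε l i) j a = packetSign l i j a := by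
  classical
  refine Finset.prod_congr rfl fun x _ => ?_
  by_cases h : ∃ u, l x = .inl u
  · rw [swapAt_of_ne (by obtain ⟨u, hu⟩ := h; rw [hu]; simp)]
  · simp [h]

lemma signAt_swapAt_of_ne (l : X → L.Slot) (i : X → Bool) (a : X → ℕ × ℤˣ) (b : Bool)
    {ε ε' : ℤˣ} (hε : ε ≠ ε') : signAt l (swapAt ε l i) a b ε' = signAt l i a b ε' := by
  classical
  refine Finset.prod_congr rfl fun x _ => ?_
  by_cases h : l x = .inr ε'
  · rw [swapAt_of_ne (by rw [h]; simpa using hε.symm)]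
  · simp [h]

lemma value_XSign_swapAt {T : L.Slot → ℕ → Prop} (ε : ℤˣ) (ψ : Graded T) {l : X → L.Slot}
    {a : X → ℕ × ℤˣ} (ha : ∀ x, IsCycleOf (kind (l x)) (a x)) (i : X → Bool) :
    (XSign ε ψ).value l (swapAt ε l i) a = sgnC (signAt l i a true ε) * ψ.value l i a := by
  rw [value_XSign ε ψ ha, swapAt_swapAt, signAt]

lemma swapAt_bijective (ε : ℤˣ) (l : X → L.Slot) :
    Function.Bijective (swapAt ε l : (X → Bool) → X → Bool) :=
  Function.Involutive.bijective (swapAt_swapAt ε l)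

/-- If `ε_I ≠ ε_P` they are `+` and `-` in some order, so both `I_±` occur; the exponents in the
cuspidal factors thereby determine the sign indexing `X_cusp`. -/
lemma half_add_half {c : CuspDatum} (h : c.εI ≠ c.εP) :
    (c.I c.εI - 1) / 2 + (c.I c.εP - 1) / 2 + 1 = CuspDatum.halfSum c.I := by
  obtain ⟨m, hm⟩ := c.odd_I 1
  obtain ⟨m', hm'⟩ := c.odd_I (-1)
  rw [CuspDatum.halfSum, hm, hm']
  rcases Int.units_eq_one_or c.εI with h1 | h1 <;> rcases Int.units_eq_one_or c.εP with h2 | h2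
  · exact absurd (h1.trans h2.symm) h
  · rw [h1, h2, hm, hm']; omega
  · rw [h1, h2, hm, hm']; omega
  · exact absurd (h1.trans h2.symm) h

/-- The value of `X_cusp`, and the comparison of the twists on both sides. -/
lemma exists_XCusp_swap {T : L.Slot → ℕ → Prop} (c : CuspDatum) (ψ : Graded T) {l : X → L.Slot}
    {a : X → ℕ × ℤˣ} (ha : ∀ x, IsCycleOf (kind (l x)) (a x)) (j : X → Bool) :
    ∃ (sw : (X → Bool) → X → Bool) (xs : (X → Bool) → ℤˣ), Function.Bijective sw ∧
      (∀ i, (XCusp c ψ).value l (sw i) a = sgnC (xs i) * ψ.value l i a) ∧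
      ∀ i, coreSign c.εI c.εP (c.ζ c.εP) ((c.I c.εI - 1) / 2) ((c.I c.εP - 1) / 2)
            (signAt l j a) * ∏ x, slotSign (l x) (a x) ^ greenExp (l x, i x, j x) =
          (∏ x, slotSign (l x) (a x) ^ greenExp (l x, sw i x, j x)) * xs i *
            coreSign c.εI c.εP (c.ζ c.εP) ((c.I c.εI - 1) / 2) ((c.I c.εP - 1) / 2)
              (signAt l i a) := by
  have hne : (-1 : ℤˣ) ≠ 1 := by decide
  -- The two cases with a single exchange at once; `ε₀` is the slot singled out by
  -- `coreSign_swap_one`.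
  have one (z ε₀ : ℤˣ) (hεζ : c.εI ≠ c.εP) (hz : c.ζ c.εP = z)
      (hε₀ : ε₀ = z * (-1) ^ CuspDatum.halfSum c.I) (hX : XCusp c ψ = XSign ε₀ ψ) :
      ∃ (sw : (X → Bool) → X → Bool) (xs : (X → Bool) → ℤˣ), Function.Bijective sw ∧
      (∀ i, (XCusp c ψ).value l (sw i) a = sgnC (xs i) * ψ.value l i a) ∧
      ∀ i, coreSign c.εI c.εP (c.ζ c.εP) ((c.I c.εI - 1) / 2) ((c.I c.εP - 1) / 2)
            (signAt l j a) * ∏ x, slotSign (l x) (a x) ^ greenExp (l x, i x, j x) =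
          (∏ x, slotSign (l x) (a x) ^ greenExp (l x, sw i x, j x)) * xs i *
            coreSign c.εI c.εP (c.ζ c.εP) ((c.I c.εI - 1) / 2) ((c.I c.εP - 1) / 2)
              (signAt l i a) := by
    refine ⟨swapAt ε₀ l, fun i => signAt l i a true ε₀, swapAt_bijective ε₀ l, fun i => ?_,
      fun i => ?_⟩
    · rw [hX, value_XSign_swapAt ε₀ ψ ha]
    · have hε : ε₀ ≠ -ε₀ := by
        clear hX hε₀
        revert ε₀
        decide
      have key := coreSign_swap_one (quadSign l i j a) hεζ z (half_add_half hεζ)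
      rw [← hε₀, colSign_quadSign, rowSign_quadSign] at key
      rw [greenSign_eq l i j a hε, greenSign_eq l _ j a hε, packetSign_swapAt,
        quadSign_swapAt_self, quadSign_swapAt_of_ne _ _ _ _ _ _ hε, Bool.not_true, hz,
        mul_left_comm, key]
      simp only [mul_assoc]
  by_cases hεζ : c.εI = c.εP
  · by_cases hζ : c.ζ c.εP = 1
    · refine ⟨id, fun _ => 1, Function.bijective_id, fun i => ?_, fun i => ?_⟩
      · rw [XCusp, if_pos hεζ, if_pos hζ, sgnC_one, one_mul]
        rfl
      · rw [hεζ, hζ, ← colSign_quadSign l i j a, coreSign_col_eq_row, rowSign_quadSign, mul_one,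
          mul_comm]
        rfl
    · have hζ' : c.ζ c.εP = -1 := (Int.units_eq_one_or _).resolve_left hζ
      refine ⟨fun i => swapAt 1 l (swapAt (-1) l i),
        fun i => signAt l i a true 1 * signAt l i a true (-1),
        (swapAt_bijective 1 l).comp (swapAt_bijective (-1) l), fun i => ?_, fun i => ?_⟩
      · rw [XCusp, if_pos hεζ, if_neg hζ, value_XSign_swapAt 1 _ ha,
          value_XSign_swapAt (-1) _ ha, signAt_swapAt_of_ne _ _ _ _ hne, sgnC_mul, mul_assoc]
      · have key := coreSign_swap_both (quadSign l i j a) c.εP ((c.I c.εP - 1) / 2)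
        rw [colSign_quadSign, rowSign_quadSign] at key
        rw [greenSign_eq l i j a hne.symm, greenSign_eq l _ j a hne.symm, packetSign_swapAt,
          packetSign_swapAt, quadSign_swapAt_self, quadSign_swapAt_of_ne _ _ _ _ _ _ hne.symm,
          quadSign_swapAt_self, quadSign_swapAt_of_ne _ _ _ _ _ _ hne, Bool.not_true, hεζ, hζ',
          mul_left_comm, key]
        simp only [mul_assoc]
  · by_cases hζ : c.ζ c.εP = 1
    · exact one 1 _ hεζ hζ (one_mul _).symm (by rw [XCusp, if_neg hεζ, if_pos hζ])
    · exact one (-1) ((-1) ^ (1 + CuspDatum.halfSum c.I)) hεζ ((Int.units_eq_one_or _).resolve_left hζ) (by rw [pow_add, pow_one])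
        (by rw [XCusp, if_neg hεζ, if_neg hζ])

/-- The compatibility of the localisation with the involutions `ρ ∘ ι`. -/
theorem loc_normalise_rhoIota {q : ℕ} (hq : Odd q) (hS : ∀ u, 0 < S.ell u)
    (hL : ∀ l, 0 < L.ell l) (x' x'' : ℕ) (c : CuspDatum) (η : DiscSigns)
    (φ : Graded (symbolLaw S c)) :
    loc (L := L) q x' x'' c.flip η (normalise c.flip (rhoIota c φ)) =
      rhoIotaGreen (XCusp c (loc q x' x'' c.flip η (tilde c φ))) := by
  refine graded_ext fun n l j a ha hT => ?_
  obtain ⟨sw, xs, hsw, hX, key⟩ :=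
    exists_XCusp_swap c (loc (L := L) q x' x'' c.flip η (tilde c φ)) ha j
  -- The outer sum over superscripts is reindexed by `sw`, so that `X_cusp` evaluates `loc` at `i`
  -- rather than at the swapped superscripts.
  rw [value_loc hq (dilL_pos hS) x' x'' _ η _ ha hT, value_rhoIotaGreen _ ha,
    ← hsw.sum_comp]
  simp only [hX, value_loc hq (dilL_pos hS) x' x'' _ η _ ha hT]
  simp only [Finset.mul_sum]
  -- Legitimate because the set of liftings does not depend on `i`.
  rw [Finset.sum_comm]
  refine Finset.sum_congr rfl fun p hp => ?_
  rw [mem_liftings fun x => (ha x).pos] at hp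
  have hcyc (x : Fin n) : IsCycleOf (kind (p x).1.1) (moveU (p x).1 (p x).2) :=
    isCycleOf_moveU (dilU_pos hL) _ (hp x).2.2
  rw [value_normalise c _ hcyc, value_rhoIota c _ hcyc]
  simp only [value_tilde c _ hcyc, Finset.mul_sum]
  refine Finset.sum_congr rfl fun i _ => ?_
  have hgreen : ∏ x, slotSign (p x).1.1 (moveU (p x).1 (p x).2) ^
      greenExp ((p x).1.1, i x, j x) =
      ∏ x, slotSign (l x) (a x) ^ greenExp (l x, i x, j x) := by
    refine Finset.prod_congr rfl fun x _ => ?_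
    rw [slotSign_move hS hL, (hp x).1, (hp x).2.1]
    rcases i x <;> rcases j x <;> rfl
  -- The product over cycles of `normalise_mul_rho`, with the twist of `g` moved from the slots
  -- `[u]` to the slots `[λ]` by `hgreen`.
  have hlocal : (∏ x, slotSign (p x).1.1 (moveU (p x).1 (p x).2) ^
        normaliseExp c ((p x).1.1, j x)) *
      (∏ x, slotSign (p x).1.1 (moveU (p x).1 (p x).2) ^ rhoExp c ((p x).1.1, i x, j x)) =
      (∏ x, slotSign (p x).1.1 (moveU (p x).1 (p x).2) ^ tildeSlotExp c ((p x).1.1, i x)) *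
      ∏ x, slotSign (l x) (a x) ^ greenExp (l x, i x, j x) := by
    rw [← hgreen, ← Finset.prod_mul_distrib, ← Finset.prod_mul_distrib]
    exact Finset.prod_congr rfl fun x _ => normalise_mul_rho c _ _ _ _
  rw [flip_flip, cuspFactor_eq q x' x'' c η (signAt l j a),
    cuspFactor_eq q x' x'' c η (signAt l i a)]
  have h1 := congrArg sgnC hlocal
  have h2 := congrArg sgnC (key i)
  simp only [sgnC_mul] at h1 h2
  -- `h1` replaces the twists on the side of `χ` by those of `~` and of `g`; `h2` then exchanges the
  -- cuspidal sign at `j` for the one at `i`, producing the sign of `X_cusp`.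
  linear_combination (cuspFactor q x' x'' c η (fun _ _ => 1) *
    sgnC (coreSign c.εI c.εP (c.ζ c.εP) ((c.I c.εI - 1) / 2) ((c.I c.εP - 1) / 2)
      (signAt l j a)) * (∏ x, chiLocal q ((p x).1, false) (p x).2 *
        ((cycleWeight (kind (l x)) (a x) : ℂ) /
          cycleWeight (pairKind ((p x).1, false)) (p x).2)) *
      φ.value (fun x => (p x).1.1) i (fun x => moveU (p x).1 (p x).2)) * h1 +
    (cuspFactor q x' x'' c η (fun _ _ => 1) *
      sgnC (∏ x, slotSign (p x).1.1 (moveU (p x).1 (p x).2) ^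
        tildeSlotExp c ((p x).1.1, i x)) * (∏ x, chiLocal q ((p x).1, false) (p x).2 *
        ((cycleWeight (kind (l x)) (a x) : ℂ) /
          cycleWeight (pairKind ((p x).1, false)) (p x).2)) *
      φ.value (fun x => (p x).1.1) i (fun x => moveU (p x).1 (p x).2)) * h2

end main

end LevelZero

end

theorem mainTheorem5
    {F : Type*} [Field F] [CharZero F] [ValuativeRel F] [TopologicalSpace F]
    [IsNonarchimedeanLocalField F]
    (p q n : ℕ) (hp : p = ringChar 𝓀[F]) (hp2 : p ≠ 2) (hq : q = Nat.card 𝓀[F])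
    (ϖ : 𝒪[F]) (hϖ : Irreducible ϖ) (j : F →+* ℂ)
    -- the element of `Sp(2n, ℂ)` which determines `χ`
    (s : Matrix (Fin n ⊕ Fin n) (Fin n ⊕ Fin n) ℂ) (hs : s ∈ Matrix.symplecticGroup (Fin n) ℂ)
    (hs_semisimple : Module.End.IsSemisimple (Matrix.toLin' s))
    (hs_tame : LevelZero.TameSelfDual p q s.charpoly)
    (hs_frob : ∀ u ∈ s.charpoly.roots,
      s.charpoly.rootMultiplicity (u ^ q) = s.charpoly.rootMultiplicity u)
    -- the element `g = g_s` of the special orthogonal group of a quadratic space of dimension `2n+1`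
    {V : Type*} [AddCommGroup V] [Module F V] [FiniteDimensional F V]
    (hV : Module.finrank F V = 2 * n + 1)
    (B : LinearMap.BilinForm F V) (hB_symm : B.IsSymm) (hB : B.Nondegenerate)
    (g : Module.End F V) (hg : ∀ x y, B (g x) (g y) = B x y) (hg_det : LinearMap.det g = 1)
    (hg_semisimple : g.IsSemisimple)
    (hg_tame : LevelZero.TameSelfDual p q (g.charpoly.map j))
    (b : ∀ ε : ℤˣ, LevelZero.AdaptedBasis B ϖ (Module.End.eigenspace g (((ε : ℤ) : F))))
    -- the cuspidal datum, and the exponents in the constant attached to it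
    (cusp : LevelZero.CuspDatum) (hcusp : cusp.Normalized) (x' x'' : ℕ)
    (φ : LevelZero.Graded
      (LevelZero.symbolLaw (LevelZero.SpectralDatum.ofCharpoly q s.charpoly) cusp)) :
    LevelZero.loc (L := LevelZero.SpectralDatum.ofCharpoly q (g.charpoly.map j)) q x' x'' cusp.flip
        (LevelZero.discSigns b) (LevelZero.normalise cusp.flip (LevelZero.rhoIota cusp φ)) =
      LevelZero.rhoIotaGreen (LevelZero.XCusp cusp
        (LevelZero.loc q x' x'' cusp.flip (LevelZero.discSigns b) (LevelZero.tilde cusp φ))) := by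
  have hodd : Odd q := by
    rw [hq]
    exact LevelZero.odd_natCard (hp ▸ hp2)
  exact LevelZero.loc_normalise_rhoIota hodd (LevelZero.ell_ofCharpoly_pos hs_tame)
    (LevelZero.ell_ofCharpoly_pos hg_tame) x' x'' cusp _ φ
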